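/- Let $T>0$, let $\mathbb T^3=\mathbb R^3/\mathbb Z^3$ and $Q_T=(0,T)\times\mathbb T^3$, and let $a_1,a_2,a_3\ge 0$. For every $M\ge 0$ there is a constant $C<\infty$, depending only on $T,a_1,a_2,a_3,M$, such that the following holds. Let $u\in L^2(0,T;W^{1,2}(\mathbb T^3;\mathbb R^3))$ and $G\in L^2(Q_T)$. Let $\rho\in L^2(Q_T)$, $\rho\ge 0$ a.e., be a weak solution of the (possibly damped) continuity equation $$\partial_t\rho+\operatorname{div}(\rho u)+h=0\ \text{ in } Q_T,\qquad \rho(0)=\rho_0,$$ for some $h\in L^1(Q_T)$ with $h\ge 0$ a.e. and some $\rho_0\in L^1(\mathbb T^3)$; that is, for all $\psi\in C^1_c([0,T)\times\mathbb T^3)$, $$\int_0^T\!\!\int_{\mathbb T^3}\bigl(\rho\,\partial_t\psi+\rho\,u\cdot\nabla\psi-h\psi\bigr)\,dx\,dt=-\int_{\mathbb T^3}\rho_0\,\psi(0,\cdot)\,dx .$$ Assume that $\|\nabla u\|_{L^2(Q_T)},\|G\|_{L^2(Q_T)},\|\rho\|_{L^2(Q_T)}\le M$. Set $$\Lambda=a_1+a_2\,\mathcal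 M(|\nabla u|)+a_3|G|,\qquad \mathcal M(f)(x)=\sup_{r>0}\frac1{|B_r(0)|}\int_{B_r(0)}|f(x+z)|\,dz ,$$ where $\mathcal M$ (the maximal function of $f$, regarded as a periodic function on $\mathbb R^3$) acts in the variable $x$ and $|\nabla u|$ is the Frobenius norm. Then there is a function $w\in L^\infty(Q_T)$ with $\Lambda w\in L^1(Q_T)$ which is a weak solution of $$\partial_t w+u\cdot\nabla w+\Lambda w=0,\qquad w(0)=1,$$ that is, for all $\psi\in C^1_c([0,T)\times\mathbb T^3)$, $$\int_0^T\!\!\int_{\mathbb T^3} \bigl(w\,(\partial_t\psi+u\cdot\nabla\psi+\psi\operatorname{div}u)-\Lambda w\psi\bigr)\,dx\,dt=-\int_{\mathbb T^3}\psi(0,\cdot)\,dx ,$$ and which has the following properties: 1. $0\le w(t,x)\le 1$ for every $(t,x)\in Q_T$; 2. $\displaystyle \operatorname*{ess\,sup}_{t\in(0,T)}\int_{\mathbb T^3}\rho(t,x)\,|\log w(t,x)|\,dx\le C$, with the conventions $|\log 0|=+\infty$ and $0\cdot\infty=0$. -/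

import Mathlib

open MeasureTheory Set
open scoped ENNReal NNReal

noncomputable section

/-- The flat torus `𝕋³ = ℝ³ / ℤ³`, with its Haar (Lebesgue) measure `volume`. -/
abbrev T3 : Type := UnitAddTorus (Fin 3)

/-- Euclidean space `ℝ³`. -/
abbrev E3 : Type := EuclideanSpace ℝ (Fin 3)

/-- `3 × 3` matrices with the Frobenius norm; the entry `(i, j)` of `∇u` is `∂_j u_i`. -/
abbrev Mat3 : Type := EuclideanSpace ℝ (Fin 3 × Fin 3)

/-- The covering map `ℝ³ → 𝕋³`. -/
def toT3 (z : E3) : T3 := fun i => (z i : UnitAddCircle)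

/-- Lebesgue measure on the space-time cylinder `(0,T) × 𝕋³`. -/
def spaceTime (T : ℝ) : Measure (ℝ × T3) :=
  ((volume : Measure ℝ).restrict (Ioo 0 T)).prod (volume : Measure T3)

/-- Classical partial derivative in the direction `e_j` on the torus. -/
def torusPartial (j : Fin 3) (φ : T3 → ℝ) (x : T3) : ℝ :=
  deriv (fun s : ℝ => φ (x + toT3 (EuclideanSpace.single j s))) 0

/-- `φ ∈ C¹(𝕋³)`: the periodic lift of `φ` to `ℝ³` is continuously differentiable. -/
def IsTorusC1 (φ : T3 → ℝ) : Prop :=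
  ContDiff ℝ 1 (fun z : E3 => φ (toT3 z))

/-- `g` is the weak partial derivative `∂_j f` on the torus. -/
def HasWeakPartial (j : Fin 3) (f g : T3 → ℝ) : Prop :=
  Integrable f ∧ Integrable g ∧
    ∀ φ : T3 → ℝ, IsTorusC1 φ → ∫ x, f x * torusPartial j φ x = - ∫ x, g x * φ x

/-- `u ∈ L²(0,T; W^{1,2}(𝕋³; ℝ³))`, with (spatial, weak) gradient `Du`. -/
structure IsL2W12 (T : ℝ) (u : ℝ × T3 → E3) (Du : ℝ × T3 → Mat3) : Prop where
  memLp : MemLp u 2 (spaceTime T)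
  memLp_grad : MemLp Du 2 (spaceTime T)
  weak_grad : ∀ᵐ t ∂((volume : Measure ℝ).restrict (Ioo 0 T)), ∀ i j : Fin 3,
    HasWeakPartial j (fun x => u (t, x) i) (fun x => Du (t, x) (i, j))

/-- The (Hardy–Littlewood) maximal function on the torus: the supremum over all radii of the
averages of `|f|`, regarded as a periodic function, over Euclidean balls centred at `x`. -/
def maximalFunction (f : T3 → ℝ) (x : T3) : ℝ≥0∞ :=
  ⨆ (r : ℝ) (_ : 0 < r), ⨍⁻ z in Metric.ball (0 : E3) r, ‖f (x + toT3 z)‖ₑ ∂volume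

/-- `Λ = a₁ + a₂ 𝓜(|∇u|) + a₃ |G|`, where `𝓜` acts in the space variable
(`𝓜(|∇u|)` is finite almost everywhere, so `toReal` only matters on a null set). -/
def weightRate (a₁ a₂ a₃ : ℝ) (Du : ℝ × T3 → Mat3) (G : ℝ × T3 → ℝ) (p : ℝ × T3) : ℝ :=
  a₁ + a₂ * (maximalFunction (fun y => ‖Du (p.1, y)‖) p.2).toReal + a₃ * |G p|

/-- Test functions `ψ ∈ C¹_c([0,T) × 𝕋³)`, extended to all times. -/
structure IsTestFun (T : ℝ) (ψ : ℝ × T3 → ℝ) : Prop where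
  contDiff : ContDiff ℝ 1 (fun q : ℝ × E3 => ψ (q.1, toT3 q.2))
  support : ∃ τ < T, ∀ t x, τ ≤ t → ψ (t, x) = 0

/-- `∂_t ψ`. -/
def timeDeriv (ψ : ℝ × T3 → ℝ) (p : ℝ × T3) : ℝ :=
  deriv (fun s : ℝ => ψ (s, p.2)) p.1

/-- `v · ∇ψ`, where `∇` is the spatial gradient. -/
def dirDeriv (v : ℝ × T3 → E3) (ψ : ℝ × T3 → ℝ) (p : ℝ × T3) : ℝ :=
  ∑ j : Fin 3, v p j * torusPartial j (fun y => ψ (p.1, y)) p.2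

/-- `div u`, the trace of `∇u`. -/
def divergence (Du : ℝ × T3 → Mat3) (p : ℝ × T3) : ℝ :=
  ∑ i : Fin 3, Du p (i, i)

/-- `w ∈ L^∞((0,T) × 𝕋³)` is a weak solution of `∂_t w + u·∇w + Λ w = 0`, `w(0) = w₀`,
the transport term being read as `u·∇w = div(w u) - w div u`. -/
structure IsWeakTransportSol (T : ℝ) (u : ℝ × T3 → E3) (Du : ℝ × T3 → Mat3)
    (Λ : ℝ × T3 → ℝ) (w₀ : T3 → ℝ) (w : ℝ × T3 → ℝ) : Prop where
  memLp : MemLp w ∞ (spaceTime T)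
  integrable_damping : Integrable (fun p => Λ p * w p) (spaceTime T)
  weak_eq : ∀ ψ : ℝ × T3 → ℝ, IsTestFun T ψ →
    ∫ p, (w p * (timeDeriv ψ p + dirDeriv u ψ p + divergence Du p * ψ p)
        - Λ p * w p * ψ p) ∂(spaceTime T)
      = - ∫ x, w₀ x * ψ (0, x)

/-- `ρ ∈ L²((0,T) × 𝕋³)`, `ρ ≥ 0`, is a weak solution of the continuity equation with a sink
`∂_t ρ + div(ρ u) + h = 0`, `ρ(0) = ρ₀`, where `0 ≤ h ∈ L¹`. -/
structure IsDensity (T : ℝ) (u : ℝ × T3 → E3) (h : ℝ × T3 → ℝ) (ρ₀ : T3 → ℝ)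
    (ρ : ℝ × T3 → ℝ) : Prop where
  memLp : MemLp ρ 2 (spaceTime T)
  nonneg : ∀ᵐ p ∂(spaceTime T), 0 ≤ ρ p
  sink_integrable : Integrable h (spaceTime T)
  sink_nonneg : ∀ᵐ p ∂(spaceTime T), 0 ≤ h p
  initial_integrable : Integrable ρ₀
  weak_eq : ∀ ψ : ℝ × T3 → ℝ, IsTestFun T ψ →
    ∫ p, (ρ p * (timeDeriv ψ p + dirDeriv u ψ p) - h p * ψ p) ∂(spaceTime T)
      = - ∫ x, ρ₀ x * ψ (0, x)

/-- `|log s|` for `s ≥ 0`, with values in `[0,∞]` and `|log 0| = ∞`. -/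
def absLog (s : ℝ) : ℝ≥0∞ := (ENNReal.log (ENNReal.ofReal s)).abs

end

/-! ### The covering map and `C¹` functions on space-time -/

/-! Formally, `|log w|` solves `∂_t |log w| + u·∇|log w| = Λ` with zero initial value. Testing the
continuity equation with `χ(t) |log w|` gives `∫ρ|log w| ≤ ∫∫ρΛ ≤ ‖ρ‖₂ ‖Λ‖₂` at almost every time:
`ρ₀` drops out because `log 1 = 0`, and the sink has the favourable sign. The strong L² maximal
inequality bounds `‖Λ‖₂` in terms of the data. It remains to construct `w` and to justify the test
function.

Existence (`exists_weak_solution`) is by duality. With `Lψ = ∂_tψ + u·∇ψ + ψ div u - Λψ`, the weak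
equation says that `w` represents the functional `Lψ ↦ -∫ψ(0,·)`. A weak maximum principle
(`neg_integral_initial_le`) bounds this functional by `∫(Lψ)⁺`. Hahn–Banach extends it to L² under
the same bound, and the Riesz density of a functional dominated by `f ↦ ∫f⁺` takes values in
`[0,1]`. Neither a flow nor a regularisation of `u` is needed.

For the estimate, `1 - w` is mollified to `C¹` functions `V_n` (`exists_approximation`). It has zero
initial value, so its zero extension to negative times still solves the equation; kernels living at
positive times then give `V_n(0,·) = 0`. The commutator of mollification with `u·∇` is only shown to
be bounded in L² (`lintegral_commutator_le`), not to vanish. This is enough: `∂_tV_n + u·∇V_n` is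
bounded in L² and converges weakly to `Λw` (`tendsto_integral_mul_materialDeriv`), while it is
paired with `ρχ/(1 - V_n + σ)`, which converges strongly in L² because `ρ ∈ L²` and the other factor
is bounded (`tendsto_toLp_mul`).

In the limit the right side is `∫∫ρχΛ w/(w+σ) ≤ ∫∫ρΛ`, uniformly in `σ` (`logGain_limit_ineq`).
Lebesgue points in time and Fatou's lemma as `σ → 0` finish the estimate. The maximal inequality is
obtained by comparison with dyadic balls of the torus, Vitali covering and the layer-cake formula
(`lintegral_sq_dyadicMax_le`). -/

theorem toT3_add (a b : E3) : toT3 (a + b) = toT3 a + toT3 b := by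
  ext i; simp [toT3]

theorem toT3_sub (a b : E3) : toT3 (a - b) = toT3 a - toT3 b := by
  ext i; simp [toT3]

theorem toT3_zero : toT3 0 = 0 := by
  ext i; simp [toT3]

theorem isOpenQuotientMap_toT3 : IsOpenQuotientMap toT3 := by
  have h : IsOpenQuotientMap (Pi.map fun _ : Fin 3 => ((↑) : ℝ → UnitAddCircle)) :=
    IsOpenQuotientMap.piMap fun _ => QuotientAddGroup.isOpenQuotientMap_mk
  exact h.comp (EuclideanSpace.equiv (Fin 3) ℝ).toHomeomorph.isOpenQuotientMap

theorem toT3_surjective : Function.Surjective toT3 := isOpenQuotientMap_toT3.surjective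

theorem continuous_toT3 : Continuous toT3 := isOpenQuotientMap_toT3.continuous

/-- The covering map `ℝ × ℝ³ → ℝ × 𝕋³`. -/
def cover (q : ℝ × E3) : ℝ × T3 := (q.1, toT3 q.2)

theorem isOpenQuotientMap_cover : IsOpenQuotientMap cover :=
  IsOpenQuotientMap.id.prodMap isOpenQuotientMap_toT3

theorem cover_surjective : Function.Surjective cover := isOpenQuotientMap_cover.surjective

theorem cover_sub (a b : ℝ × E3) : cover (a - b) = cover a - cover b := by
  simp [cover, toT3_sub]

/-- `C¹` functions on `ℝ × 𝕋³`. -/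
def IsC1 (ψ : ℝ × T3 → ℝ) : Prop := ContDiff ℝ 1 (ψ ∘ cover)

/-- The spatial partial derivative `∂_j ψ`. -/
noncomputable def spacePartial (j : Fin 3) (ψ : ℝ × T3 → ℝ) (p : ℝ × T3) : ℝ :=
  torusPartial j (fun y => ψ (p.1, y)) p.2

/-- The unit vector `e_j` of `ℝ³`. -/
noncomputable abbrev unitVec (j : Fin 3) : E3 := EuclideanSpace.single j (1 : ℝ)

theorem single_eq_smul (j : Fin 3) (s : ℝ) :
    (EuclideanSpace.single j s : E3) = s • unitVec j := by
  ext i; by_cases h : i = j <;> simp [h]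

theorem toT3_single_zero (j : Fin 3) : toT3 (EuclideanSpace.single j (0 : ℝ)) = 0 := by
  rw [single_eq_smul, zero_smul, toT3_zero]

namespace IsC1

variable {ψ φ : ℝ × T3 → ℝ}

theorem continuous (h : IsC1 ψ) : Continuous ψ :=
  isOpenQuotientMap_cover.continuous_comp_iff.1 (ContDiff.continuous h)

theorem hasFDerivAt (h : IsC1 ψ) (q : ℝ × E3) :
    HasFDerivAt (ψ ∘ cover) (fderiv ℝ (ψ ∘ cover) q) q :=
  ((ContDiff.differentiable h one_ne_zero) q).hasFDerivAt

theorem hasDerivAt_time_aux (h : IsC1 ψ) (q : ℝ × E3) :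
    HasDerivAt (fun s => ψ (s, toT3 q.2)) (fderiv ℝ (ψ ∘ cover) q (1, 0)) q.1 := by
  have h1 : HasDerivAt (fun s : ℝ => ((s, q.2) : ℝ × E3)) (1, 0) q.1 :=
    (hasDerivAt_id _).prodMk (hasDerivAt_const _ _)
  exact (h.hasFDerivAt q).comp_hasDerivAt q.1 h1

theorem hasDerivAt_space_aux (h : IsC1 ψ) (j : Fin 3) (q : ℝ × E3) :
    HasDerivAt (fun s => ψ (q.1, toT3 q.2 + toT3 (EuclideanSpace.single j s)))
      (fderiv ℝ (ψ ∘ cover) q (0, unitVec j)) 0 := by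
  have h1 : HasDerivAt (fun s : ℝ => ((q.1, q.2 + s • unitVec j) : ℝ × E3)) (0, unitVec j) 0 := by
    refine (hasDerivAt_const _ _).prodMk ?_
    simpa using ((hasDerivAt_id (0 : ℝ)).smul_const (unitVec j)).const_add q.2
  have h2 : HasFDerivAt (ψ ∘ cover) (fderiv ℝ (ψ ∘ cover) q) (q.1, q.2 + (0 : ℝ) • unitVec j) := by
    simpa using h.hasFDerivAt q
  have h3 := h2.comp_hasDerivAt (0 : ℝ) h1
  refine h3.congr_of_eventuallyEq (Filter.Eventually.of_forall fun s => ?_)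
  simp only [Function.comp, cover, ← toT3_add, single_eq_smul j s]

theorem timeDeriv_cover (h : IsC1 ψ) (q : ℝ × E3) :
    timeDeriv ψ (cover q) = fderiv ℝ (ψ ∘ cover) q (1, 0) :=
  (h.hasDerivAt_time_aux q).deriv

theorem spacePartial_cover (h : IsC1 ψ) (j : Fin 3) (q : ℝ × E3) :
    spacePartial j ψ (cover q) = fderiv ℝ (ψ ∘ cover) q (0, unitVec j) :=
  (h.hasDerivAt_space_aux j q).deriv

theorem hasDerivAt_time (h : IsC1 ψ) (t : ℝ) (x : T3) :
    HasDerivAt (fun s => ψ (s, x)) (timeDeriv ψ (t, x)) t := by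
  obtain ⟨z, rfl⟩ := toT3_surjective x
  exact (h.hasDerivAt_time_aux (t, z)).differentiableAt.hasDerivAt

theorem hasDerivAt_space (h : IsC1 ψ) (j : Fin 3) (p : ℝ × T3) :
    HasDerivAt (fun s => ψ (p.1, p.2 + toT3 (EuclideanSpace.single j s))) (spacePartial j ψ p) 0 := by
  obtain ⟨q, rfl⟩ := cover_surjective p
  exact (h.hasDerivAt_space_aux j q).differentiableAt.hasDerivAt

theorem continuous_timeDeriv (h : IsC1 ψ) : Continuous (timeDeriv ψ) := by
  refine isOpenQuotientMap_cover.continuous_comp_iff.1 ?_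
  have : timeDeriv ψ ∘ cover = fun q => fderiv ℝ (ψ ∘ cover) q (1, 0) :=
    funext fun q => h.timeDeriv_cover q
  rw [this]
  exact (ContDiff.continuous_fderiv h one_ne_zero).clm_apply continuous_const

theorem continuous_spacePartial (h : IsC1 ψ) (j : Fin 3) : Continuous (spacePartial j ψ) := by
  refine isOpenQuotientMap_cover.continuous_comp_iff.1 ?_
  have : spacePartial j ψ ∘ cover = fun q => fderiv ℝ (ψ ∘ cover) q (0, unitVec j) :=
    funext fun q => h.spacePartial_cover j q
  rw [this]
  exact (ContDiff.continuous_fderiv h one_ne_zero).clm_apply continuous_const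

end IsC1

/-- The full differential of a function on `ℝ × 𝕋³`. -/
noncomputable def fullDiff (ψ : ℝ × T3 → ℝ) (p : ℝ × T3) : ℝ × E3 →L[ℝ] ℝ :=
  timeDeriv ψ p • ContinuousLinearMap.fst ℝ ℝ E3 +
    ∑ j, spacePartial j ψ p • ((EuclideanSpace.proj j : E3 →L[ℝ] ℝ).comp
      (ContinuousLinearMap.snd ℝ ℝ E3))

theorem fullDiff_time (ψ : ℝ × T3 → ℝ) (p : ℝ × T3) : fullDiff ψ p (1, 0) = timeDeriv ψ p := by
  simp [fullDiff]

theorem fullDiff_space (ψ : ℝ × T3 → ℝ) (p : ℝ × T3) (j : Fin 3) :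
    fullDiff ψ p (0, unitVec j) = spacePartial j ψ p := by
  simp [fullDiff, Fin.sum_univ_three]
  fin_cases j <;> simp

theorem clm_ext_unitVec {A B : ℝ × E3 →L[ℝ] ℝ} (h0 : A (1, 0) = B (1, 0))
    (h1 : ∀ j, A (0, unitVec j) = B (0, unitVec j)) : A = B := by
  have h2 : ∀ z : E3, A (0, z) = B (0, z) := by
    intro z
    have hz : z = ∑ j, z j • unitVec j := by
      ext i; simp [Fin.sum_univ_three]; fin_cases i <;> simp
    have key : ∀ C : ℝ × E3 →L[ℝ] ℝ, C (0, z) = ∑ j, z j * C (0, unitVec j) := by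
      intro C
      have : C (0, z) = (C.comp (ContinuousLinearMap.inr ℝ ℝ E3)) z := by simp
      rw [this, hz, map_sum]
      simp [Fin.sum_univ_three, map_smul]
    simp [key, h1]
  ext x
  · simpa using h0
  · simpa using h2 _

namespace IsC1

variable {ψ φ : ℝ × T3 → ℝ}

theorem hasFDerivAt_fullDiff (h : IsC1 ψ) (q : ℝ × E3) :
    HasFDerivAt (ψ ∘ cover) (fullDiff ψ (cover q)) q := by
  have : fullDiff ψ (cover q) = fderiv ℝ (ψ ∘ cover) q :=
    clm_ext_unitVec (by rw [fullDiff_time, h.timeDeriv_cover])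
      fun j => by rw [fullDiff_space, h.spacePartial_cover]
  rw [this]
  exact h.hasFDerivAt q

theorem continuous_fullDiff (h : IsC1 ψ) : Continuous (fullDiff ψ) :=
  (h.continuous_timeDeriv.smul continuous_const).add
    (continuous_finsetSum _ fun j _ => (h.continuous_spacePartial j).smul continuous_const)

/-- Lets `C¹` regularity be proved from a candidate differential living on the torus itself; this is
how reflections and convolutions are treated. -/
theorem of_hasFDerivAt {d : ℝ × T3 → ℝ × E3 →L[ℝ] ℝ} (hd : Continuous d)
    (h : ∀ q, HasFDerivAt (ψ ∘ cover) (d (cover q)) q) : IsC1 ψ := by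
  refine contDiff_one_iff_fderiv.2 ⟨fun q => (h q).differentiableAt, ?_⟩
  have : fderiv ℝ (ψ ∘ cover) = d ∘ cover := funext fun q => (h q).fderiv
  rw [this]
  exact hd.comp isOpenQuotientMap_cover.continuous

theorem timeDeriv_of_hasFDerivAt {d : ℝ × T3 → ℝ × E3 →L[ℝ] ℝ} (hψ : IsC1 ψ)
    (h : ∀ q, HasFDerivAt (ψ ∘ cover) (d (cover q)) q) (p : ℝ × T3) :
    timeDeriv ψ p = d p (1, 0) := by
  obtain ⟨q, rfl⟩ := cover_surjective p
  rw [hψ.timeDeriv_cover, (h q).fderiv]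

theorem spacePartial_of_hasFDerivAt {d : ℝ × T3 → ℝ × E3 →L[ℝ] ℝ} (hψ : IsC1 ψ)
    (h : ∀ q, HasFDerivAt (ψ ∘ cover) (d (cover q)) q) (j : Fin 3) (p : ℝ × T3) :
    spacePartial j ψ p = d p (0, unitVec j) := by
  obtain ⟨q, rfl⟩ := cover_surjective p
  rw [hψ.spacePartial_cover, (h q).fderiv]

theorem mul (h : IsC1 ψ) (h' : IsC1 φ) : IsC1 (fun p => ψ p * φ p) := ContDiff.mul h h'

theorem of_time {χ : ℝ → ℝ} (h : ContDiff ℝ 1 χ) : IsC1 (fun p => χ p.1) :=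
  h.comp (contDiff_fst (E := ℝ) (F := E3))

theorem comp_left {f : ℝ → ℝ} (hf : ContDiff ℝ 1 f) (h : IsC1 ψ) : IsC1 (fun p => f (ψ p)) :=
  hf.comp h

theorem timeDeriv_comp {f : ℝ → ℝ} (h : IsC1 ψ) (p : ℝ × T3) {f' : ℝ}
    (hf : HasDerivAt f f' (ψ p)) :
    timeDeriv (fun p => f (ψ p)) p = f' * timeDeriv ψ p :=
  (hf.comp p.1 (h.hasDerivAt_time p.1 p.2)).deriv

theorem spacePartial_comp {f : ℝ → ℝ} (h : IsC1 ψ) (j : Fin 3) (p : ℝ × T3) {f' : ℝ}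
    (hf : HasDerivAt f f' (ψ p)) :
    spacePartial j (fun p => f (ψ p)) p = f' * spacePartial j ψ p := by
  have h0 : ψ (p.1, p.2 + toT3 (EuclideanSpace.single j (0 : ℝ))) = ψ p := by
    rw [toT3_single_zero, add_zero]
  rw [← h0] at hf
  exact (hf.comp (0 : ℝ) (h.hasDerivAt_space j p)).deriv

theorem timeDeriv_mul (h : IsC1 ψ) (h' : IsC1 φ) (p : ℝ × T3) :
    timeDeriv (fun p => ψ p * φ p) p = timeDeriv ψ p * φ p + ψ p * timeDeriv φ p :=
  ((h.hasDerivAt_time p.1 p.2).mul (h'.hasDerivAt_time p.1 p.2)).deriv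

theorem spacePartial_mul (h : IsC1 ψ) (h' : IsC1 φ) (j : Fin 3) (p : ℝ × T3) :
    spacePartial j (fun p => ψ p * φ p) p = spacePartial j ψ p * φ p + ψ p * spacePartial j φ p := by
  have := ((h.hasDerivAt_space j p).mul (h'.hasDerivAt_space j p)).deriv
  rwa [toT3_single_zero, add_zero] at this

theorem timeDeriv_add (h : IsC1 ψ) (h' : IsC1 φ) (p : ℝ × T3) :
    timeDeriv (fun p => ψ p + φ p) p = timeDeriv ψ p + timeDeriv φ p :=
  ((h.hasDerivAt_time p.1 p.2).add (h'.hasDerivAt_time p.1 p.2)).deriv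

theorem spacePartial_add (h : IsC1 ψ) (h' : IsC1 φ) (j : Fin 3) (p : ℝ × T3) :
    spacePartial j (fun p => ψ p + φ p) p = spacePartial j ψ p + spacePartial j φ p :=
  ((h.hasDerivAt_space j p).add (h'.hasDerivAt_space j p)).deriv

theorem timeDeriv_const_mul (c : ℝ) (h : IsC1 ψ) (p : ℝ × T3) :
    timeDeriv (fun p => c * ψ p) p = c * timeDeriv ψ p :=
  ((h.hasDerivAt_time p.1 p.2).const_mul c).deriv

theorem spacePartial_const_mul (c : ℝ) (h : IsC1 ψ) (j : Fin 3) (p : ℝ × T3) :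
    spacePartial j (fun p => c * ψ p) p = c * spacePartial j ψ p :=
  ((h.hasDerivAt_space j p).const_mul c).deriv

theorem spacePartial_time (χ : ℝ → ℝ) (j : Fin 3) (p : ℝ × T3) :
    spacePartial j (fun p => χ p.1) p = 0 := by
  simp [spacePartial, torusPartial]

/-- The reflection `q ↦ ψ (p - q)`. -/
theorem hasFDerivAt_reflect (h : IsC1 ψ) (p : ℝ × T3) (q : ℝ × E3) :
    HasFDerivAt ((fun q => ψ (p - q)) ∘ cover) ((fun r => -fullDiff ψ (p - r)) (cover q)) q := by
  obtain ⟨p, rfl⟩ := cover_surjective p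
  have h1 : HasFDerivAt (fun q : ℝ × E3 => p - q) (-ContinuousLinearMap.id ℝ (ℝ × E3)) q :=
    (hasFDerivAt_id q).const_sub p
  have h2 := (h.hasFDerivAt_fullDiff (p - q)).comp q h1
  simp only [cover_sub] at h2
  have h3 : (fun q => ψ (cover p - q)) ∘ cover = (ψ ∘ cover) ∘ fun q => p - q := by
    funext r; simp [cover_sub]
  rw [h3]
  have h4 : -fullDiff ψ (cover p - cover q) = (fullDiff ψ (cover p - cover q)).comp
      (-ContinuousLinearMap.id ℝ (ℝ × E3)) :=
    ContinuousLinearMap.ext fun v => by simp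
  simp only [h4]
  exact h2

theorem reflect (h : IsC1 ψ) (p : ℝ × T3) : IsC1 (fun q => ψ (p - q)) :=
  of_hasFDerivAt (d := fun r => -fullDiff ψ (p - r))
    (h.continuous_fullDiff.comp (continuous_const.sub continuous_id)).neg
    (h.hasFDerivAt_reflect p)

theorem timeDeriv_reflect (h : IsC1 ψ) (p q : ℝ × T3) :
    timeDeriv (fun q => ψ (p - q)) q = -timeDeriv ψ (p - q) := by
  rw [timeDeriv_of_hasFDerivAt (d := fun r => -fullDiff ψ (p - r)) (h.reflect p) (h.hasFDerivAt_reflect p)]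
  simp [fullDiff_time]

theorem spacePartial_reflect (h : IsC1 ψ) (j : Fin 3) (p q : ℝ × T3) :
    spacePartial j (fun q => ψ (p - q)) q = -spacePartial j ψ (p - q) := by
  rw [spacePartial_of_hasFDerivAt (d := fun r => -fullDiff ψ (p - r)) (h.reflect p) (h.hasFDerivAt_reflect p)]
  simp [fullDiff_space]

theorem slice (h : IsC1 ψ) (t : ℝ) : IsTorusC1 (fun x => ψ (t, x)) :=
  ContDiff.comp (g := ψ ∘ cover) h (contDiff_prodMk_right t)

end IsC1

theorem IsTestFun.isC1 {T : ℝ} {ψ : ℝ × T3 → ℝ} (h : IsTestFun T ψ) : IsC1 ψ := h.contDiff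


/-! ### Measure theory on the cyl -/

instance : (volume : Measure (ℝ × T3)).IsAddHaarMeasure :=
  Measure.prod.instIsAddHaarMeasure (volume : Measure ℝ) (volume : Measure T3)

instance : (volume : Measure (ℝ × T3)).Regular :=
  Measure.Regular.of_sigmaCompactSpace_of_isLocallyFiniteMeasure _

instance : IsProbabilityMeasure (volume : Measure UnitAddCircle) :=
  ⟨by simp [AddCircle.measure_univ]⟩

instance : IsProbabilityMeasure (volume : Measure T3) :=
  inferInstanceAs (IsProbabilityMeasure (Measure.pi fun _ : Fin 3 => (volume : Measure UnitAddCircle)))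

/-- The space-time cylinder `(0,T) × 𝕋³`. -/
def cyl (T : ℝ) : Set (ℝ × T3) := Ioo 0 T ×ˢ univ

theorem measurableSet_cyl (T : ℝ) : MeasurableSet (cyl T) :=
  measurableSet_Ioo.prod MeasurableSet.univ

theorem mem_cyl {T : ℝ} {p : ℝ × T3} : p ∈ cyl T ↔ 0 < p.1 ∧ p.1 < T := by
  simp [cyl]

theorem spaceTime_eq (T : ℝ) :
    spaceTime T = (volume : Measure (ℝ × T3)).restrict (cyl T) := by
  rw [spaceTime, cyl, Measure.volume_eq_prod, ← Measure.prod_restrict, Measure.restrict_univ]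

instance (T : ℝ) : IsFiniteMeasure (spaceTime T) := by
  unfold spaceTime; infer_instance

theorem ae_mem_cyl (T : ℝ) : ∀ᵐ p ∂(spaceTime T), p ∈ cyl T := by
  rw [spaceTime_eq]; exact ae_restrict_mem (measurableSet_cyl T)

/-! ### Squared L² norms, Minkowski's inequality and translations in L². -/

theorem lintegral_enorm_sq_eq {α : Type*} [MeasurableSpace α] {μ : Measure α} (f : α → ℝ) :
    ∫⁻ a, ‖f a‖ₑ ^ 2 ∂μ = eLpNorm f 2 μ ^ 2 := by
  have := eLpNorm_nnreal_pow_eq_lintegral (μ := μ) (f := f) (p := 2) (by norm_num)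
  simp only [NNReal.coe_ofNat, ENNReal.coe_ofNat, ENNReal.rpow_ofNat] at this
  exact this.symm

/-- Cauchy–Schwarz with a weight. -/
theorem sq_lintegral_mul_le {α : Type*} [MeasurableSpace α] {μ : Measure α} {k f : α → ℝ≥0∞}
    (hk : AEMeasurable k μ) (hf : AEMeasurable f μ) :
    (∫⁻ a, k a * f a ∂μ) ^ 2 ≤ (∫⁻ a, k a ∂μ) * ∫⁻ a, k a * f a ^ 2 ∂μ := by
  -- Split `k f = k^(1/2) · (k^(1/2) f)` before applying Hölder.
  have h := ENNReal.lintegral_mul_le_Lp_mul_Lq μ (Real.HolderConjugate.two_two)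
    (hk.pow_const (1 / 2 : ℝ)) ((hk.pow_const (1 / 2 : ℝ)).mul hf)
  have e1 : ∀ a, ((fun a => k a ^ (1 / 2 : ℝ)) * ((fun a => k a ^ (1 / 2 : ℝ)) * f)) a
      = k a * f a := by
    intro a
    simp only [Pi.mul_apply, ← mul_assoc]
    rw [← ENNReal.rpow_add_of_nonneg _ _ (by norm_num) (by norm_num)]
    norm_num
  have e2 : ∀ x : ℝ≥0∞, (x ^ (1 / 2 : ℝ)) ^ (2 : ℝ) = x := by
    intro x; rw [← ENNReal.rpow_mul]; norm_num
  simp_rw [e1, Pi.mul_apply, ENNReal.mul_rpow_of_nonneg _ _ (zero_le_two (α := ℝ)), e2] at h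
  calc _ ≤ _ := pow_le_pow_left' h 2
    _ = _ := by
      rw [mul_pow]
      simp only [ENNReal.rpow_two] at e2 ⊢
      rw [e2, e2]

/-- Minkowski's integral inequality in `L²`, in squared form. -/
theorem lintegral_sq_lintegral_mul_le {α β : Type*} [MeasurableSpace α] [MeasurableSpace β]
    {μ : Measure α} {ν : Measure β} [SFinite μ] [SFinite ν] {k : β → ℝ≥0∞} {H : α → β → ℝ≥0∞}
    (hk : Measurable k) (hH : Measurable (Function.uncurry H)) :
    ∫⁻ p, (∫⁻ z, k z * H p z ∂ν) ^ 2 ∂μ ≤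
      (∫⁻ z, k z ∂ν) * ∫⁻ z, k z * ∫⁻ p, H p z ^ 2 ∂μ ∂ν := by
  calc _ ≤ ∫⁻ p, (∫⁻ z, k z ∂ν) * ∫⁻ z, k z * H p z ^ 2 ∂ν ∂μ :=
        lintegral_mono fun p => sq_lintegral_mul_le hk.aemeasurable
          (hH.of_uncurry_left (x := p)).aemeasurable
    _ = (∫⁻ z, k z ∂ν) * ∫⁻ p, ∫⁻ z, k z * H p z ^ 2 ∂ν ∂μ := by
        rw [lintegral_const_mul]
        exact Measurable.lintegral_prod_right' (f := fun q : α × β => k q.2 * H q.1 q.2 ^ 2)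
          ((hk.comp measurable_snd).mul (hH.pow_const 2))
    _ = (∫⁻ z, k z ∂ν) * ∫⁻ z, ∫⁻ p, k z * H p z ^ 2 ∂μ ∂ν := by
        rw [lintegral_lintegral_swap]
        exact ((hk.comp measurable_snd).mul (hH.pow_const 2)).aemeasurable
    _ = _ := by
        congr 1
        refine lintegral_congr fun z => ?_
        rw [lintegral_const_mul]
        exact (hH.of_uncurry_right (y := z)).pow_const 2

/-- The squared `L²` distance of `F` and its translate by `z`. -/
noncomputable def shiftDist (F : ℝ × T3 → ℝ) (z : ℝ × T3) : ℝ≥0∞ :=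
  ∫⁻ p, ‖F (p - z) - F p‖ₑ ^ 2

/-- Translations act continuously on L². They form a continuous family of measure-preserving maps in
the compact-open topology, and composition with such a family is continuous in L². -/
theorem tendsto_shiftDist {F : ℝ × T3 → ℝ} (hF : MemLp F 2) :
    Filter.Tendsto (shiftDist F) (nhds 0) (nhds 0) := by
  let g : ℝ × T3 → C(ℝ × T3, ℝ × T3) := fun z => ⟨fun p => p - z, by fun_prop⟩
  have hg : Continuous g := by
    let G : C((ℝ × T3) × (ℝ × T3), ℝ × T3) := ⟨fun a => a.2 - a.1, by fun_prop⟩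
    exact G.curry.continuous
  have hgm : ∀ z, MeasurePreserving (g z) (volume : Measure (ℝ × T3)) volume :=
    fun z => measurePreserving_sub_right volume z
  have h0 : Filter.Tendsto g (nhds 0) (nhds (g 0)) := hg.tendsto 0
  have := Filter.Tendsto.compMeasurePreservingLp (E := ℝ) (p := 2) (f := fun _ => hF.toLp F)
    tendsto_const_nhds h0 hgm (hgm 0) (by simp)
  have key : ∀ z, shiftDist F z =
      edist (Lp.compMeasurePreserving (g z) (hgm z) (hF.toLp F))
        (Lp.compMeasurePreserving (g 0) (hgm 0) (hF.toLp F)) ^ 2 := by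
    intro z
    rw [shiftDist, lintegral_enorm_sq_eq, Lp.toLp_compMeasurePreserving,
      Lp.toLp_compMeasurePreserving, Lp.edist_toLp_toLp]
    congr 2
    funext p
    simp [g]
  rw [show shiftDist F = _ from funext key]
  have h2 := (tendsto_iff_edist_tendsto_0.1 this)
  have h3 := ((ENNReal.continuous_pow 2).tendsto 0).comp h2
  simpa [Function.comp_def] using h3

/-- Insert the intermediate translate and use `(x + y)² ≤ 2x² + 2y²`. This separates time shifts
from shifts along each coordinate axis. -/
theorem shiftDist_add_le {F : ℝ × T3 → ℝ} (hF : Measurable F) (a b : ℝ × T3) :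
    shiftDist F (a + b) ≤ 2 * shiftDist F a + 2 * shiftDist F b := by
  have h1 : shiftDist F b = ∫⁻ p, ‖F (p - a - b) - F (p - a)‖ₑ ^ 2 := by
    rw [shiftDist, ← lintegral_sub_right_eq_self _ a]
  rw [h1, shiftDist, shiftDist, ← lintegral_const_mul _ (by fun_prop),
    ← lintegral_const_mul _ (by fun_prop), ← lintegral_add_left (by fun_prop)]
  refine lintegral_mono fun p => ?_
  have : F (p - (a + b)) - F p = (F (p - a) - F p) + (F (p - a - b) - F (p - a)) := by
    rw [sub_add_eq_sub_sub]; ring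
  rw [this]
  calc _ ≤ (‖F (p - a) - F p‖ₑ + ‖F (p - a - b) - F (p - a)‖ₑ) ^ 2 :=
        pow_le_pow_left' (enorm_add_le _ _) 2
    _ ≤ _ := by
        rw [← mul_add]
        have := ENNReal.rpow_add_le_mul_rpow_add_rpow ‖F (p - a) - F p‖ₑ
          ‖F (p - a - b) - F (p - a)‖ₑ (p := 2) (by norm_num)
        norm_num at this
        exact this


/-! ### Mollification on the cylinder -/

namespace IsC1

variable {κ : ℝ × T3 → ℝ}

theorem fullDiff_eq_zero_of_eventually {p : ℝ × T3} (h : IsC1 κ) (h0 : ∀ᶠ q in nhds p, κ q = 0) :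
    fullDiff κ p = 0 := by
  obtain ⟨q, rfl⟩ := cover_surjective p
  have h1 : κ ∘ cover =ᶠ[nhds q] fun _ => (0 : ℝ) :=
    (isOpenQuotientMap_cover.continuous.tendsto q).eventually h0
  have h2 := (h.hasFDerivAt_fullDiff q).fderiv
  rw [h1.fderiv_eq] at h2
  simpa using h2.symm

/-- A `C¹` function supported in a bounded time interval has bounded differential. -/
theorem exists_bound (h : IsC1 κ) {a b : ℝ} (hs : ∀ p, κ p ≠ 0 → p.1 ∈ Icc a b) :
    ∃ B, 0 ≤ B ∧ ∀ p, |κ p| ≤ B ∧ ‖fullDiff κ p‖ ≤ B ∧ |timeDeriv κ p| ≤ B ∧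
      ∀ j, |spacePartial j κ p| ≤ B := by
  have hK : IsCompact (Icc a b ×ˢ (univ : Set T3)) := isCompact_Icc.prod isCompact_univ
  obtain ⟨B₁, h1⟩ := hK.exists_bound_of_continuousOn h.continuous.continuousOn
  obtain ⟨B₂, h2⟩ := hK.exists_bound_of_continuousOn h.continuous_fullDiff.continuousOn
  have out : ∀ p : ℝ × T3, p.1 ∉ Icc a b → κ p = 0 := fun p hp => by
    by_contra hne; exact hp (hs p hne)
  -- The complement of the closed interval is open, so `κ` vanishes near `p` and not only at `p`.
  have outd : ∀ p : ℝ × T3, p.1 ∉ Icc a b → fullDiff κ p = 0 := fun p hp => by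
    refine h.fullDiff_eq_zero_of_eventually ?_
    have : ∀ᶠ q : ℝ × T3 in nhds p, q.1 ∈ (Icc a b)ᶜ :=
      continuous_fst.continuousAt.eventually (isClosed_Icc.isOpen_compl.mem_nhds hp)
    exact this.mono fun q hq => out q hq
  have hd : ∀ p, ‖fullDiff κ p‖ ≤ max (max B₁ B₂) 0 := fun p => by
    by_cases hp : p.1 ∈ Icc a b
    · exact (h2 p ⟨hp, mem_univ _⟩).trans (by simp)
    · simp [outd p hp]
  refine ⟨max (max B₁ B₂) 0, by simp, fun p => ⟨?_, hd p, ?_, fun j => ?_⟩⟩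
  · by_cases hp : p.1 ∈ Icc a b
    · exact (h1 p ⟨hp, mem_univ _⟩).trans (by simp)
    · simp [out p hp]
  · rw [← fullDiff_time, ← Real.norm_eq_abs]
    refine ((fullDiff κ p).le_opNorm _).trans ((mul_le_of_le_one_right (norm_nonneg _) ?_).trans (hd p))
    simp [Prod.norm_def]
  · rw [← fullDiff_space, ← Real.norm_eq_abs]
    refine ((fullDiff κ p).le_opNorm _).trans ((mul_le_of_le_one_right (norm_nonneg _) ?_).trans (hd p))
    simp [Prod.norm_def]

end IsC1

/-- Convolution of `F` with the kernel `κ` on `ℝ × 𝕋³`. -/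
noncomputable def moll (κ F : ℝ × T3 → ℝ) (p : ℝ × T3) : ℝ := ∫ q, F q * κ (p - q)

theorem moll_eq_integral_sub (κ F : ℝ × T3 → ℝ) (p : ℝ × T3) :
    moll κ F p = ∫ z, F (p - z) * κ z := by
  rw [moll, ← integral_sub_left_eq_self _ volume p]
  simp

theorem integrable_mul_kernel {κ F : ℝ × T3 → ℝ} (hF : Integrable F) (hκ : Continuous κ) {B : ℝ}
    (hB : ∀ p, |κ p| ≤ B) (p : ℝ × T3) : Integrable (fun q => F q * κ (p - q)) :=
  hF.mul_bdd (c := B) (by fun_prop) (Filter.Eventually.of_forall fun q => hB _)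

section Derivative

variable {κ F : ℝ × T3 → ℝ} {a b : ℝ}

/-- Differentiation under the integral: all derivatives fall on the kernel, with dominating function
`|F| B`. -/
theorem hasFDerivAt_moll (hF : Integrable F) (hκ : IsC1 κ) (hs : ∀ p, κ p ≠ 0 → p.1 ∈ Icc a b)
    (P : ℝ × E3) :
    HasFDerivAt (moll κ F ∘ cover) ((fun p => ∫ q, F q • fullDiff κ (p - q)) (cover P)) P := by
  obtain ⟨B, hB0, hB⟩ := hκ.exists_bound hs
  refine hasFDerivAt_integral_of_dominated_of_fderiv_le (𝕜 := ℝ) (s := univ)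
    (F := fun P q => F q * κ (cover P - q)) (F' := fun P q => F q • fullDiff κ (cover P - q))
    (bound := fun q => ‖F q‖ * B) Filter.univ_mem ?_ ?_ ?_ ?_ ?_ ?_
  · exact Filter.Eventually.of_forall fun P =>
      (integrable_mul_kernel hF hκ.continuous (fun p => (hB p).1) _).aestronglyMeasurable
  · exact integrable_mul_kernel hF hκ.continuous (fun p => (hB p).1) _
  · exact hF.aestronglyMeasurable.smul
      (hκ.continuous_fullDiff.comp (continuous_const.sub continuous_id)).aestronglyMeasurable
  · refine Filter.Eventually.of_forall fun q P _ => ?_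
    rw [norm_smul]
    exact mul_le_mul_of_nonneg_left (hB _).2.1 (norm_nonneg _)
  · exact hF.norm.mul_const B
  · refine Filter.Eventually.of_forall fun q P _ => ?_
    obtain ⟨q', rfl⟩ := cover_surjective q
    have h1 := (hκ.hasFDerivAt_fullDiff (P - q')).comp P ((hasFDerivAt_id P).sub_const q')
    have h2 := h1.const_smul (F (cover q'))
    simp only [cover_sub, ContinuousLinearMap.comp_id] at h2
    refine h2.congr_of_eventuallyEq (Filter.Eventually.of_forall fun r => ?_)
    simp [cover_sub]

theorem continuous_integral_fullDiff (hF : Integrable F) (hκ : IsC1 κ)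
    (hs : ∀ p, κ p ≠ 0 → p.1 ∈ Icc a b) :
    Continuous fun p => ∫ q, F q • fullDiff κ (p - q) := by
  obtain ⟨B, hB0, hB⟩ := hκ.exists_bound hs
  refine continuous_of_dominated (bound := fun q => ‖F q‖ * B) (fun p => ?_) (fun p => ?_)
    (hF.norm.mul_const B) ?_
  · exact hF.aestronglyMeasurable.smul
      (hκ.continuous_fullDiff.comp (continuous_const.sub continuous_id)).aestronglyMeasurable
  · refine Filter.Eventually.of_forall fun q => ?_
    rw [norm_smul]
    exact mul_le_mul_of_nonneg_left (hB _).2.1 (norm_nonneg _)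
  · refine Filter.Eventually.of_forall fun q => ?_
    exact Continuous.const_smul (hκ.continuous_fullDiff.comp
      (continuous_id.sub (continuous_const (y := q)))) (F q)

theorem isC1_moll (hF : Integrable F) (hκ : IsC1 κ) (hs : ∀ p, κ p ≠ 0 → p.1 ∈ Icc a b) :
    IsC1 (moll κ F) :=
  IsC1.of_hasFDerivAt (d := fun p => ∫ q, F q • fullDiff κ (p - q)) (continuous_integral_fullDiff hF hκ hs) (hasFDerivAt_moll hF hκ hs)

theorem integrable_smul_fullDiff (hF : Integrable F) (hκ : IsC1 κ)
    (hs : ∀ p, κ p ≠ 0 → p.1 ∈ Icc a b) (p : ℝ × T3) :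
    Integrable fun q => F q • fullDiff κ (p - q) := by
  obtain ⟨B, hB0, hB⟩ := hκ.exists_bound hs
  refine (hF.norm.mul_const B).mono' (hF.aestronglyMeasurable.smul
      (hκ.continuous_fullDiff.comp (continuous_const.sub continuous_id)).aestronglyMeasurable)
      (Filter.Eventually.of_forall fun q => ?_)
  rw [norm_smul]
  exact mul_le_mul_of_nonneg_left (hB _).2.1 (norm_nonneg _)

theorem timeDeriv_moll (hF : Integrable F) (hκ : IsC1 κ) (hs : ∀ p, κ p ≠ 0 → p.1 ∈ Icc a b)
    (p : ℝ × T3) : timeDeriv (moll κ F) p = ∫ q, F q * timeDeriv κ (p - q) := by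
  rw [(isC1_moll hF hκ hs).timeDeriv_of_hasFDerivAt
      (d := fun p => ∫ q, F q • fullDiff κ (p - q)) (hasFDerivAt_moll hF hκ hs),
    ContinuousLinearMap.integral_apply (integrable_smul_fullDiff hF hκ hs p)]
  simp [fullDiff_time]

theorem spacePartial_moll (hF : Integrable F) (hκ : IsC1 κ) (hs : ∀ p, κ p ≠ 0 → p.1 ∈ Icc a b)
    (j : Fin 3) (p : ℝ × T3) :
    spacePartial j (moll κ F) p = ∫ q, F q * spacePartial j κ (p - q) := by
  rw [(isC1_moll hF hκ hs).spacePartial_of_hasFDerivAt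
      (d := fun p => ∫ q, F q • fullDiff κ (p - q)) (hasFDerivAt_moll hF hκ hs),
    ContinuousLinearMap.integral_apply (integrable_smul_fullDiff hF hκ hs p)]
  simp [fullDiff_space]

end Derivative

/-- A nonnegative `C¹` kernel of total mass one, supported in times `(0,τ)` and in the ball of
radius `δ`, whose spatial derivatives have mass at most `A / δ`. -/
structure IsMollifier (A τ δ : ℝ) (κ : ℝ × T3 → ℝ) : Prop where
  isC1 : IsC1 κ
  nonneg : ∀ p, 0 ≤ κ p
  support_time : ∀ p, κ p ≠ 0 → p.1 ∈ Ioo 0 τ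
  support_space : ∀ p, κ p ≠ 0 → ‖p.2‖ ≤ δ
  mass : ∫⁻ p, ENNReal.ofReal (κ p) = 1
  mass_partial : ∀ j, ∫⁻ p, ‖spacePartial j κ p‖ₑ ≤ ENNReal.ofReal (A / δ)

namespace IsMollifier

variable {A τ δ : ℝ} {κ F : ℝ × T3 → ℝ}

theorem support_Icc (h : IsMollifier A τ δ κ) (p : ℝ × T3) (hp : κ p ≠ 0) : p.1 ∈ Icc 0 τ :=
  Ioo_subset_Icc_self (h.support_time p hp)

theorem integrable (h : IsMollifier A τ δ κ) : Integrable κ := by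
  refine ⟨h.isC1.continuous.aestronglyMeasurable, ?_⟩
  rw [hasFiniteIntegral_iff_ofReal (Filter.Eventually.of_forall h.nonneg), h.mass]
  simp

theorem integral_eq_one (h : IsMollifier A τ δ κ) : ∫ p, κ p = 1 := by
  rw [integral_eq_lintegral_of_nonneg_ae (Filter.Eventually.of_forall h.nonneg)
    h.isC1.continuous.aestronglyMeasurable, h.mass]
  simp

theorem fullDiff_eq_zero (h : IsMollifier A τ δ κ) {p : ℝ × T3}
    (hp : p.1 < 0 ∨ τ < p.1 ∨ δ < ‖p.2‖) : fullDiff κ p = 0 := by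
  refine h.isC1.fullDiff_eq_zero_of_eventually ?_
  have hz : ∀ q : ℝ × T3, (q.1 < 0 ∨ τ < q.1 ∨ δ < ‖q.2‖) → κ q = 0 := by
    intro q hq
    by_contra hne
    have h1 := h.support_time q hne
    have h2 := h.support_space q hne
    rcases hq with hq | hq | hq
    · exact absurd h1.1 (not_lt.2 hq.le)
    · exact absurd h1.2 (not_lt.2 hq.le)
    · exact absurd h2 (not_le.2 hq)
  have ho : IsOpen {q : ℝ × T3 | q.1 < 0 ∨ τ < q.1 ∨ δ < ‖q.2‖} := by
    exact (isOpen_lt continuous_fst continuous_const).union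
      ((isOpen_lt continuous_const continuous_fst).union
        (isOpen_lt continuous_const continuous_snd.norm))
  exact Filter.mem_of_superset (ho.mem_nhds hp) fun q hq => hz q hq

theorem spacePartial_support (h : IsMollifier A τ δ κ) {j : Fin 3} {p : ℝ × T3}
    (hp : spacePartial j κ p ≠ 0) : p.1 ∈ Icc 0 τ ∧ ‖p.2‖ ≤ δ := by
  by_contra hcon
  refine hp ?_
  rw [← fullDiff_space, h.fullDiff_eq_zero]
  · simp
  · rw [not_and_or, mem_Icc, not_and_or, not_le, not_le, not_le] at hcon
    tauto

theorem moll_sub (h : IsMollifier A τ δ κ) (hF : Integrable F) (p : ℝ × T3) :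
    moll κ F p - F p = ∫ z, κ z * (F (p - z) - F p) := by
  obtain ⟨B, hB0, hB⟩ := h.isC1.exists_bound h.support_Icc
  have h1 : Integrable fun z => F (p - z) * κ z := by
    have := (integrable_mul_kernel hF h.isC1.continuous (fun p => (hB p).1) p).comp_sub_left p
    simpa using this
  rw [moll_eq_integral_sub]
  simp_rw [mul_sub]
  rw [integral_sub (by simpa [mul_comm] using h1) (h.integrable.mul_const _),
    integral_mul_const, h.integral_eq_one, one_mul]
  simp_rw [mul_comm]

theorem enorm_eq (h : IsMollifier A τ δ κ) (z : ℝ × T3) : ‖κ z‖ₑ = ENNReal.ofReal (κ z) :=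
  Real.enorm_eq_ofReal (h.nonneg z)

/-- The kernel has mass one, so `moll κ F - F` is a `κ`-average of the differences `F(· - z) - F`.
Minkowski bounds its L² norm by the worst shift in the support of `κ`. -/
theorem lintegral_moll_sub_le (h : IsMollifier A τ δ κ) (hF : Integrable F) (hm : Measurable F)
    {ε : ℝ≥0∞} (hε : ∀ z, z.1 ∈ Ioo 0 τ → ‖z.2‖ ≤ δ → shiftDist F z ≤ ε) :
    ∫⁻ p, ‖moll κ F p - F p‖ₑ ^ 2 ≤ ε := by
  have hκm : Measurable fun z => ENNReal.ofReal (κ z) := h.isC1.continuous.measurable.ennreal_ofReal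
  calc ∫⁻ p, ‖moll κ F p - F p‖ₑ ^ 2
      ≤ ∫⁻ p, (∫⁻ z, ENNReal.ofReal (κ z) * ‖F (p - z) - F p‖ₑ) ^ 2 := by
        refine lintegral_mono fun p => pow_le_pow_left' ?_ 2
        rw [h.moll_sub hF]
        refine (enorm_integral_le_lintegral_enorm _).trans (le_of_eq ?_)
        refine lintegral_congr fun z => ?_
        rw [enorm_mul, h.enorm_eq]
    _ ≤ (∫⁻ z, ENNReal.ofReal (κ z)) * ∫⁻ z, ENNReal.ofReal (κ z) * shiftDist F z :=
        lintegral_sq_lintegral_mul_le (H := fun p z => ‖F (p - z) - F p‖ₑ) hκm (by fun_prop)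
    _ ≤ 1 * ∫⁻ z, ENNReal.ofReal (κ z) * ε := by
        rw [h.mass]
        refine mul_le_mul_right (lintegral_mono fun z => ?_) 1
        by_cases hz : κ z = 0
        · simp [hz]
        · exact mul_le_mul_right (hε z (h.support_time z hz) (h.support_space z hz)) _
    _ = ε := by rw [one_mul, lintegral_mul_const _ hκm, h.mass, one_mul]

/-- Convolution with a mollifier does not increase the `L²` norm. -/
theorem lintegral_moll_le (h : IsMollifier A τ δ κ) (hm : Measurable F) :
    ∫⁻ p, ‖moll κ F p‖ₑ ^ 2 ≤ ∫⁻ p, ‖F p‖ₑ ^ 2 := by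
  have hκm : Measurable fun z => ENNReal.ofReal (κ z) := h.isC1.continuous.measurable.ennreal_ofReal
  calc ∫⁻ p, ‖moll κ F p‖ₑ ^ 2
      ≤ ∫⁻ p, (∫⁻ z, ENNReal.ofReal (κ z) * ‖F (p - z)‖ₑ) ^ 2 := by
        refine lintegral_mono fun p => pow_le_pow_left' ?_ 2
        rw [moll_eq_integral_sub]
        refine (enorm_integral_le_lintegral_enorm _).trans (le_of_eq ?_)
        refine lintegral_congr fun z => ?_
        rw [enorm_mul, h.enorm_eq, mul_comm]
    _ ≤ (∫⁻ z, ENNReal.ofReal (κ z)) * ∫⁻ z, ENNReal.ofReal (κ z) * ∫⁻ p, ‖F (p - z)‖ₑ ^ 2 :=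
        lintegral_sq_lintegral_mul_le (H := fun p z => ‖F (p - z)‖ₑ) hκm (by fun_prop)
    _ = ∫⁻ p, ‖F p‖ₑ ^ 2 := by
        simp_rw [lintegral_sub_right_eq_self (fun p => ‖F p‖ₑ ^ 2)]
        rw [lintegral_mul_const _ hκm, h.mass, one_mul, one_mul]

end IsMollifier


/-! ### Existence of mollifiers -/

/-- Squaring the positive part makes it `C¹`. Both the periodic bump and the smoothed negative part
rely on this. -/
theorem hasDerivAt_max_zero_sq (x : ℝ) :
    HasDerivAt (fun x : ℝ => (max x 0) ^ 2) (2 * max x 0) x := by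
  rcases lt_trichotomy x 0 with h | rfl | h
  · have : (fun x : ℝ => (max x 0) ^ 2) =ᶠ[nhds x] fun _ => 0 := by
      filter_upwards [Iio_mem_nhds h] with y hy
      simp [max_eq_right (le_of_lt (mem_Iio.1 hy))]
    simpa [max_eq_right h.le] using (hasDerivAt_const x (0 : ℝ)).congr_of_eventuallyEq this
  · rw [hasDerivAt_iff_isLittleO_nhds_zero]
    have h1 : (fun h : ℝ => h ^ 2) =o[nhds 0] fun h : ℝ => h := by
      simpa using Asymptotics.isLittleO_pow_id (𝕜 := ℝ) (n := 2) (by norm_num)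
    refine Asymptotics.IsBigO.trans_isLittleO (Asymptotics.IsBigO.of_bound 1 ?_) h1
    refine Filter.Eventually.of_forall fun h => ?_
    simp only [zero_add, max_self, ne_eq, OfNat.ofNat_ne_zero, not_false_eq_true, zero_pow, sub_zero,
      mul_zero, smul_zero, one_mul, Real.norm_eq_abs, abs_pow]
    refine pow_le_pow_left₀ (abs_nonneg _) ?_ 2
    rcases le_total h 0 with hh | hh
    · simp [max_eq_right hh]
    · simp [max_eq_left hh]
  · have : (fun x : ℝ => (max x 0) ^ 2) =ᶠ[nhds x] fun x => x ^ 2 := by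
      filter_upwards [Ioi_mem_nhds h] with y hy
      simp [max_eq_left (le_of_lt (mem_Ioi.1 hy))]
    simpa [max_eq_left h.le] using (hasDerivAt_pow 2 x).congr_of_eventuallyEq this

/-- The (unnormalised) periodic bump `(δ² - sin² πx)₊²`. -/
noncomputable def sinBump (δ x : ℝ) : ℝ := (max (δ ^ 2 - Real.sin (Real.pi * x) ^ 2) 0) ^ 2

/-- The derivative of `sinBump`. -/
noncomputable def sinBumpDeriv (δ x : ℝ) : ℝ :=
  2 * max (δ ^ 2 - Real.sin (Real.pi * x) ^ 2) 0 *
    (-(2 * Real.sin (Real.pi * x) * (Real.cos (Real.pi * x) * Real.pi)))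

theorem hasDerivAt_sinBump (δ x : ℝ) : HasDerivAt (sinBump δ) (sinBumpDeriv δ x) x := by
  have h1 : HasDerivAt (fun x => Real.sin (Real.pi * x)) (Real.cos (Real.pi * x) * Real.pi) x := by
    simpa using ((hasDerivAt_id x).const_mul Real.pi).sin
  have h2 := (h1.pow 2).const_sub (δ ^ 2)
  have h3 := (hasDerivAt_max_zero_sq (δ ^ 2 - Real.sin (Real.pi * x) ^ 2)).comp x h2
  unfold sinBump sinBumpDeriv
  simpa [Function.comp_def] using h3

theorem continuous_sinBumpDeriv (δ : ℝ) : Continuous (sinBumpDeriv δ) := by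
  unfold sinBumpDeriv; fun_prop

theorem sin_pi_add_one (x : ℝ) : Real.sin (Real.pi * (x + 1)) = -Real.sin (Real.pi * x) := by
  rw [mul_add, mul_one, Real.sin_add_pi]

theorem cos_pi_add_one (x : ℝ) : Real.cos (Real.pi * (x + 1)) = -Real.cos (Real.pi * x) := by
  rw [mul_add, mul_one, Real.cos_add_pi]

theorem periodic_sinBump (δ : ℝ) : Function.Periodic (sinBump δ) 1 := fun x => by
  simp [sinBump, sin_pi_add_one]

theorem periodic_sinBumpDeriv (δ : ℝ) : Function.Periodic (sinBumpDeriv δ) 1 := fun x => by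
  simp [sinBumpDeriv, sin_pi_add_one, cos_pi_add_one]

/-- Jordan's inequality. It turns `|sin πx| < δ` into `|x| < δ/2` on the fundamental interval. -/
theorem two_mul_abs_le_abs_sin {x : ℝ} (hx : |x| ≤ 1 / 2) : 2 * |x| ≤ |Real.sin (Real.pi * x)| := by
  have key : ∀ y : ℝ, 0 ≤ y → y ≤ 1 / 2 → 2 * y ≤ Real.sin (Real.pi * y) := by
    intro y h0 h1
    have := Real.mul_le_sin (x := Real.pi * y) (by positivity)
      (by nlinarith [Real.pi_pos])
    calc 2 * y = 2 / Real.pi * (Real.pi * y) := by field_simp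
      _ ≤ _ := this
  rcases le_total 0 x with h | h
  · rw [abs_of_nonneg h] at hx ⊢
    exact (key x h hx).trans (le_abs_self _)
  · rw [abs_of_nonpos h] at hx ⊢
    have := (key (-x) (by linarith) hx).trans (le_abs_self _)
    rwa [mul_neg Real.pi, Real.sin_neg, abs_neg] at this

theorem abs_lt_of_sinBump_arg {δ x : ℝ} (hδ : 0 < δ) (hx : |x| ≤ 1 / 2)
    (h : max (δ ^ 2 - Real.sin (Real.pi * x) ^ 2) 0 ≠ 0) : |x| < δ / 2 := by
  have h1 : 0 < δ ^ 2 - Real.sin (Real.pi * x) ^ 2 := by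
    by_contra hc
    exact h (max_eq_right (not_lt.1 hc))
  have h2 : |Real.sin (Real.pi * x)| < δ := abs_lt_of_sq_lt_sq (by linarith) hδ.le
  have := two_mul_abs_le_abs_sin hx
  linarith

/-- Where the bump is nonzero `|sin πx| ≤ δ`; with `π ≤ 4` the product is at most `2δ² · 2δ · 4`. -/
theorem abs_sinBumpDeriv_le {δ x : ℝ} (hδ : 0 < δ) :
    |sinBumpDeriv δ x| ≤ 16 * δ ^ 3 := by
  unfold sinBumpDeriv
  by_cases h1 : 0 < δ ^ 2 - Real.sin (Real.pi * x) ^ 2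
  · have h2 : |Real.sin (Real.pi * x)| ≤ δ := abs_le_of_sq_le_sq (by linarith) hδ.le
    rw [max_eq_left h1.le, abs_mul, abs_neg, abs_mul, abs_mul, abs_mul, abs_mul, abs_of_pos h1,
      abs_of_pos Real.pi_pos]
    have h3 : |Real.cos (Real.pi * x)| ≤ 1 := Real.abs_cos_le_one _
    have h4 : δ ^ 2 - Real.sin (Real.pi * x) ^ 2 ≤ δ ^ 2 := by nlinarith [sq_nonneg (Real.sin (Real.pi * x))]
    have h5 := Real.pi_lt_four
    have h6 : |Real.cos (Real.pi * x)| * Real.pi ≤ 4 := by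
      nlinarith [abs_nonneg (Real.cos (Real.pi * x)), Real.pi_pos]
    simp only [abs_two]
    calc _ ≤ 2 * δ ^ 2 * (2 * δ * 4) := by gcongr
      _ = _ := by ring
  · rw [max_eq_right (not_lt.1 h1)]
    simp; positivity

/-- Height `16δ³` on a support of width `δ`. -/
theorem integral_abs_sinBumpDeriv_le {δ : ℝ} (hδ : 0 < δ) :
    ∫ x in Ioc (-(1 / 2) : ℝ) (-(1 / 2) + 1), |sinBumpDeriv δ x| ≤ 16 * δ ^ 4 := by
  have h1 : ∀ x ∈ Ioc (-(1 / 2) : ℝ) (-(1 / 2) + 1), |sinBumpDeriv δ x| ≤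
      (Icc (-(δ / 2)) (δ / 2)).indicator (fun _ => 16 * δ ^ 3) x := by
    intro x hx
    by_cases hm : x ∈ Icc (-(δ / 2)) (δ / 2)
    · rw [indicator_of_mem hm]; exact abs_sinBumpDeriv_le hδ
    · rw [indicator_of_notMem hm]
      have : max (δ ^ 2 - Real.sin (Real.pi * x) ^ 2) 0 = 0 := by
        by_contra hne
        have := abs_lt_of_sinBump_arg hδ (abs_le.2 ⟨by linarith [hx.1], by linarith [hx.2]⟩) hne
        exact hm ⟨(abs_lt.1 this).1.le, (abs_lt.1 this).2.le⟩
      simp [sinBumpDeriv, this]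
  have hi : Integrable ((Icc (-(δ / 2)) (δ / 2)).indicator (fun _ => 16 * δ ^ 3)) :=
    (integrable_indicator_iff measurableSet_Icc).2 (integrableOn_const (by simp))
  calc _ ≤ ∫ x in Ioc (-(1 / 2) : ℝ) (-(1 / 2) + 1),
        (Icc (-(δ / 2)) (δ / 2)).indicator (fun _ => 16 * δ ^ 3) x :=
        setIntegral_mono_on (((continuous_sinBumpDeriv δ).abs.integrableOn_Icc).mono_set
          Ioc_subset_Icc_self) hi.integrableOn measurableSet_Ioc h1
    _ ≤ ∫ x, (Icc (-(δ / 2)) (δ / 2)).indicator (fun _ => 16 * δ ^ 3) x :=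
        setIntegral_le_integral hi (Filter.Eventually.of_forall fun x =>
          indicator_nonneg (fun _ _ => by positivity) x)
    _ = 16 * δ ^ 4 := by
        rw [integral_indicator measurableSet_Icc, setIntegral_const]
        simp [Measure.real, Real.volume_Icc]
        rw [ENNReal.toReal_ofReal hδ.le]
        ring

/-- For `|x| ≤ δ/8` one has `|sin πx| ≤ δ/2` because `π < 4`. The bump is then at least `(3δ²/4)² ≥
δ⁴/2` on an interval of length `δ/4`. -/
theorem le_integral_sinBump {δ : ℝ} (hδ : 0 < δ) (hδ' : δ ≤ 1) :
    δ ^ 5 / 8 ≤ ∫ x in Ioc (-(1 / 2) : ℝ) (-(1 / 2) + 1), sinBump δ x := by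
  have hc : Continuous (sinBump δ) := by unfold sinBump; fun_prop
  have h0 : ∀ x, 0 ≤ sinBump δ x := fun x => sq_nonneg _
  have hsub : Ioc (-(δ / 8)) (δ / 8) ⊆ Ioc (-(1 / 2) : ℝ) (-(1 / 2) + 1) :=
    Ioc_subset_Ioc (by linarith) (by linarith)
  have hint : IntegrableOn (sinBump δ) (Ioc (-(1 / 2) : ℝ) (-(1 / 2) + 1)) :=
    hc.integrableOn_Icc.mono_set Ioc_subset_Icc_self
  have hl : ∀ x ∈ Ioc (-(δ / 8)) (δ / 8), δ ^ 4 / 2 ≤ sinBump δ x := by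
    intro x hx
    have h1 : |x| ≤ δ / 8 := abs_le.2 ⟨hx.1.le, hx.2⟩
    have h2 : |Real.sin (Real.pi * x)| ≤ δ / 2 := by
      refine (Real.abs_sin_le_abs).trans ?_
      rw [abs_mul, abs_of_pos Real.pi_pos]
      nlinarith [Real.pi_lt_four, abs_nonneg x]
    have h3 : Real.sin (Real.pi * x) ^ 2 ≤ (δ / 2) ^ 2 := by
      rw [← sq_abs]; exact pow_le_pow_left₀ (abs_nonneg _) h2 2
    have h4 : 3 / 4 * δ ^ 2 ≤ max (δ ^ 2 - Real.sin (Real.pi * x) ^ 2) 0 :=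
      le_max_of_le_left (by nlinarith)
    calc δ ^ 4 / 2 ≤ (3 / 4 * δ ^ 2) ^ 2 := by nlinarith [sq_nonneg (δ ^ 2)]
      _ ≤ _ := pow_le_pow_left₀ (by positivity) h4 2
  calc δ ^ 5 / 8 = ∫ x in Ioc (-(δ / 8)) (δ / 8), δ ^ 4 / 2 := by
        rw [setIntegral_const]
        simp [Measure.real, Real.volume_Ioc]
        rw [ENNReal.toReal_ofReal (by positivity)]
        ring
    _ ≤ ∫ x in Ioc (-(δ / 8)) (δ / 8), sinBump δ x :=
        setIntegral_mono_on (integrableOn_const (by simp)) (hint.mono_set hsub) measurableSet_Ioc hl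
    _ ≤ _ := setIntegral_mono_set hint (Filter.Eventually.of_forall h0) hsub.eventuallyLE

/-- One-dimensional periodic bumps. -/
theorem exists_circle_bump {δ : ℝ} (hδ : 0 < δ) (hδ' : δ ≤ 1) :
    ∃ k dk : UnitAddCircle → ℝ, Continuous k ∧ Continuous dk ∧
      (∀ x : ℝ, HasDerivAt (fun x : ℝ => k x) (dk x) x) ∧ (∀ y, 0 ≤ k y) ∧
      (∀ y, k y ≠ 0 → ‖y‖ ≤ δ) ∧ ∫ y, k y = 1 ∧ ∫ y, |dk y| ≤ 128 / δ := by
  set m : ℝ := ∫ x in Ioc (-(1 / 2) : ℝ) (-(1 / 2) + 1), sinBump δ x with hm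
  have hm1 := le_integral_sinBump hδ hδ'
  have hm0 : 0 < m := lt_of_lt_of_le (by positivity) hm1
  have hc : Continuous (sinBump δ) := by unfold sinBump; fun_prop
  let k : UnitAddCircle → ℝ := fun y => (periodic_sinBump δ).lift y / m
  let dk : UnitAddCircle → ℝ := fun y => (periodic_sinBumpDeriv δ).lift y / m
  have hk : ∀ x : ℝ, k x = sinBump δ x / m := fun x => by simp [k, Function.Periodic.lift_coe]
  have hdk : ∀ x : ℝ, dk x = sinBumpDeriv δ x / m := fun x => by simp [dk, Function.Periodic.lift_coe]
  have hq : IsOpenQuotientMap ((↑) : ℝ → UnitAddCircle) := QuotientAddGroup.isOpenQuotientMap_mk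
  refine ⟨k, dk, ?_, ?_, fun x => ?_, fun y => ?_, fun y hy => ?_, ?_, ?_⟩
  · refine hq.continuous_comp_iff.1 ?_
    rw [show k ∘ ((↑) : ℝ → UnitAddCircle) = fun x => sinBump δ x / m from funext hk]
    exact hc.div_const m
  · refine hq.continuous_comp_iff.1 ?_
    rw [show dk ∘ ((↑) : ℝ → UnitAddCircle) = fun x => sinBumpDeriv δ x / m from funext hdk]
    exact (continuous_sinBumpDeriv δ).div_const m
  · rw [show (fun x : ℝ => k x) = fun x => sinBump δ x / m from funext hk, hdk]
    exact (hasDerivAt_sinBump δ x).div_const m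
  · obtain ⟨x, rfl⟩ := hq.surjective y
    rw [hk]
    exact div_nonneg (sq_nonneg _) hm0.le
  · obtain ⟨x, rfl⟩ := hq.surjective y
    rw [hk] at hy
    rw [UnitAddCircle.norm_eq]
    have h1 : sinBump δ (x - round x) ≠ 0 := by
      have := (periodic_sinBump δ).sub_int_mul_eq (round x) (x := x)
      rw [mul_one] at this
      rw [this]
      intro h; simp [h] at hy
    have h2 := abs_lt_of_sinBump_arg hδ (abs_sub_round x) (fun h => h1 (by simp [sinBump, h]))
    linarith
  · rw [← UnitAddCircle.integral_preimage (-(1 / 2))]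
    simp_rw [hk]
    rw [integral_div, ← hm, div_self hm0.ne']
  · rw [← UnitAddCircle.integral_preimage (-(1 / 2))]
    simp_rw [hdk, abs_div, abs_of_pos hm0]
    rw [integral_div]
    calc _ ≤ 16 * δ ^ 4 / (δ ^ 5 / 8) :=
          div_le_div₀ (by positivity) (integral_abs_sinBumpDeriv_le hδ) (by positivity) hm1
      _ = 128 / δ := by field_simp; norm_num

/-- A product of a time bump and three circle bumps. A spatial derivative hits a single factor, so
its mass is at most `128/δ` whatever `τ` is; `τ` can later be chosen much smaller than `δ`. -/
theorem exists_isMollifier {τ δ : ℝ} (hτ : 0 < τ) (hδ : 0 < δ) (hδ' : δ ≤ 1) :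
    ∃ κ, IsMollifier 128 τ δ κ := by
  obtain ⟨k, dk, hkc, hdkc, hder, hk0, hks, hk1, hdk⟩ := exists_circle_bump hδ hδ'
  -- Centre and outer radius are both `τ/2`, so the support lies in strictly positive times and
  -- convolution sees only the past.
  let b : ContDiffBump (τ / 2) := ⟨τ / 4, τ / 2, by positivity, by linarith⟩
  let θ : ℝ → ℝ := b.normed volume
  have hθ : ContDiff ℝ 1 θ := b.contDiff_normed (n := 1)
  have hθ0 : ∀ t, 0 ≤ θ t := b.nonneg_normed
  have hθs : ∀ t, θ t ≠ 0 → t ∈ Ioo 0 τ := by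
    intro t ht
    have : t ∈ Function.support θ := ht
    rw [b.support_normed_eq, Real.ball_eq_Ioo] at this
    simpa [b] using this
  have hθ1 : ∫ t, θ t = 1 := b.integral_normed
  have hθi : Integrable θ := b.integrable_normed
  let κ : ℝ × T3 → ℝ := fun p => θ p.1 * ∏ i, k (p.2 i)
  have hkC : ContDiff ℝ 1 (fun x : ℝ => k x) := by
    rw [contDiff_one_iff_deriv]
    refine ⟨fun x => (hder x).differentiableAt, ?_⟩
    rw [show deriv (fun x : ℝ => k x) = fun x : ℝ => dk x from funext fun x => (hder x).deriv]
    exact hdkc.comp QuotientAddGroup.isOpenQuotientMap_mk.continuous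
  have hκ : IsC1 κ := by
    have : κ ∘ cover = fun q : ℝ × E3 => θ q.1 * ∏ i, (fun x : ℝ => k x) (q.2 i) := rfl
    rw [IsC1, this]
    refine (hθ.comp contDiff_fst).mul (contDiff_prod fun i _ => hkC.comp ?_)
    exact (contDiff_euclidean.1 contDiff_snd) i
  have hpart : ∀ j p, spacePartial j κ p =
      θ p.1 * ∏ i, (if i = j then dk (p.2 i) else k (p.2 i)) := by
    intro j p
    obtain ⟨⟨t, z⟩, rfl⟩ := cover_surjective p
    have h1 : ∀ s : ℝ, κ (t, toT3 z + toT3 (EuclideanSpace.single j s)) =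
        θ t * (k ((z j + s : ℝ)) * ∏ i ∈ Finset.univ.erase j, k (z i)) := by
      intro s
      simp only [κ]
      rw [← Finset.mul_prod_erase _ _ (Finset.mem_univ j)]
      congr 2
      · simp [toT3]
      · refine Finset.prod_congr rfl fun i hi => ?_
        simp [toT3, (Finset.mem_erase.1 hi).1]
    have h2 : HasDerivAt (fun s : ℝ => k ((z j + s : ℝ))) (dk (z j)) 0 := by
      have h3 : HasDerivAt (fun x : ℝ => k x) (dk (z j)) (z j + 0) := by
        simpa using hder (z j)
      simpa using h3.comp_const_add (z j) 0
    have h4 := ((h2.mul_const (∏ i ∈ Finset.univ.erase j, k (z i))).const_mul (θ t)).deriv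
    change deriv (fun s : ℝ => κ (t, toT3 z + toT3 (EuclideanSpace.single j s))) 0 = _
    simp_rw [h1]
    rw [h4, ← Finset.mul_prod_erase _ _ (Finset.mem_univ j)]
    simp only [cover, if_true]
    congr 2
    refine Finset.prod_congr rfl fun i hi => ?_
    simp [(Finset.mem_erase.1 hi).1, toT3]
  refine ⟨κ, hκ, fun p => ?_, fun p hp => ?_, fun p hp => ?_, ?_, fun j => ?_⟩
  · exact mul_nonneg (hθ0 _) (Finset.prod_nonneg fun i _ => hk0 _)
  · exact hθs _ (left_ne_zero_of_mul hp)
  · refine (pi_norm_le_iff_of_nonneg hδ.le).2 fun i => hks _ ?_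
    exact Finset.prod_ne_zero_iff.1 (right_ne_zero_of_mul hp) i (Finset.mem_univ i)
  · have hi : Integrable κ := by
      refine Integrable.mul_prod (μ := (volume : Measure ℝ)) (ν := (volume : Measure T3))
        hθi (g := fun x : T3 => ∏ i, k (x i)) ?_
      exact Continuous.integrable_of_hasCompactSupport (by fun_prop) (HasCompactSupport.of_compactSpace _)
    rw [← ofReal_integral_eq_lintegral_ofReal hi (Filter.Eventually.of_forall fun p =>
      mul_nonneg (hθ0 _) (Finset.prod_nonneg fun i _ => hk0 _))]
    have h1 := integral_prod_mul (μ := (volume : Measure ℝ)) (ν := (volume : Measure T3)) θ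
      (fun x : T3 => ∏ i, k (x i))
    have h2 := integral_fintype_prod_volume_eq_prod (𝕜 := ℝ) (ι := Fin 3) (fun _ => k)
    rw [Measure.volume_eq_prod, h1, h2, hθ1, hk1]
    simp
  · have e : ∀ p, ‖spacePartial j κ p‖ₑ = ENNReal.ofReal
        (θ p.1 * ∏ i, (if i = j then |dk (p.2 i)| else k (p.2 i))) := by
      intro p
      rw [hpart, Real.enorm_eq_ofReal_abs, abs_mul, abs_of_nonneg (hθ0 _), Finset.abs_prod]
      congr 2
      refine Finset.prod_congr rfl fun i _ => ?_
      split_ifs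
      · rfl
      · exact abs_of_nonneg (hk0 _)
    let g : Fin 3 → UnitAddCircle → ℝ := fun i y => if i = j then |dk y| else k y
    have hg : ∀ i, Continuous (g i) := by
      intro i
      by_cases h : i = j
      · simpa [g, h] using hdkc.abs
      · simpa [g, h] using hkc
    have hg0 : ∀ i y, 0 ≤ g i y := by
      intro i y
      by_cases h : i = j
      · simp [g, h]
      · simpa [g, h] using hk0 y
    have hi : Integrable (fun p : ℝ × T3 => θ p.1 * ∏ i, g i (p.2 i)) := by
      refine Integrable.mul_prod (μ := (volume : Measure ℝ)) (ν := (volume : Measure T3))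
        hθi (g := fun x : T3 => ∏ i, g i (x i)) ?_
      refine Continuous.integrable_of_hasCompactSupport ?_ (HasCompactSupport.of_compactSpace _)
      exact continuous_finsetProd _ fun i _ => (hg i).comp (continuous_apply i)
    simp_rw [e]
    rw [← ofReal_integral_eq_lintegral_ofReal hi (Filter.Eventually.of_forall fun p =>
      mul_nonneg (hθ0 _) (Finset.prod_nonneg fun i _ => hg0 _ _))]
    have h1 := integral_prod_mul (μ := (volume : Measure ℝ)) (ν := (volume : Measure T3)) θ
      (fun x : T3 => ∏ i, g i (x i))
    have h2 := integral_fintype_prod_volume_eq_prod (𝕜 := ℝ) (ι := Fin 3) g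
    rw [Measure.volume_eq_prod, h1, h2, hθ1, one_mul]
    refine ENNReal.ofReal_le_ofReal ?_
    rw [← Finset.mul_prod_erase _ _ (Finset.mem_univ j)]
    have h3 : ∏ i ∈ Finset.univ.erase j, ∫ y, g i y = 1 := by
      refine Finset.prod_eq_one fun i hi => ?_
      simp [g, (Finset.mem_erase.1 hi).1, hk1]
    rw [h3, mul_one]
    simpa [g] using hdk


/-! ### Integration by parts on the cylinder -/

namespace IsC1

variable {ψ : ℝ × T3 → ℝ}

theorem exists_bound_on (h : IsC1 ψ) (T : ℝ) : ∃ B, 0 ≤ B ∧ ∀ p ∈ cyl T,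
    |ψ p| ≤ B ∧ |timeDeriv ψ p| ≤ B ∧ ∀ j, |spacePartial j ψ p| ≤ B := by
  have hK : IsCompact (Icc 0 T ×ˢ (univ : Set T3)) := isCompact_Icc.prod isCompact_univ
  obtain ⟨B₁, h1⟩ := hK.exists_bound_of_continuousOn h.continuous.continuousOn
  obtain ⟨B₂, h2⟩ := hK.exists_bound_of_continuousOn h.continuous_timeDeriv.continuousOn
  have h3 := fun j => hK.exists_bound_of_continuousOn (h.continuous_spacePartial j).continuousOn
  choose B₃ h3 using h3
  have hs : ∀ p ∈ cyl T, p ∈ Icc 0 T ×ˢ (univ : Set T3) := fun p hp =>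
    ⟨Ioo_subset_Icc_self hp.1, mem_univ _⟩
  refine ⟨|B₁| + |B₂| + ∑ j, |B₃ j|, by positivity, fun p hp => ⟨?_, ?_, fun j => ?_⟩⟩
  · have := (h1 p (hs p hp)).trans (le_abs_self _)
    have h4 : 0 ≤ ∑ j, |B₃ j| := by positivity
    rw [Real.norm_eq_abs] at this
    linarith [abs_nonneg B₂]
  · have := (h2 p (hs p hp)).trans (le_abs_self _)
    have h4 : 0 ≤ ∑ j, |B₃ j| := by positivity
    rw [Real.norm_eq_abs] at this
    linarith [abs_nonneg B₁]
  · have := (h3 j p (hs p hp)).trans (le_abs_self _)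
    have h4 := Finset.single_le_sum (f := fun j => |B₃ j|) (fun _ _ => abs_nonneg _)
      (Finset.mem_univ j)
    rw [Real.norm_eq_abs] at this
    linarith [abs_nonneg B₁, abs_nonneg B₂]

variable {T : ℝ}

theorem memLp_top (h : IsC1 ψ) : MemLp ψ ∞ (spaceTime T) := by
  obtain ⟨B, -, hB⟩ := h.exists_bound_on T
  exact memLp_top_of_bound h.continuous.aestronglyMeasurable B
    ((ae_mem_cyl T).mono fun p hp => (hB p hp).1)

theorem memLp_top_timeDeriv (h : IsC1 ψ) : MemLp (timeDeriv ψ) ∞ (spaceTime T) := by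
  obtain ⟨B, -, hB⟩ := h.exists_bound_on T
  exact memLp_top_of_bound h.continuous_timeDeriv.aestronglyMeasurable B
    ((ae_mem_cyl T).mono fun p hp => (hB p hp).2.1)

theorem memLp_top_spacePartial (h : IsC1 ψ) (j : Fin 3) :
    MemLp (spacePartial j ψ) ∞ (spaceTime T) := by
  obtain ⟨B, -, hB⟩ := h.exists_bound_on T
  exact memLp_top_of_bound (h.continuous_spacePartial j).aestronglyMeasurable B
    ((ae_mem_cyl T).mono fun p hp => (hB p hp).2.2 j)

end IsC1

section

variable {T : ℝ} {u : ℝ × T3 → E3} {Du : ℝ × T3 → Mat3}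

theorem IsL2W12.memLp_comp (hu : IsL2W12 T u Du) (i : Fin 3) :
    MemLp (fun p => u p i) 2 (spaceTime T) :=
  (EuclideanSpace.proj i : E3 →L[ℝ] ℝ).comp_memLp' hu.memLp

theorem IsL2W12.memLp_grad_comp (hu : IsL2W12 T u Du) (a : Fin 3 × Fin 3) :
    MemLp (fun p => Du p a) 2 (spaceTime T) :=
  (EuclideanSpace.proj a : Mat3 →L[ℝ] ℝ).comp_memLp' hu.memLp_grad

theorem IsL2W12.memLp_divergence (hu : IsL2W12 T u Du) :
    MemLp (divergence Du) 2 (spaceTime T) :=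
  memLp_finsetSum Finset.univ fun i _ => hu.memLp_grad_comp (i, i)

theorem IsL2W12.integral_mul_spacePartial (hu : IsL2W12 T u Du) (i j : Fin 3)
    {φ : ℝ × T3 → ℝ} (hφ : IsC1 φ) :
    ∫ p, u p i * spacePartial j φ p ∂(spaceTime T) = -∫ p, Du p (i, j) * φ p ∂(spaceTime T) := by
  have h1 : Integrable (fun p => u p i * spacePartial j φ p) (spaceTime T) :=
    ((hφ.memLp_top_spacePartial j).mul (hu.memLp_comp i) (r := 2)).integrable (by norm_num) |>.congr
      (Filter.Eventually.of_forall fun p => by simp [mul_comm])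
  have h2 : Integrable (fun p => Du p (i, j) * φ p) (spaceTime T) :=
    (hφ.memLp_top.mul (hu.memLp_grad_comp (i, j)) (r := 2)).integrable (by norm_num) |>.congr
      (Filter.Eventually.of_forall fun p => by simp [mul_comm])
  rw [spaceTime] at h1 h2 ⊢
  rw [integral_prod _ h1, integral_prod _ h2, ← integral_neg]
  refine integral_congr_ae ?_
  filter_upwards [hu.weak_grad] with t ht
  exact (ht i j).2.2 (fun x => φ (t, x)) (hφ.slice t)

theorem IsC1.integral_timeDeriv {φ : ℝ × T3 → ℝ} (hT : 0 < T) (hφ : IsC1 φ)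
    (h0 : ∀ x, φ (T, x) = 0) :
    ∫ p, timeDeriv φ p ∂(spaceTime T) = -∫ x, φ (0, x) := by
  have h1 : Integrable (timeDeriv φ) (spaceTime T) :=
    hφ.memLp_top_timeDeriv.integrable (by simp)
  rw [spaceTime] at h1 ⊢
  rw [integral_prod_symm _ h1, ← integral_neg]
  congr 1
  funext x
  rw [← integral_Ioc_eq_integral_Ioo, ← intervalIntegral.integral_of_le hT.le,
    intervalIntegral.integral_eq_sub_of_hasDerivAt (fun t _ => hφ.hasDerivAt_time t x)]
  · simp [h0]
  · exact (hφ.continuous_timeDeriv.comp (by fun_prop : Continuous fun t : ℝ => (t, x))).intervalIntegrable _ _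

theorem dirDeriv_eq (v : ℝ × T3 → E3) (ψ : ℝ × T3 → ℝ) (p : ℝ × T3) :
    dirDeriv v ψ p = ∑ j, v p j * spacePartial j ψ p := rfl

theorem IsL2W12.memLp_dirDeriv (hu : IsL2W12 T u Du) {φ : ℝ × T3 → ℝ} (hφ : IsC1 φ) :
    MemLp (dirDeriv u φ) 2 (spaceTime T) :=
  memLp_finsetSum Finset.univ fun j _ =>
    (hφ.memLp_top_spacePartial j).mul' (hu.memLp_comp j)

theorem IsL2W12.integral_dirDeriv (hu : IsL2W12 T u Du) {φ : ℝ × T3 → ℝ} (hφ : IsC1 φ) :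
    ∫ p, dirDeriv u φ p ∂(spaceTime T) = -∫ p, divergence Du p * φ p ∂(spaceTime T) := by
  have h1 : ∀ j, Integrable (fun p => u p j * spacePartial j φ p) (spaceTime T) := fun j =>
    MemLp.integrable (q := 2) (by norm_num) ((hφ.memLp_top_spacePartial j).mul' (hu.memLp_comp j))
  have h2 : ∀ j, Integrable (fun p => Du p (j, j) * φ p) (spaceTime T) := fun j =>
    MemLp.integrable (q := 2) (by norm_num) (hφ.memLp_top.mul' (hu.memLp_grad_comp (j, j)))
  simp_rw [dirDeriv_eq, divergence, Finset.sum_mul]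
  rw [integral_finsetSum _ fun j _ => h1 j, integral_finsetSum _ fun j _ => h2 j,
    ← Finset.sum_neg_distrib]
  exact Finset.sum_congr rfl fun j _ => hu.integral_mul_spacePartial j j hφ

end

theorem IsTestFun.eq_zero_end {T : ℝ} {ψ : ℝ × T3 → ℝ} (h : IsTestFun T ψ) (x : T3) :
    ψ (T, x) = 0 := by
  obtain ⟨τ, hτ, h0⟩ := h.support
  exact h0 T x hτ.le

/-! ### A smooth approximation of the negative part -/

/-- A `C¹` concave approximation of `min r 0`. -/
noncomputable def softNeg (ε r : ℝ) : ℝ := ε - Real.sqrt (ε ^ 2 + (max (-r) 0) ^ 2)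

/-- The derivative of `softNeg`. -/
noncomputable def softNegDeriv (ε r : ℝ) : ℝ := max (-r) 0 / Real.sqrt (ε ^ 2 + (max (-r) 0) ^ 2)

section softNeg

variable {ε : ℝ}

theorem softNeg_root_ge (ε r : ℝ) : ε ≤ Real.sqrt (ε ^ 2 + (max (-r) 0) ^ 2) :=
  Real.le_sqrt_of_sq_le (by nlinarith [sq_nonneg (max (-r) 0)])

theorem hasDerivAt_softNeg (hε : 0 < ε) (r : ℝ) : HasDerivAt (softNeg ε) (softNegDeriv ε r) r := by
  have hR := lt_of_lt_of_le hε (softNeg_root_ge ε r)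
  have h1 := ((hasDerivAt_max_zero_sq (-r)).comp r (hasDerivAt_neg r)).const_add (ε ^ 2)
  have h2 := (h1.sqrt (Real.sqrt_pos.1 hR).ne').const_sub ε
  have h3 : softNegDeriv ε r = -(2 * max (-r) 0 * -1 /
      (2 * Real.sqrt (ε ^ 2 + ((fun x => max x 0 ^ 2) ∘ Neg.neg) r))) := by
    simp only [softNegDeriv, Function.comp]
    field_simp
  rw [h3]
  exact h2

theorem continuous_softNegDeriv (hε : 0 < ε) : Continuous (softNegDeriv ε) := by
  unfold softNegDeriv
  refine Continuous.div (by fun_prop) (by fun_prop) fun r => ?_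
  exact (lt_of_lt_of_le hε (softNeg_root_ge ε r)).ne'

theorem contDiff_softNeg (hε : 0 < ε) : ContDiff ℝ 1 (softNeg ε) := by
  rw [contDiff_one_iff_deriv]
  refine ⟨fun r => (hasDerivAt_softNeg hε r).differentiableAt, ?_⟩
  rw [show deriv (softNeg ε) = softNegDeriv ε from funext fun r => (hasDerivAt_softNeg hε r).deriv]
  exact continuous_softNegDeriv hε

theorem softNegDeriv_nonneg (ε r : ℝ) : 0 ≤ softNegDeriv ε r :=
  div_nonneg (le_max_right _ _) (Real.sqrt_nonneg _)

theorem softNegDeriv_le_one (hε : 0 < ε) (r : ℝ) : softNegDeriv ε r ≤ 1 := by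
  have hR := lt_of_lt_of_le hε (softNeg_root_ge ε r)
  rw [softNegDeriv, div_le_one hR]
  exact Real.le_sqrt_of_sq_le (by nlinarith)

theorem softNegDeriv_mul_le (ε r : ℝ) : softNegDeriv ε r * r ≤ 0 := by
  rcases le_total 0 r with h | h
  · simp [softNegDeriv, max_eq_right (neg_nonpos.2 h)]
  · exact mul_nonpos_of_nonneg_of_nonpos (softNegDeriv_nonneg ε r) h

theorem neg_le_neg_softNeg (ε r : ℝ) : -r - ε ≤ -softNeg ε r := by
  have : -r ≤ Real.sqrt (ε ^ 2 + (max (-r) 0) ^ 2) :=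
    (le_max_left _ _).trans (Real.le_sqrt_of_sq_le (by nlinarith))
  simp only [softNeg]
  linarith

theorem softNeg_zero (hε : 0 < ε) : softNeg ε 0 = 0 := by
  simp [softNeg, Real.sqrt_sq hε.le]

/-- The function `min r 0` is homogeneous of degree one, so for it this difference is zero. For the
smooth version it equals `ε²/R - ε`, where the root `R` is at least `ε`. -/
theorem abs_softNegDeriv_mul_sub_le (hε : 0 < ε) (r : ℝ) : |softNegDeriv ε r * r - softNeg ε r| ≤ ε := by
  have hR := lt_of_lt_of_le hε (softNeg_root_ge ε r)
  have hge := softNeg_root_ge ε r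
  have hsq : Real.sqrt (ε ^ 2 + (max (-r) 0) ^ 2) ^ 2 = ε ^ 2 + (max (-r) 0) ^ 2 :=
    Real.sq_sqrt (by positivity)
  have hm : max (-r) 0 * r = -(max (-r) 0) ^ 2 := by
    rcases le_total 0 r with h | h
    · simp [max_eq_right (neg_nonpos.2 h)]
    · rw [max_eq_left (neg_nonneg.2 h)]; ring
  simp only [softNegDeriv, softNeg]
  set R := Real.sqrt (ε ^ 2 + (max (-r) 0) ^ 2)
  have h1 : max (-r) 0 / R * r - (ε - R) = ε * (ε / R) - ε := by
    rw [div_mul_eq_mul_div, hm]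
    field_simp
    linarith
  have h2 : ε / R ≤ 1 := (div_le_one hR).2 hge
  have h3 : 0 ≤ ε / R := by positivity
  rw [h1, abs_le]
  constructor <;> nlinarith

end softNeg


/-! ### Existence of a weak solution by the Hahn–Banach theorem -/

/-- The adjoint transport operator `∂_t ψ + u·∇ψ + ψ div u - Λ ψ`. -/
noncomputable def transportAdjoint (u : ℝ × T3 → E3) (Du : ℝ × T3 → Mat3) (Λ : ℝ × T3 → ℝ)
    (ψ : ℝ × T3 → ℝ) (p : ℝ × T3) : ℝ :=
  timeDeriv ψ p + dirDeriv u ψ p + divergence Du p * ψ p - Λ p * ψ p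

theorem dirDeriv_comp {u : ℝ × T3 → E3} {ψ : ℝ × T3 → ℝ} (h : IsC1 ψ) (p : ℝ × T3) {f : ℝ → ℝ}
    {f' : ℝ} (hf : HasDerivAt f f' (ψ p)) :
    dirDeriv u (fun p => f (ψ p)) p = f' * dirDeriv u ψ p := by
  simp_rw [dirDeriv_eq, h.spacePartial_comp _ p hf, Finset.mul_sum]
  exact Finset.sum_congr rfl fun j _ => by ring

section

variable {T : ℝ} {u : ℝ × T3 → E3} {Du : ℝ × T3 → Mat3} {Λ : ℝ × T3 → ℝ} {ψ : ℝ × T3 → ℝ}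

theorem memLp_transportAdjoint (hu : IsL2W12 T u Du) (hΛ : MemLp Λ 2 (spaceTime T))
    (hψ : IsC1 ψ) : MemLp (transportAdjoint u Du Λ ψ) 2 (spaceTime T) :=
  (((hψ.memLp_top_timeDeriv.mono_exponent le_top).add (hu.memLp_dirDeriv hψ)).add
    (hψ.memLp_top.mul' hu.memLp_divergence)).sub (hψ.memLp_top.mul' hΛ)

theorem integrable_slice (hψ : IsC1 ψ) (t : ℝ) : Integrable fun x => ψ (t, x) :=
  (hψ.continuous.comp (by fun_prop : Continuous fun x : T3 => (t, x))).integrable_of_hasCompactSupport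
    (HasCompactSupport.of_compactSpace _)

/-- A weak maximum principle for the adjoint equation. With `s(r) = min r 0`, the expression `∂_t
s(ψ) + u·∇s(ψ) + s(ψ) div u` integrates to `-∫s(ψ(0,·)) ≥ -∫ψ(0,·)`. It also equals `s'(ψ) Lψ + Λ
s'(ψ) ψ`, which is at most `(Lψ)⁺` since `0 ≤ s' ≤ 1` and `s'(r) r ≤ 0`. Using `softNeg` for `s`
costs an error of order `ε`. -/
theorem neg_integral_initial_le (hT : 0 < T) (hu : IsL2W12 T u Du)
    (hΛ : MemLp Λ 2 (spaceTime T)) (hΛ0 : ∀ᵐ p ∂(spaceTime T), 0 ≤ Λ p) (hψ : IsTestFun T ψ) :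
    -∫ x, ψ (0, x) ≤ ∫ p, max (transportAdjoint u Du Λ ψ p) 0 ∂(spaceTime T) := by
  have hC := hψ.isC1
  set f := transportAdjoint u Du Λ ψ with hf
  have hfL : MemLp f 2 (spaceTime T) := memLp_transportAdjoint hu hΛ hC
  have hfi : Integrable f (spaceTime T) := hfL.integrable (by norm_num)
  have hdi : Integrable (divergence Du) (spaceTime T) := hu.memLp_divergence.integrable (by norm_num)
  have main : ∀ ε > 0, -∫ x, ψ (0, x) ≤ (∫ p, max (f p) 0 ∂(spaceTime T)) +
      ε * (1 + ∫ p, |divergence Du p| ∂(spaceTime T)) := by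
    intro ε hε
    have hS : IsC1 fun p => softNeg ε (ψ p) := IsC1.comp_left (contDiff_softNeg hε) hC
    have hs : ∀ p, HasDerivAt (softNeg ε) (softNegDeriv ε (ψ p)) (ψ p) := fun p =>
      hasDerivAt_softNeg hε _
    have i1 : ∫ p, timeDeriv (fun p => softNeg ε (ψ p)) p ∂(spaceTime T) =
        -∫ x, softNeg ε (ψ (0, x)) :=
      hS.integral_timeDeriv hT fun x => by rw [hψ.eq_zero_end, softNeg_zero hε]
    have i2 := hu.integral_dirDeriv hS
    have g1 : Integrable (timeDeriv fun p => softNeg ε (ψ p)) (spaceTime T) :=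
      hS.memLp_top_timeDeriv.integrable (by simp)
    have g2 : Integrable (dirDeriv u fun p => softNeg ε (ψ p)) (spaceTime T) :=
      (hu.memLp_dirDeriv hS).integrable (by norm_num)
    have g3 : Integrable (fun p => divergence Du p * softNeg ε (ψ p)) (spaceTime T) :=
      MemLp.integrable (q := 2) (by norm_num) (hS.memLp_top.mul' hu.memLp_divergence)
    have e1 : -∫ x, softNeg ε (ψ (0, x)) = ∫ p, (timeDeriv (fun p => softNeg ε (ψ p)) p +
        dirDeriv u (fun p => softNeg ε (ψ p)) p + divergence Du p * softNeg ε (ψ p))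
          ∂(spaceTime T) := by
      have g12 : Integrable (fun p => timeDeriv (fun p => softNeg ε (ψ p)) p +
        dirDeriv u (fun p => softNeg ε (ψ p)) p) (spaceTime T) := g1.add g2
      rw [integral_add g12 g3, integral_add g1 g2, i1, i2]
      ring
    have e2 : ∫ p, (timeDeriv (fun p => softNeg ε (ψ p)) p +
        dirDeriv u (fun p => softNeg ε (ψ p)) p + divergence Du p * softNeg ε (ψ p))
          ∂(spaceTime T) ≤ ∫ p, (max (f p) 0 + ε * |divergence Du p|) ∂(spaceTime T) := by
      refine integral_mono_ae ((g1.add g2).add g3)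
        (hfi.pos_part.add (hdi.abs.const_mul ε)) ?_
      filter_upwards [hΛ0] with p hp
      simp only [hC.timeDeriv_comp p (hs p), dirDeriv_comp hC p (hs p)]
      have a1 : softNegDeriv ε (ψ p) * f p ≤ max (f p) 0 := by
        have h0 := softNegDeriv_nonneg ε (ψ p)
        have h1 := softNegDeriv_le_one hε (ψ p)
        rcases le_total 0 (f p) with h | h
        · rw [max_eq_left h]; nlinarith
        · rw [max_eq_right h]; nlinarith
      have a2 : Λ p * (softNegDeriv ε (ψ p) * ψ p) ≤ 0 :=
        mul_nonpos_of_nonneg_of_nonpos hp (softNegDeriv_mul_le ε _)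
      -- The divergence term multiplies `s(ψ)` where the chain rule would need `s'(ψ)ψ`; the gap is
      -- at most `ε`.
      have a3 : -(divergence Du p * (softNegDeriv ε (ψ p) * ψ p - softNeg ε (ψ p))) ≤
          ε * |divergence Du p| := by
        refine (neg_le_abs _).trans ?_
        rw [abs_mul, mul_comm]
        exact mul_le_mul_of_nonneg_right (abs_softNegDeriv_mul_sub_le hε _) (abs_nonneg _)
      simp only [hf, transportAdjoint] at a1 ⊢
      nlinarith
    have e3 : -∫ x, ψ (0, x) ≤ -(∫ x, softNeg ε (ψ (0, x))) + ε := by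
      have j1 := integrable_slice hC 0
      have j2 := integrable_slice hS 0
      have : ∫ x : T3, (-ψ (0, x) - ε) ≤ ∫ x, -softNeg ε (ψ (0, x)) :=
        integral_mono (j1.neg.sub (integrable_const _)) j2.neg fun x => neg_le_neg_softNeg ε _
      have j3 : Integrable fun x => -ψ (0, x) := j1.neg
      rw [integral_sub j3 (integrable_const _), integral_neg, integral_neg] at this
      simp at this
      linarith
    rw [integral_add hfi.pos_part (hdi.abs.const_mul ε), integral_const_mul] at e2
    linarith
  set D := 1 + ∫ p, |divergence Du p| ∂(spaceTime T)
  have hD : 0 < D := by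
    have : 0 ≤ ∫ p, |divergence Du p| ∂(spaceTime T) := integral_nonneg fun _ => abs_nonneg _
    positivity
  refine le_of_forall_pos_le_add fun η hη => ?_
  have := main (η / D) (by positivity)
  rwa [div_mul_cancel₀ _ hD.ne'] at this

end

/-- Hahn–Banach: a functional dominated through a linear map factors through a dominated
functional. -/
theorem exists_le_sublinear_comp {V E : Type*} [AddCommGroup V] [Module ℝ V] [AddCommGroup E]
    [Module ℝ E] (A : V →ₗ[ℝ] E) (c : V →ₗ[ℝ] ℝ) (N : E → ℝ)
    (N_hom : ∀ r : ℝ, 0 < r → ∀ x, N (r • x) = r * N x) (N_add : ∀ x y, N (x + y) ≤ N x + N y)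
    (h : ∀ v, c v ≤ N (A v)) :
    ∃ g : E →ₗ[ℝ] ℝ, (∀ v, g (A v) = c v) ∧ ∀ x, g x ≤ N x := by
  have N0 : N 0 = 0 := by
    have := N_hom 2 (by norm_num) 0
    rw [smul_zero] at this; linarith
  -- Domination applied to `v` and `-v` forces `c v = 0` whenever `A v = 0`, so `c` descends to the
  -- range of `A`.
  have hker : LinearMap.ker A ≤ LinearMap.ker c := by
    intro v hv
    rw [LinearMap.mem_ker] at hv ⊢
    have h1 := h v
    have h2 := h (-v)
    rw [map_neg, map_neg, hv, neg_zero, N0] at h2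
    rw [hv, N0] at h1
    linarith
  let l : LinearMap.range A →ₗ[ℝ] ℝ :=
    ((LinearMap.ker A).liftQ c hker).comp A.quotKerEquivRange.symm.toLinearMap
  have hl : ∀ v, l ⟨A v, LinearMap.mem_range_self A v⟩ = c v := by
    intro v
    have : A.quotKerEquivRange.symm ⟨A v, LinearMap.mem_range_self A v⟩ =
        Submodule.Quotient.mk v := by
      rw [LinearEquiv.symm_apply_eq]; rfl
    change (LinearMap.ker A).liftQ c hker (A.quotKerEquivRange.symm _) = _
    rw [this]
    rfl
  obtain ⟨g, hg, hgN⟩ := exists_extension_of_le_sublinear ⟨LinearMap.range A, l⟩ N N_hom N_add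
    (by rintro ⟨_, v, rfl⟩; exact (hl v).le.trans (h v))
  exact ⟨g, fun v => (hg ⟨A v, LinearMap.mem_range_self A v⟩).trans (hl v), hgN⟩

/-- A linear functional on `L²` of a finite measure dominated by `f ↦ ∫ f⁺` is integration
against a function with values in `[0,1]`. -/
theorem exists_unit_density {α : Type*} [MeasurableSpace α] {μ : Measure α} [IsFiniteMeasure μ]
    (g : Lp ℝ 2 μ →ₗ[ℝ] ℝ) (hg : ∀ f : Lp ℝ 2 μ, g f ≤ ∫ a, max (f a) 0 ∂μ) :
    ∃ w : α → ℝ, Measurable w ∧ (∀ a, 0 ≤ w a ∧ w a ≤ 1) ∧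
      ∀ f : Lp ℝ 2 μ, g f = ∫ a, w a * f a ∂μ := by
  have hint : ∀ f : Lp ℝ 2 μ, Integrable f μ := fun f => (Lp.memLp f).integrable (by norm_num)
  -- On a finite measure space the L¹ norm is controlled by the L² norm; hence `g` is bounded and
  -- the Riesz theorem applies.
  have hb1 : ∀ f : Lp ℝ 2 μ, ∫ a, |f a| ∂μ ≤ (μ univ).toReal ^ (1 / 2 : ℝ) * ‖f‖ := by
    intro f
    have h1 : ∫ a, |f a| ∂μ = (eLpNorm f 1 μ).toReal := by
      rw [eLpNorm_one_eq_lintegral_enorm, ← integral_norm_eq_lintegral_enorm (hint f).1]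
      rfl
    have h2 := eLpNorm_le_eLpNorm_mul_rpow_measure_univ (μ := μ) (p := 1) (q := 2) (by norm_num)
      (Lp.aestronglyMeasurable f)
    rw [h1, Lp.norm_def, mul_comm, ENNReal.toReal_rpow, ← ENNReal.toReal_mul]
    refine ENNReal.toReal_mono ?_ (h2.trans (le_of_eq ?_))
    · exact ENNReal.mul_ne_top (Lp.eLpNorm_ne_top f)
        (ENNReal.rpow_ne_top_of_nonneg (by norm_num) (measure_ne_top _ _))
    · norm_num
  have hb : ∀ f : Lp ℝ 2 μ, ‖g f‖ ≤ (μ univ).toReal ^ (1 / 2 : ℝ) * ‖f‖ := by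
    have hle : ∀ f : Lp ℝ 2 μ, g f ≤ (μ univ).toReal ^ (1 / 2 : ℝ) * ‖f‖ := fun f =>
      (hg f).trans ((integral_mono (hint f).pos_part (hint f).abs fun a =>
        max_le (le_abs_self _) (abs_nonneg _)).trans (hb1 f))
    intro f
    rw [Real.norm_eq_abs, abs_le]
    refine ⟨?_, hle f⟩
    have := hle (-f)
    rw [map_neg, norm_neg] at this
    linarith
  let G : Lp ℝ 2 μ →L[ℝ] ℝ := g.mkContinuous _ hb
  let w₀ : Lp ℝ 2 μ := (InnerProductSpace.toDual ℝ (Lp ℝ 2 μ)).symm G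
  have hw : ∀ f : Lp ℝ 2 μ, g f = ∫ a, w₀ a * f a ∂μ := by
    intro f
    have : inner ℝ w₀ f = G f := InnerProductSpace.toDual_symm_apply
    rw [L2.inner_def] at this
    rw [show g f = G f from rfl, ← this]
    refine integral_congr_ae (Filter.Eventually.of_forall fun a => ?_)
    simp [mul_comm]
  -- Indicators with `c = -1` and `c = 1` give the lower bound `0` and the upper bound `1` on the
  -- density.
  have hset : ∀ (c : ℝ) (s : Set α), MeasurableSet s →
      c * ∫ a in s, w₀ a ∂μ ≤ max c 0 * μ.real s := by
    intro c s hs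
    have h1 := hg (indicatorConstLp 2 hs (measure_ne_top μ s) c)
    rw [hw] at h1
    have hc := indicatorConstLp_coeFn (p := 2) (hs := hs) (hμs := measure_ne_top μ s) (c := c)
    have e1 : ∫ a, w₀ a * (indicatorConstLp 2 hs (measure_ne_top μ s) c) a ∂μ =
        c * ∫ a in s, w₀ a ∂μ := by
      rw [← integral_const_mul, ← integral_indicator hs]
      refine integral_congr_ae (hc.mono fun a ha => ?_)
      simp only [ha]
      by_cases h : a ∈ s <;> simp [h, mul_comm]
    have e2 : ∫ a, max ((indicatorConstLp 2 hs (measure_ne_top μ s) c) a) 0 ∂μ =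
        max c 0 * μ.real s := by
      rw [mul_comm, ← smul_eq_mul, ← setIntegral_const, ← integral_indicator hs]
      refine integral_congr_ae (hc.mono fun a ha => ?_)
      simp only [ha]
      by_cases h : a ∈ s <;> simp [h]
    rwa [e1, e2] at h1
  have h0 : ∀ᵐ a ∂μ, 0 ≤ w₀ a := by
    refine ae_nonneg_of_forall_setIntegral_nonneg (hint w₀) fun s hs _ => ?_
    have := hset (-1) s hs
    norm_num at this
    exact this
  have h1 : ∀ᵐ a ∂μ, w₀ a ≤ 1 := by
    refine ae_le_of_forall_setIntegral_le (hint w₀) (integrable_const 1) fun s hs _ => ?_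
    have := hset 1 s hs
    simpa using this
  -- Clamping changes `w₀` only on a null set and makes the bounds hold at every point.
  refine ⟨fun a => max 0 (min 1 (w₀ a)), ?_, fun a => ⟨le_max_left _ _, ?_⟩, fun f => ?_⟩
  · exact measurable_const.max (measurable_const.min (Lp.stronglyMeasurable w₀).measurable)
  · exact max_le zero_le_one (min_le_left _ _)
  · rw [hw]
    refine integral_congr_ae ?_
    filter_upwards [h0, h1] with a ha hb
    rw [min_eq_right hb, max_eq_right ha]

/-- The space of test functions. -/
def testSpace (T : ℝ) : Submodule ℝ (ℝ × T3 → ℝ) where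
  carrier := {ψ | IsTestFun T ψ}
  add_mem' := by
    rintro ψ φ ⟨h1, τ₁, ht₁, h2⟩ ⟨h3, τ₂, ht₂, h4⟩
    refine ⟨h1.add h3, max τ₁ τ₂, max_lt ht₁ ht₂, fun t x ht => ?_⟩
    simp [h2 t x ((le_max_left _ _).trans ht), h4 t x ((le_max_right _ _).trans ht)]
  zero_mem' := ⟨contDiff_const, _, sub_one_lt T, fun _ _ _ => rfl⟩
  smul_mem' := by
    rintro c ψ ⟨h1, τ, ht, h2⟩
    exact ⟨h1.const_smul c, τ, ht, fun t x h => by simp [h2 t x h]⟩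

/-- Here `A` is the adjoint operator on test functions and `c` the initial functional. The weak
equation is exactly the factorisation of `c` through `A` by integration against `w`. -/
theorem exists_weak_solution {T : ℝ} {u : ℝ × T3 → E3} {Du : ℝ × T3 → Mat3} {Λ : ℝ × T3 → ℝ}
    (hT : 0 < T) (hu : IsL2W12 T u Du) (hΛ : MemLp Λ 2 (spaceTime T))
    (hΛ0 : ∀ᵐ p ∂(spaceTime T), 0 ≤ Λ p) :
    ∃ w : ℝ × T3 → ℝ, Measurable w ∧ (∀ p, 0 ≤ w p ∧ w p ≤ 1) ∧
      IsWeakTransportSol T u Du Λ (fun _ => 1) w := by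
  let A : testSpace T →ₗ[ℝ] Lp ℝ 2 (spaceTime T) :=
    { toFun := fun ψ => (memLp_transportAdjoint hu hΛ (IsTestFun.isC1 ψ.2)).toLp _
      map_add' := by
        intro ψ φ
        rw [← MemLp.toLp_add]
        congr 1
        funext p
        have h1 := IsC1.timeDeriv_add (IsTestFun.isC1 ψ.2) (IsTestFun.isC1 φ.2) p
        have h2 := fun j => IsC1.spacePartial_add (IsTestFun.isC1 ψ.2) (IsTestFun.isC1 φ.2) j p
        have e : ((ψ + φ : testSpace T) : ℝ × T3 → ℝ) = fun p => ψ.1 p + φ.1 p := rfl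
        simp only [transportAdjoint, dirDeriv_eq, e, h1, h2, Pi.add_apply, mul_add,
          Finset.sum_add_distrib]
        ring
      map_smul' := by
        intro c ψ
        rw [RingHom.id_apply, ← MemLp.toLp_const_smul]
        congr 1
        funext p
        have h1 := IsC1.timeDeriv_const_mul c (IsTestFun.isC1 ψ.2) p
        have h2 := fun j => IsC1.spacePartial_const_mul c (IsTestFun.isC1 ψ.2) j p
        have e : ((c • ψ : testSpace T) : ℝ × T3 → ℝ) = fun p => c * ψ.1 p := rfl
        have e3 : ∀ j, u p j * (c * spacePartial j ψ.1 p) = c * (u p j * spacePartial j ψ.1 p) :=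
          fun j => by ring
        simp only [transportAdjoint, dirDeriv_eq, e, h1, h2, Pi.smul_apply, smul_eq_mul, e3,
          ← Finset.mul_sum]
        ring }
  let c : testSpace T →ₗ[ℝ] ℝ :=
    { toFun := fun ψ => -∫ x, ψ.1 (0, x)
      map_add' := by
        intro ψ φ
        have := integral_add (integrable_slice (IsTestFun.isC1 ψ.2) 0)
          (integrable_slice (IsTestFun.isC1 φ.2) 0)
        simp only [Submodule.coe_add, Pi.add_apply, this]
        ring
      map_smul' := by
        intro r ψ
        simp [integral_const_mul] }
  have hint : ∀ f : Lp ℝ 2 (spaceTime T), Integrable f (spaceTime T) := fun f =>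
    (Lp.memLp f).integrable (by norm_num)
  obtain ⟨g, hg, hgN⟩ := exists_le_sublinear_comp A c
    (fun f => ∫ p, max (f p) 0 ∂(spaceTime T))
    (by
      intro r hr f
      rw [← integral_const_mul]
      refine integral_congr_ae ((Lp.coeFn_smul r f).mono fun p hp => ?_)
      simp only [hp, Pi.smul_apply, smul_eq_mul]
      rw [mul_max_of_nonneg _ _ hr.le, mul_zero])
    (by
      intro f f'
      rw [← integral_add (hint f).pos_part (hint f').pos_part]
      refine integral_mono_ae (hint (f + f')).pos_part
        ((hint f).pos_part.add (hint f').pos_part) ((Lp.coeFn_add f f').mono fun p hp => ?_)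
      simp only [hp, Pi.add_apply]
      exact max_le (add_le_add (le_max_left _ _) (le_max_left _ _))
        (add_nonneg (le_max_right _ _) (le_max_right _ _)))
    (by
      intro ψ
      refine (neg_integral_initial_le hT hu hΛ hΛ0 ψ.2).trans (le_of_eq ?_)
      refine integral_congr_ae
        ((MemLp.coeFn_toLp (memLp_transportAdjoint hu hΛ (IsTestFun.isC1 ψ.2))).mono fun p hp => ?_)
      simp only [← hp]
      rfl)
  obtain ⟨w, hwm, hw01, hw⟩ := exists_unit_density g hgN
  have hwtop : MemLp w ∞ (spaceTime T) := memLp_top_of_bound hwm.aestronglyMeasurable 1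
    (Filter.Eventually.of_forall fun p => by
      rw [Real.norm_eq_abs, abs_of_nonneg (hw01 p).1]; exact (hw01 p).2)
  refine ⟨w, hwm, hw01, hwtop, MemLp.integrable (q := 2) (by norm_num) (hwtop.mul' hΛ),
    fun ψ hψ => ?_⟩
  have h1 := hg ⟨ψ, hψ⟩
  rw [hw] at h1
  have h2 : c ⟨ψ, hψ⟩ = -∫ x, 1 * ψ (0, x) := by simp [c]
  rw [← h2, ← h1]
  refine integral_congr_ae
    ((MemLp.coeFn_toLp (memLp_transportAdjoint hu hΛ hψ.isC1)).mono fun p hp => ?_)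
  have h3 : (A ⟨ψ, hψ⟩ : ℝ × T3 → ℝ) p = transportAdjoint u Du Λ ψ p := hp
  simp only [h3, transportAdjoint]
  ring


/-! ### Zero extension -/

/-- `F` is a measurable function on `ℝ × 𝕋³` which vanishes off the cylinder and represents `f`. -/
structure IsZeroExt (T : ℝ) (f F : ℝ × T3 → ℝ) : Prop where
  measurable : Measurable F
  eq_zero : ∀ p, p ∉ cyl T → F p = 0
  ae_eq : F =ᵐ[spaceTime T] f

theorem exists_isZeroExt {T : ℝ} {f : ℝ × T3 → ℝ} (hf : AEStronglyMeasurable f (spaceTime T)) :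
    ∃ F, IsZeroExt T f F := by
  refine ⟨(cyl T).indicator (hf.mk f), hf.stronglyMeasurable_mk.measurable.indicator
    (measurableSet_cyl T), fun p hp => indicator_of_notMem hp _, ?_⟩
  filter_upwards [ae_mem_cyl T, hf.ae_eq_mk] with p hp hp'
  rw [indicator_of_mem hp, hp']

namespace IsZeroExt

variable {T : ℝ} {f F : ℝ × T3 → ℝ}

theorem indicator_eq (h : IsZeroExt T f F) : (cyl T).indicator F = F :=
  indicator_eq_self.2 fun p hp => by_contra fun hc => hp (h.eq_zero p hc)

theorem memLp (h : IsZeroExt T f F) {r : ℝ≥0∞} (hf : MemLp f r (spaceTime T)) : MemLp F r := by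
  rw [← h.indicator_eq, memLp_indicator_iff_restrict (measurableSet_cyl T), ← spaceTime_eq]
  exact hf.ae_eq h.ae_eq.symm

theorem integrable (h : IsZeroExt T f F) (hf : Integrable f (spaceTime T)) : Integrable F :=
  memLp_one_iff_integrable.1 (h.memLp (memLp_one_iff_integrable.2 hf))

theorem integral_mul (h : IsZeroExt T f F) (φ : ℝ × T3 → ℝ) :
    ∫ p, F p * φ p = ∫ p, f p * φ p ∂(spaceTime T) := by
  have h1 : (fun p => F p * φ p) = (cyl T).indicator fun p => F p * φ p := by
    refine (indicator_eq_self.2 fun p hp => by_contra fun hc => hp ?_).symm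
    simp [h.eq_zero p hc]
  rw [h1, integral_indicator (measurableSet_cyl T), ← spaceTime_eq]
  exact integral_congr_ae (h.ae_eq.mono fun p hp => by simp only [hp])

theorem lintegral_enorm_sq (h : IsZeroExt T f F) :
    ∫⁻ p, ‖F p‖ₑ ^ 2 = eLpNorm f 2 (spaceTime T) ^ 2 := by
  rw [lintegral_enorm_sq_eq, ← h.indicator_eq,
    eLpNorm_indicator_eq_eLpNorm_restrict (measurableSet_cyl T), ← spaceTime_eq,
    eLpNorm_congr_ae h.ae_eq]

end IsZeroExt

/-! ### Translation estimates for weakly differentiable functions -/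

/-- `g` is the weak derivative `∂_j F` on `ℝ × 𝕋³`. -/
structure HasWeakDeriv (j : Fin 3) (F g : ℝ × T3 → ℝ) : Prop where
  measurable : Measurable F
  measurable_deriv : Measurable g
  memLp : MemLp F 2
  integrable : Integrable F
  integrable_deriv : Integrable g
  weak_eq : ∀ φ, IsC1 φ → ∫ p, F p * spacePartial j φ p = -∫ p, g p * φ p

/-- The translation by `s` in the direction `e_j`. -/
noncomputable def dirShift (j : Fin 3) (s : ℝ) : ℝ × T3 := (0, toT3 (EuclideanSpace.single j s))

theorem dirShift_add (j : Fin 3) (a b : ℝ) : dirShift j (a + b) = dirShift j a + dirShift j b := by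
  simp only [dirShift, Prod.mk_add_mk, add_zero, ← toT3_add]
  rw [single_eq_smul j (a + b), single_eq_smul j a, single_eq_smul j b, add_smul]

theorem continuous_dirShift (j : Fin 3) : Continuous (dirShift j) := by
  refine continuous_const.prodMk (continuous_toT3.comp ?_)
  rw [show (EuclideanSpace.single j : ℝ → E3) = fun s => s • unitVec j from
    funext (single_eq_smul j)]
  fun_prop

theorem IsC1.hasDerivAt_dirShift {ψ : ℝ × T3 → ℝ} (h : IsC1 ψ) (j : Fin 3) (p : ℝ × T3) (s : ℝ) :
    HasDerivAt (fun s => ψ (p + dirShift j s)) (spacePartial j ψ (p + dirShift j s)) s := by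
  have h1 := h.hasDerivAt_space j (p + dirShift j s)
  have h2 : HasDerivAt (fun r => ψ (p + dirShift j s + dirShift j r))
      (spacePartial j ψ (p + dirShift j s)) (s - s) := by
    rw [sub_self]
    refine h1.congr_of_eventuallyEq (Filter.Eventually.of_forall fun r => ?_)
    simp only [dirShift]
    congr 1
    ext1 <;> simp
  have h3 := h2.comp_sub_const s s
  refine h3.congr_of_eventuallyEq (Filter.Eventually.of_forall fun r => ?_)
  simp only
  rw [add_assoc, ← dirShift_add]
  simp

/-- Test the weak identity with `q ↦ κ (p - q)`; the sign from reflecting the kernel cancels the one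
from integration by parts. -/
theorem HasWeakDeriv.spacePartial_moll {j : Fin 3} {F g κ : ℝ × T3 → ℝ} (h : HasWeakDeriv j F g)
    {A τ δ : ℝ} (hκ : IsMollifier A τ δ κ) (p : ℝ × T3) :
    spacePartial j (moll κ F) p = moll κ g p := by
  rw [_root_.spacePartial_moll h.integrable hκ.isC1 hκ.support_Icc, moll]
  have h1 := h.weak_eq _ (hκ.isC1.reflect p)
  simp_rw [hκ.isC1.spacePartial_reflect j p, mul_neg, integral_neg, neg_inj] at h1
  exact h1

/-- Write the difference as the integral of `g` along the segment and apply Minkowski, together with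
translation invariance. -/
theorem shiftDist_dirShift_le_of_isC1 {j : Fin 3} {f g : ℝ × T3 → ℝ} (hf : IsC1 f)
    (hg : Continuous g) (hfg : ∀ p, spacePartial j f p = g p) (s : ℝ) :
    shiftDist f (dirShift j s) ≤ ENNReal.ofReal |s| ^ 2 * ∫⁻ p, ‖g p‖ₑ ^ 2 := by
  -- The factor `1` is the weight in the weighted form of Minkowski's inequality.
  have h1 : ∀ p, ‖f (p + dirShift j s) - f p‖ₑ ≤
      ∫⁻ r in uIoc 0 s, 1 * ‖g (p + dirShift j r)‖ₑ := by
    intro p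
    have hc : Continuous fun r => g (p + dirShift j r) :=
      hg.comp (continuous_const.add (continuous_dirShift j))
    have h0 : dirShift j 0 = 0 := by simp [dirShift, toT3_single_zero]
    have h2 := intervalIntegral.integral_eq_sub_of_hasDerivAt (a := 0) (b := s)
      (fun r _ => hf.hasDerivAt_dirShift j p r)
      (by simp_rw [hfg]; exact hc.intervalIntegrable _ _)
    rw [h0, add_zero] at h2
    rw [← h2]
    simp_rw [hfg, one_mul]
    rw [← ofReal_norm, intervalIntegral.norm_intervalIntegral_eq, ofReal_norm]
    exact enorm_integral_le_lintegral_enorm _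
  have h2 : shiftDist f (dirShift j s) = ∫⁻ p, ‖f (p + dirShift j s) - f p‖ₑ ^ 2 := by
    rw [shiftDist, ← lintegral_add_right_eq_self _ (dirShift j s)]
    refine lintegral_congr fun p => ?_
    rw [add_sub_cancel_right, enorm_sub_rev]
  have hν : (volume.restrict (uIoc 0 s)) univ = ENNReal.ofReal |s| := by
    rw [Measure.restrict_apply_univ, Real.volume_uIoc, sub_zero]
  rw [h2]
  calc _ ≤ ∫⁻ p, (∫⁻ r in uIoc 0 s, 1 * ‖g (p + dirShift j r)‖ₑ) ^ 2 :=
        lintegral_mono fun p => pow_le_pow_left' (h1 p) 2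
    _ ≤ (∫⁻ _ in uIoc 0 s, 1) * ∫⁻ r in uIoc 0 s, 1 * ∫⁻ p, ‖g (p + dirShift j r)‖ₑ ^ 2 :=
        lintegral_sq_lintegral_mul_le (H := fun p r => ‖g (p + dirShift j r)‖ₑ) measurable_const
          ((hg.comp (continuous_fst.add ((continuous_dirShift j).comp
            continuous_snd))).measurable.enorm)
    _ = _ := by
        simp_rw [lintegral_add_right_eq_self (fun p => ‖g p‖ₑ ^ 2)]
        rw [lintegral_const, lintegral_const, hν]
        ring

/-- The threshold `η` serves all kernels with small enough support, so further smallness conditions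
on `τ` and `δ` may be imposed afterwards. -/
theorem exists_mollifier_near {F : ℝ × T3 → ℝ} (hF : Integrable F) (hF2 : MemLp F 2)
    (hm : Measurable F) {ε : ℝ≥0∞} (hε : 0 < ε) :
    ∃ η > 0, ∀ τ δ κ A, τ ≤ η → δ ≤ η → IsMollifier A τ δ κ →
      ∫⁻ p, ‖moll κ F p - F p‖ₑ ^ 2 ≤ ε := by
  have h1 := (tendsto_shiftDist hF2).eventually (gt_mem_nhds hε)
  obtain ⟨η, hη, hball⟩ := Metric.eventually_nhds_iff.1 h1
  refine ⟨η / 2, by positivity, fun τ δ κ A hτ hδ hκ => ?_⟩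
  refine hκ.lintegral_moll_sub_le hF hm fun z hz1 hz2 => (hball ?_).le
  rw [dist_zero_right, Prod.norm_def, max_lt_iff, Real.norm_eq_abs, abs_of_pos hz1.1]
  constructor
  · linarith [hz1.2]
  · linarith

/-- The `C¹` estimate applied to a mollification, whose derivative `moll κ g` has no larger L² norm
than `g`. Replacing the mollification by `F` at `p` and at `p - z` costs `ε/2` each. -/
theorem HasWeakDeriv.shiftDist_le {j : Fin 3} {F g : ℝ × T3 → ℝ} (h : HasWeakDeriv j F g) (s : ℝ) :
    shiftDist F (dirShift j s) ≤ ENNReal.ofReal |s| ^ 2 * ∫⁻ p, ‖g p‖ₑ ^ 2 := by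
  set z := dirShift j s with hz
  set R := ENNReal.ofReal |s| * eLpNorm g 2 volume with hR
  have hshift : ∀ f : ℝ × T3 → ℝ, shiftDist f z = eLpNorm (fun p => f (p - z) - f p) 2 volume ^ 2 :=
    fun f => lintegral_enorm_sq_eq _
  rw [lintegral_enorm_sq_eq, ← mul_pow, hshift]
  refine pow_le_pow_left' ?_ 2
  refine ENNReal.le_of_forall_pos_le_add fun ε hε _ => ?_
  have hε' : (0 : ℝ≥0∞) < (ε / 2 : ℝ≥0) ^ 2 := by positivity
  obtain ⟨η, hη, hmoll⟩ := exists_mollifier_near h.integrable h.memLp h.measurable hε'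
  obtain ⟨κ, hκ⟩ := exists_isMollifier hη (lt_min hη one_pos) (min_le_right η 1)
  have hd := hmoll _ _ _ _ le_rfl (min_le_left _ _) hκ
  set f := moll κ F with hf
  have hfC : IsC1 f := isC1_moll h.integrable hκ.isC1 hκ.support_Icc
  have hgc : Continuous (moll κ g) :=
    (isC1_moll h.integrable_deriv hκ.isC1 hκ.support_Icc).continuous
  have h1 : eLpNorm (fun p => f p - F p) 2 volume ≤ (ε / 2 : ℝ≥0) := by
    rw [lintegral_enorm_sq_eq] at hd
    exact (ENNReal.pow_le_pow_left_iff two_ne_zero).1 hd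
  have h2 : eLpNorm (fun p => f (p - z) - f p) 2 volume ≤ R := by
    have := (shiftDist_dirShift_le_of_isC1 hfC hgc (h.spacePartial_moll hκ) s).trans
      (mul_le_mul_right (hκ.lintegral_moll_le h.measurable_deriv) _)
    rw [lintegral_enorm_sq_eq, ← mul_pow, hshift] at this
    exact (ENNReal.pow_le_pow_left_iff two_ne_zero).1 this
  have hmeas : AEStronglyMeasurable (fun p => f p - F p) volume :=
    (hfC.continuous.measurable.sub h.measurable).aestronglyMeasurable
  have h3 : eLpNorm (fun p => f (p - z) - F (p - z)) 2 volume ≤ (ε / 2 : ℝ≥0) := by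
    have := eLpNorm_comp_measurePreserving (p := 2) hmeas (measurePreserving_sub_right volume z)
    simp only [Function.comp_def] at this
    rwa [this]
  have e : (fun p => F (p - z) - F p) = ((fun p => f (p - z) - f p) -
      fun p => f (p - z) - F (p - z)) + fun p => f p - F p := by
    funext p; simp
  have m1 : AEStronglyMeasurable (fun p => f (p - z) - f p) volume :=
    ((hfC.continuous.measurable.comp (measurable_sub_const z)).sub
      hfC.continuous.measurable).aestronglyMeasurable
  have m2 : AEStronglyMeasurable (fun p => f (p - z) - F (p - z)) volume :=
    ((hfC.continuous.measurable.comp (measurable_sub_const z)).sub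
      (h.measurable.comp (measurable_sub_const z))).aestronglyMeasurable
  rw [e]
  calc _ ≤ (R + (ε / 2 : ℝ≥0)) + (ε / 2 : ℝ≥0) :=
        (eLpNorm_add_le (m1.sub m2) hmeas one_le_two).trans
          (add_le_add ((eLpNorm_sub_le m1 m2 one_le_two).trans (add_le_add h2 h3)) h1)
    _ = R + ε := by
        rw [add_assoc, ← ENNReal.coe_add, add_halves]

theorem exists_toT3_eq (y : T3) : ∃ z : E3, toT3 z = y ∧ ∀ j, |z j| ≤ ‖y‖ := by
  obtain ⟨z, rfl⟩ := toT3_surjective y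
  refine ⟨WithLp.toLp 2 fun j => z j - round (z j), ?_, fun j => ?_⟩
  · funext j
    simp only [toT3]
    rw [AddCircle.coe_sub, sub_eq_self]
    simp
  · refine le_trans (le_of_eq ?_) (norm_le_pi_norm (toT3 z) j)
    exact UnitAddCircle.norm_eq.symm

/-- Move along the three axes in turn; two uses of `shiftDist_add_le` account for the factor `4`. -/
theorem shiftDist_space_le {F : ℝ × T3 → ℝ} {g : Fin 3 → ℝ × T3 → ℝ}
    (h : ∀ j, HasWeakDeriv j F (g j)) (y : T3) {δ : ℝ} (hy : ‖y‖ ≤ δ) :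
    shiftDist F (0, y) ≤ ENNReal.ofReal δ ^ 2 * (4 * ∑ j, ∫⁻ p, ‖g j p‖ₑ ^ 2) := by
  obtain ⟨z, rfl, hz⟩ := exists_toT3_eq y
  have hm := (h 0).measurable
  have e : ((0, toT3 z) : ℝ × T3) =
      dirShift 0 (z 0) + (dirShift 1 (z 1) + dirShift 2 (z 2)) := by
    have : z = EuclideanSpace.single 0 (z 0) + (EuclideanSpace.single 1 (z 1) +
        EuclideanSpace.single 2 (z 2)) := by
      ext i; fin_cases i <;> simp
    simp only [dirShift]
    rw [Prod.mk_add_mk, Prod.mk_add_mk, ← toT3_add, ← toT3_add, ← this]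
    simp
  have hj : ∀ j, shiftDist F (dirShift j (z j)) ≤ ENNReal.ofReal δ ^ 2 * ∫⁻ p, ‖g j p‖ₑ ^ 2 :=
    fun j => ((h j).shiftDist_le (z j)).trans (mul_le_mul_left
      (pow_le_pow_left' (ENNReal.ofReal_le_ofReal ((hz j).trans hy)) 2) _)
  rw [e, Fin.sum_univ_three]
  calc _ ≤ 2 * shiftDist F (dirShift 0 (z 0)) + 2 * (2 * shiftDist F (dirShift 1 (z 1)) +
        2 * shiftDist F (dirShift 2 (z 2))) :=
        (shiftDist_add_le hm _ _).trans (by gcongr; exact shiftDist_add_le hm _ _)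
    _ ≤ 4 * shiftDist F (dirShift 0 (z 0)) + 2 * (2 * shiftDist F (dirShift 1 (z 1)) +
        2 * shiftDist F (dirShift 2 (z 2))) := by gcongr; norm_num
    _ = 4 * (shiftDist F (dirShift 0 (z 0)) + shiftDist F (dirShift 1 (z 1)) +
        shiftDist F (dirShift 2 (z 2))) := by ring
    _ ≤ 4 * (ENNReal.ofReal δ ^ 2 * (∫⁻ p, ‖g 0 p‖ₑ ^ 2) + ENNReal.ofReal δ ^ 2 *
        (∫⁻ p, ‖g 1 p‖ₑ ^ 2) + ENNReal.ofReal δ ^ 2 * ∫⁻ p, ‖g 2 p‖ₑ ^ 2) := by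
        gcongr <;> exact hj _
    _ = _ := by ring


/-! ### The commutator estimate -/

/-- The gain `δ` from the shift of `U` cancels the mass `A/δ` of the kernel's derivative. The
outcome is a bound independent of `δ`; smallness is neither claimed nor needed. -/
theorem lintegral_commutator_le {A τ δ : ℝ} {κ v U : ℝ × T3 → ℝ} {K : ℝ≥0∞} (hδ : 0 < δ)
    (hA : 0 ≤ A)
    (hκ : IsMollifier A τ δ κ) (hU : Measurable U) (hv : ∀ p, |v p| ≤ 1) (i : Fin 3)
    (hK : ∀ z : ℝ × T3, z.1 ∈ Icc 0 τ → ‖z.2‖ ≤ δ → shiftDist U z ≤ ENNReal.ofReal δ ^ 2 * K) :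
    ∫⁻ p, ‖∫ q, v q * ((U p - U q) * spacePartial i κ (p - q))‖ₑ ^ 2 ≤ ENNReal.ofReal A ^ 2 * K := by
  have hm : Measurable fun z => ‖spacePartial i κ z‖ₑ :=
    (hκ.isC1.continuous_spacePartial i).measurable.enorm
  calc _ ≤ ∫⁻ p, (∫⁻ z, ‖spacePartial i κ z‖ₑ * ‖U (p - z) - U p‖ₑ) ^ 2 := by
        refine lintegral_mono fun p => pow_le_pow_left' ?_ 2
        rw [← integral_sub_left_eq_self _ volume p]
        refine (enorm_integral_le_lintegral_enorm _).trans (lintegral_mono fun z => ?_)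
        have h1 : ‖v (p - z)‖ₑ ≤ 1 := by
          rw [Real.enorm_eq_ofReal_abs]
          exact ENNReal.ofReal_le_one.2 (hv _)
        rw [enorm_mul, enorm_mul, sub_sub_cancel, enorm_sub_rev, mul_comm ‖U _ - U p‖ₑ]
        exact mul_le_of_le_one_left (zero_le) h1
    _ ≤ (∫⁻ z, ‖spacePartial i κ z‖ₑ) * ∫⁻ z, ‖spacePartial i κ z‖ₑ * shiftDist U z :=
        lintegral_sq_lintegral_mul_le (H := fun p z => ‖U (p - z) - U p‖ₑ) hm (by fun_prop)
    _ ≤ (∫⁻ z, ‖spacePartial i κ z‖ₑ) *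
          ∫⁻ z, ‖spacePartial i κ z‖ₑ * (ENNReal.ofReal δ ^ 2 * K) := by
        refine mul_le_mul_right (lintegral_mono fun z => ?_) _
        by_cases hz : spacePartial i κ z = 0
        · simp [hz]
        · have := hκ.spacePartial_support hz
          exact mul_le_mul_right (hK z this.1 this.2) _
    _ = (∫⁻ z, ‖spacePartial i κ z‖ₑ) ^ 2 * ENNReal.ofReal δ ^ 2 * K := by
        rw [lintegral_mul_const _ hm]; ring
    _ ≤ ENNReal.ofReal (A / δ) ^ 2 * ENNReal.ofReal δ ^ 2 * K := by
        gcongr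
        exact hκ.mass_partial i
    _ = ENNReal.ofReal A ^ 2 * K := by
        rw [← mul_pow, ← ENNReal.ofReal_mul (by positivity), div_mul_cancel₀ _ hδ.ne']

/-- There is no rate for shifts in time, only L² continuity. Hence the time scale is selected after
`δ`, so short that a time shift costs at most `δ²`. The constant is `2·1 + 2·4∑`. -/
theorem exists_time_scale {F : ℝ × T3 → ℝ} {g : Fin 3 → ℝ × T3 → ℝ}
    (h : ∀ j, HasWeakDeriv j F (g j)) {δ : ℝ} (hδ : 0 < δ) :
    ∃ η > 0, ∀ z : ℝ × T3, z.1 ∈ Icc 0 η → ‖z.2‖ ≤ δ →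
      shiftDist F z ≤ ENNReal.ofReal δ ^ 2 * (2 + 8 * ∑ j, ∫⁻ p, ‖g j p‖ₑ ^ 2) := by
  have hε : (0 : ℝ≥0∞) < ENNReal.ofReal δ ^ 2 := by positivity
  have h1 := (tendsto_shiftDist (h 0).memLp).eventually (gt_mem_nhds hε)
  obtain ⟨η, hη, hball⟩ := Metric.eventually_nhds_iff.1 h1
  refine ⟨η / 2, by positivity, fun z hz1 hz2 => ?_⟩
  have e : z = (z.1, (0 : T3)) + ((0 : ℝ), z.2) := by simp
  have h2 : shiftDist F (z.1, (0 : T3)) ≤ ENNReal.ofReal δ ^ 2 := by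
    refine (hball ?_).le
    rw [dist_zero_right, Prod.norm_def, norm_zero, max_lt_iff, Real.norm_eq_abs,
      abs_of_nonneg hz1.1]
    exact ⟨by linarith [hz1.2], hη⟩
  rw [e]
  calc _ ≤ 2 * shiftDist F (z.1, (0 : T3)) + 2 * shiftDist F ((0 : ℝ), z.2) :=
        shiftDist_add_le (h 0).measurable _ _
    _ ≤ 2 * ENNReal.ofReal δ ^ 2 +
        2 * (ENNReal.ofReal δ ^ 2 * (4 * ∑ j, ∫⁻ p, ‖g j p‖ₑ ^ 2)) := by
        gcongr
        exact shiftDist_space_le h _ hz2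
    _ = _ := by ring

/-! ### Mollifying the transport equation for `1 - w`. -/

theorem eLpNorm_spaceTime_le (T : ℝ) (f : ℝ × T3 → ℝ) (r : ℝ≥0∞) :
    eLpNorm f r (spaceTime T) ≤ eLpNorm f r volume := by
  rw [spaceTime_eq]
  exact eLpNorm_mono_measure f Measure.restrict_le_self

/-- The transport operator `∂_t V + u·∇V`. -/
noncomputable def materialDeriv (u : ℝ × T3 → E3) (V : ℝ × T3 → ℝ) (p : ℝ × T3) : ℝ :=
  timeDeriv V p + dirDeriv u V p

theorem IsZeroExt.mul {T : ℝ} {f F g G : ℝ × T3 → ℝ} (h : IsZeroExt T f F) (h' : IsZeroExt T g G) :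
    IsZeroExt T (fun p => f p * g p) (fun p => F p * G p) where
  measurable := h.measurable.mul h'.measurable
  eq_zero p hp := by simp [h.eq_zero p hp]
  ae_eq := h.ae_eq.mul h'.ae_eq

section

variable {T : ℝ} {u : ℝ × T3 → E3} {Du : ℝ × T3 → Mat3} {Λ w : ℝ × T3 → ℝ}

/-- The constant `1` solves the undamped transport equation, so subtracting leaves an equation for
`1 - w` with source `Λw` and no initial term. -/
theorem IsWeakTransportSol.weak_eq_compl (hT : 0 < T) (hu : IsL2W12 T u Du)
    (hw : IsWeakTransportSol T u Du Λ (fun _ => 1) w)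
    {ψ : ℝ × T3 → ℝ} (hψ : IsTestFun T ψ) :
    ∫ p, ((1 - w p) * (timeDeriv ψ p + dirDeriv u ψ p + divergence Du p * ψ p) +
      Λ p * w p * ψ p) ∂(spaceTime T) = 0 := by
  have hC := hψ.isC1
  have g1 : Integrable (timeDeriv ψ) (spaceTime T) := hC.memLp_top_timeDeriv.integrable (by simp)
  have g2 : Integrable (dirDeriv u ψ) (spaceTime T) := (hu.memLp_dirDeriv hC).integrable (by norm_num)
  have g3 : Integrable (fun p => divergence Du p * ψ p) (spaceTime T) :=
    MemLp.integrable (q := 2) (by norm_num) (hC.memLp_top.mul' hu.memLp_divergence)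
  have g12 : Integrable (fun p => timeDeriv ψ p + dirDeriv u ψ p) (spaceTime T) := g1.add g2
  have g123 : Integrable (fun p => timeDeriv ψ p + dirDeriv u ψ p + divergence Du p * ψ p)
    (spaceTime T) := g12.add g3
  have g4 : Integrable (fun p => w p * (timeDeriv ψ p + dirDeriv u ψ p + divergence Du p * ψ p) -
      Λ p * w p * ψ p) (spaceTime T) := by
    refine Integrable.sub ?_ ?_
    · exact g123.mul_of_top_right hw.memLp
    · exact hw.integrable_damping.mul_of_top_left hC.memLp_top
  have e : ∀ p, (1 - w p) * (timeDeriv ψ p + dirDeriv u ψ p + divergence Du p * ψ p) +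
      Λ p * w p * ψ p = (timeDeriv ψ p + dirDeriv u ψ p + divergence Du p * ψ p) -
      (w p * (timeDeriv ψ p + dirDeriv u ψ p + divergence Du p * ψ p) - Λ p * w p * ψ p) :=
    fun p => by ring
  simp_rw [e]
  rw [integral_sub g123 g4, hw.weak_eq ψ hψ, integral_add g12 g3, integral_add g1 g2,
    hC.integral_timeDeriv hT hψ.eq_zero_end, hu.integral_dirDeriv hC]
  simp

/-- Translates of a mollifier are test functions. -/
theorem IsMollifier.isTestFun_reflect {A τ δ : ℝ} {κ : ℝ × T3 → ℝ} (hκ : IsMollifier A τ δ κ)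
    {p : ℝ × T3} (hp : p.1 < T) : IsTestFun T fun q => κ (p - q) := by
  refine ⟨hκ.isC1.reflect p, p.1, hp, fun t x ht => ?_⟩
  by_contra hne
  have := (hκ.support_time _ hne).1
  simp only [Prod.fst_sub] at this
  linarith

/-- Testing the equation of `1 - w` with `κ (p - ·)` expresses `∂_t (moll κ V)` through `∫ V(q)
u(q)·∇κ(p - q)`. Adding `u(p)·∇(moll κ V)` produces the difference `U(p) - U(q)`. The pointwise
condition on `U` is needed because `u` is evaluated at the single point `p`. -/
theorem materialDeriv_moll (hT : 0 < T) (hu : IsL2W12 T u Du)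
    (hw : IsWeakTransportSol T u Du Λ (fun _ => 1) w)
    {V : ℝ × T3 → ℝ} (hV : IsZeroExt T (fun p => 1 - w p) V) {U : Fin 3 → ℝ × T3 → ℝ}
    (hU : ∀ i, IsZeroExt T (fun p => u p i) (U i)) {E : ℝ × T3 → ℝ}
    (hE : IsZeroExt T (fun p => (1 - w p) * divergence Du p + Λ p * w p) E)
    {A τ δ : ℝ} {κ : ℝ × T3 → ℝ} (hκ : IsMollifier A τ δ κ) {p : ℝ × T3} (hp : p ∈ cyl T)
    (hUp : ∀ i, U i p = u p i) :
    materialDeriv u (moll κ V) p =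
      (∑ i, ∫ q, V q * ((U i p - U i q) * spacePartial i κ (p - q))) + moll κ E p := by
  have hC := hκ.isC1
  have hv : MemLp (fun p => 1 - w p) ∞ (spaceTime T) := (memLp_top_const 1).sub hw.memLp
  have hVi : Integrable V := hV.integrable (hv.integrable (by simp))
  have hψ := hκ.isTestFun_reflect (T := T) (p := p) (mem_cyl.1 hp).2
  have hψC := hψ.isC1
  have hVU : ∀ i, IsZeroExt T (fun q => (1 - w q) * u q i) (fun q => V q * U i q) :=
    fun i => hV.mul (hU i)
  have hvu : ∀ i, Integrable (fun q => (1 - w q) * u q i) (spaceTime T) := fun i =>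
    ((hu.memLp_comp i).integrable (by norm_num)).mul_of_top_right hv
  obtain ⟨B, hB0, hB⟩ := hC.exists_bound hκ.support_Icc
  have hb : ∀ i, ∀ q, |spacePartial i κ q| ≤ B := fun i q => (hB q).2.2.2 i
  have c1 : ∀ i, ∫ q, V q * ((U i p - U i q) * spacePartial i κ (p - q)) =
      u p i * spacePartial i (moll κ V) p -
        ∫ q, (1 - w q) * u q i * spacePartial i κ (p - q) ∂(spaceTime T) := by
    intro i
    have i1 := integrable_mul_kernel hVi (hC.continuous_spacePartial i) (hb i) p
    have i2 := integrable_mul_kernel ((hVU i).integrable (hvu i))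
      (hC.continuous_spacePartial i) (hb i) p
    rw [spacePartial_moll hVi hC hκ.support_Icc, ← (hVU i).integral_mul, ← hUp i,
      ← integral_const_mul, ← integral_sub (i1.const_mul _) i2]
    refine integral_congr_ae (Filter.Eventually.of_forall fun q => ?_)
    ring
  have hdi : Integrable (divergence Du) (spaceTime T) := hu.memLp_divergence.integrable (by norm_num)
  have hEi : Integrable (fun q => (1 - w q) * divergence Du q + Λ q * w q) (spaceTime T) :=
    (hdi.mul_of_top_right hv).add hw.integrable_damping
  have c2 := hw.weak_eq_compl hT hu hψ
  simp_rw [dirDeriv_eq, hC.timeDeriv_reflect p, hC.spacePartial_reflect _ p] at c2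
  have e : ∀ q, (1 - w q) * (-timeDeriv κ (p - q) + ∑ j, u q j * -spacePartial j κ (p - q) +
      divergence Du q * κ (p - q)) + Λ q * w q * κ (p - q) =
      ((1 - w q) * divergence Du q + Λ q * w q) * κ (p - q) -
        ((1 - w q) * timeDeriv κ (p - q) +
          ∑ j, (1 - w q) * u q j * spacePartial j κ (p - q)) := by
    intro q
    simp only [Fin.sum_univ_three]
    ring
  simp_rw [e] at c2
  have j1 : Integrable (fun q => ((1 - w q) * divergence Du q + Λ q * w q) * κ (p - q))
      (spaceTime T) := hEi.mul_of_top_left hψC.memLp_top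
  have j2 : Integrable (fun q => (1 - w q) * timeDeriv κ (p - q)) (spaceTime T) := by
    refine (hv.integrable (by simp)).mul_bdd (c := B) ?_ (Filter.Eventually.of_forall fun q =>
      (hB _).2.2.1)
    exact (hC.continuous_timeDeriv.comp (continuous_const.sub continuous_id)).aestronglyMeasurable
  have j3 : ∀ j, Integrable (fun q => (1 - w q) * u q j * spacePartial j κ (p - q))
      (spaceTime T) := fun j => by
    refine (hvu j).mul_bdd (c := B) ?_ (Filter.Eventually.of_forall fun q => hb j _)
    exact ((hC.continuous_spacePartial j).comp
      (continuous_const.sub continuous_id)).aestronglyMeasurable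
  have j4 : Integrable (fun q => ∑ j, (1 - w q) * u q j * spacePartial j κ (p - q))
      (spaceTime T) := integrable_finsetSum _ fun j _ => j3 j
  have j5 : Integrable (fun q => (1 - w q) * timeDeriv κ (p - q) +
      ∑ j, (1 - w q) * u q j * spacePartial j κ (p - q)) (spaceTime T) := j2.add j4
  rw [integral_sub j1 j5, integral_add j2 j4,
    integral_finsetSum _ fun j _ => j3 j, sub_eq_zero] at c2
  rw [materialDeriv, timeDeriv_moll hVi hC hκ.support_Icc, hV.integral_mul, moll, hE.integral_mul,
    c2, dirDeriv_eq]
  simp_rw [c1, Finset.sum_sub_distrib]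
  ring

theorem IsL2W12.hasWeakDeriv (hu : IsL2W12 T u Du) {i j : Fin 3} {U g : ℝ × T3 → ℝ}
    (hU : IsZeroExt T (fun p => u p i) U) (hg : IsZeroExt T (fun p => Du p (i, j)) g) :
    HasWeakDeriv j U g where
  measurable := hU.measurable
  measurable_deriv := hg.measurable
  memLp := hU.memLp (hu.memLp_comp i)
  integrable := hU.integrable ((hu.memLp_comp i).integrable (by norm_num))
  integrable_deriv := hg.integrable ((hu.memLp_grad_comp (i, j)).integrable (by norm_num))
  weak_eq φ hφ := by rw [hU.integral_mul, hg.integral_mul, hu.integral_mul_spacePartial i j hφ]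

/-- `1 - w` is approximated by `C¹` functions whose material derivatives are bounded in `L²`. -/
theorem exists_approximation (hT : 0 < T) (hu : IsL2W12 T u Du) (hΛ : MemLp Λ 2 (spaceTime T))
    (hwm : Measurable w) (hw01 : ∀ p, 0 ≤ w p ∧ w p ≤ 1)
    (hw : IsWeakTransportSol T u Du Λ (fun _ => 1) w) :
    ∃ V : ℕ → ℝ × T3 → ℝ, ∃ B : ℝ≥0, (∀ n, IsC1 (V n)) ∧ (∀ n p, 0 ≤ V n p ∧ V n p ≤ 1) ∧
      (∀ n x, V n (0, x) = 0) ∧ (∀ n, eLpNorm (materialDeriv u (V n)) 2 (spaceTime T) ≤ B) ∧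
      ∀ᵐ p ∂(spaceTime T), Filter.Tendsto (fun n => V n p) Filter.atTop (nhds (1 - w p)) := by
  set V₀ : ℝ × T3 → ℝ := (cyl T).indicator fun p => 1 - w p with hV₀
  have hV : IsZeroExt T (fun p => 1 - w p) V₀ :=
    ⟨(measurable_const.sub hwm).indicator (measurableSet_cyl T),
      fun p hp => indicator_of_notMem hp _,
      (ae_mem_cyl T).mono fun p hp => indicator_of_mem hp _⟩
  have hV01 : ∀ p, 0 ≤ V₀ p ∧ V₀ p ≤ 1 := by
    intro p
    by_cases hp : p ∈ cyl T
    · rw [hV₀, indicator_of_mem hp]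
      constructor <;> linarith [hw01 p]
    · rw [hV₀, indicator_of_notMem hp]
      simp
  have hVabs : ∀ p, |V₀ p| ≤ 1 := fun p => by
    rw [abs_of_nonneg (hV01 p).1]; exact (hV01 p).2
  have hv : MemLp (fun p => 1 - w p) ∞ (spaceTime T) := (memLp_top_const 1).sub hw.memLp
  have hVi : Integrable V₀ := hV.integrable (hv.integrable (by simp))
  have hV2 : MemLp V₀ 2 := hV.memLp (hv.mono_exponent le_top)
  have hEL : MemLp (fun p => (1 - w p) * divergence Du p + Λ p * w p) 2 (spaceTime T) :=
    (hu.memLp_divergence.mul' hv).add (hw.memLp.mul' hΛ)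
  obtain ⟨E, hE⟩ := exists_isZeroExt hEL.aestronglyMeasurable
  choose U hU using fun i => exists_isZeroExt (hu.memLp_comp i).aestronglyMeasurable
  choose g hg using fun i j => exists_isZeroExt (hu.memLp_grad_comp (i, j)).aestronglyMeasurable
  have hwd : ∀ i j, HasWeakDeriv j (U i) (g i j) := fun i j => hu.hasWeakDeriv (hU i) (hg i j)
  set K : Fin 3 → ℝ≥0∞ := fun i => 2 + 8 * ∑ j, ∫⁻ p, ‖g i j p‖ₑ ^ 2 with hK
  have hKtop : ∀ i, K i ≠ ∞ := by
    intro i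
    refine ENNReal.add_ne_top.2 ⟨by simp, ENNReal.mul_ne_top (by simp) ?_⟩
    refine (ENNReal.sum_ne_top).2 fun j _ => ?_
    rw [(hg i j).lintegral_enorm_sq]
    exact ENNReal.pow_ne_top (hu.memLp_grad_comp (i, j)).2.ne
  -- First `δ` is fixed by closeness to `V₀`, then `τ` by the time scales of the three components of
  -- `u`, and finally the kernel.
  have hmolls : ∀ n : ℕ, ∃ τ δ κ, 0 < δ ∧ IsMollifier 128 τ δ κ ∧
      (∫⁻ p, ‖moll κ V₀ p - V₀ p‖ₑ ^ 2 ≤ ((n : ℝ≥0∞) + 1)⁻¹ ^ 2) ∧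
      ∀ i, ∀ z : ℝ × T3, z.1 ∈ Icc 0 τ → ‖z.2‖ ≤ δ →
        shiftDist (U i) z ≤ ENNReal.ofReal δ ^ 2 * K i := by
    intro n
    have hε : (0 : ℝ≥0∞) < ((n : ℝ≥0∞) + 1)⁻¹ ^ 2 := by
      refine ENNReal.pow_pos (ENNReal.inv_pos.2 (by finiteness)) 2
    obtain ⟨η, hη, hnear⟩ := exists_mollifier_near hVi hV2 hV.measurable hε
    have hδ : 0 < min η 1 := lt_min hη one_pos
    choose τ hτ hscale using fun i => exists_time_scale (hwd i) hδ
    have hτ' : 0 < min η (min (τ 0) (min (τ 1) (τ 2))) :=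
      lt_min hη (lt_min (hτ 0) (lt_min (hτ 1) (hτ 2)))
    obtain ⟨κ, hκ⟩ := exists_isMollifier hτ' hδ (min_le_right _ _)
    refine ⟨_, _, κ, hδ, hκ, hnear _ _ _ _ (min_le_left _ _) (min_le_left _ _) hκ,
      fun i z hz1 hz2 => hscale i z ⟨hz1.1, hz1.2.trans ?_⟩ hz2⟩
    fin_cases i <;> simp
  choose τ δ κ hδ hκ hclose hscale using hmolls
  have hVn : ∀ n, IsC1 (moll (κ n) V₀) := fun n => isC1_moll hVi (hκ n).isC1 (hκ n).support_Icc
  have h01 : ∀ n p, 0 ≤ moll (κ n) V₀ p ∧ moll (κ n) V₀ p ≤ 1 := by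
    intro n p
    obtain ⟨B, hB0, hB⟩ := (hκ n).isC1.exists_bound (hκ n).support_Icc
    refine ⟨integral_nonneg fun q => mul_nonneg (hV01 q).1 ((hκ n).nonneg _), ?_⟩
    rw [← (hκ n).integral_eq_one, ← integral_sub_left_eq_self (κ n) volume p]
    refine integral_mono (integrable_mul_kernel hVi (hκ n).isC1.continuous (fun q => (hB q).1) p)
      ((hκ n).integrable.comp_sub_left p) fun q => ?_
    exact mul_le_of_le_one_left ((hκ n).nonneg _) (hV01 q).2
  -- At time zero the kernel samples only negative times, where `V₀` vanishes.
  have hinit : ∀ n x, moll (κ n) V₀ (0, x) = 0 := by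
    intro n x
    have : ∀ q : ℝ × T3, V₀ q * κ n ((0, x) - q) = 0 := by
      intro q
      by_cases hq : q ∈ cyl T
      · have : κ n ((0, x) - q) = 0 := by
          by_contra hne
          have h1 := ((hκ n).support_time _ hne).1
          have h2 := (mem_cyl.1 hq).1
          simp only [Prod.fst_sub] at h1
          linarith
        rw [this, mul_zero]
      · rw [hV.eq_zero q hq, zero_mul]
    simp [moll, this]
  set C : ℕ → Fin 3 → ℝ × T3 → ℝ := fun n i p =>
    ∫ q, V₀ q * ((U i p - U i q) * spacePartial i (κ n) (p - q)) with hC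
  have hCm : ∀ n i, AEStronglyMeasurable (C n i) volume := by
    intro n i
    refine (StronglyMeasurable.integral_prod_right
      (f := fun p q : ℝ × T3 => V₀ q * ((U i p - U i q) * spacePartial i (κ n) (p - q)))
      (Measurable.stronglyMeasurable ?_)).aestronglyMeasurable
    have m1 := (hU i).measurable
    have m2 := hV.measurable
    have m3 := ((hκ n).isC1.continuous_spacePartial i).measurable
    simp only [Function.uncurry_def]
    fun_prop
  have hCb : ∀ n i, eLpNorm (C n i) 2 volume ^ 2 ≤ ENNReal.ofReal 128 ^ 2 * K i := by
    intro n i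
    rw [← lintegral_enorm_sq_eq]
    exact lintegral_commutator_le (hδ n) (by norm_num) (hκ n) (hU i).measurable hVabs i (hscale n i)
  have hEb : ∀ n, eLpNorm (moll (κ n) E) 2 volume ≤
      eLpNorm (fun p => (1 - w p) * divergence Du p + Λ p * w p) 2 (spaceTime T) := by
    intro n
    have := (hκ n).lintegral_moll_le hE.measurable
    rw [hE.lintegral_enorm_sq, lintegral_enorm_sq_eq] at this
    exact (ENNReal.pow_le_pow_left_iff two_ne_zero).1 this
  have hEc : ∀ n, AEStronglyMeasurable (moll (κ n) E) volume := fun n =>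
    (isC1_moll (hE.integrable (hEL.integrable (by norm_num))) (hκ n).isC1
      (hκ n).support_Icc).continuous.aestronglyMeasurable
  set S : ℝ≥0∞ := (∑ i, (1 + ENNReal.ofReal 128 ^ 2 * K i)) +
    eLpNorm (fun p => (1 - w p) * divergence Du p + Λ p * w p) 2 (spaceTime T) with hS
  have hStop : S ≠ ∞ := by
    refine ENNReal.add_ne_top.2 ⟨ENNReal.sum_ne_top.2 fun i _ => ?_, hEL.2.ne⟩
    exact ENNReal.add_ne_top.2 ⟨by simp, ENNReal.mul_ne_top (by simp) (hKtop i)⟩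
  have hD : ∀ n, eLpNorm (materialDeriv u (moll (κ n) V₀)) 2 (spaceTime T) ≤ S := by
    intro n
    have hae : materialDeriv u (moll (κ n) V₀) =ᵐ[spaceTime T]
        (∑ i, C n i) + moll (κ n) E := by
      have hall : ∀ᵐ p ∂(spaceTime T), ∀ i, U i p = u p i := by
        rw [ae_all_iff]; exact fun i => (hU i).ae_eq
      filter_upwards [ae_mem_cyl T, hall] with p hp hUp
      rw [materialDeriv_moll hT hu hw hV hU hE (hκ n) hp hUp]
      simp [hC]
    rw [eLpNorm_congr_ae hae]
    refine (eLpNorm_spaceTime_le T _ 2).trans ?_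
    refine (eLpNorm_add_le (Finset.aestronglyMeasurable_sum _ fun i _ => hCm n i) (hEc n)
      one_le_two).trans (add_le_add ?_ (hEb n))
    refine (eLpNorm_sum_le (fun i _ => hCm n i) one_le_two).trans (Finset.sum_le_sum fun i _ => ?_)
    -- Turns the bound on the squared norm into one on the norm without square roots.
    have hx : ∀ x : ℝ≥0∞, x ≤ 1 + x ^ 2 := by
      intro x
      rcases le_total x 1 with h | h
      · exact h.trans le_self_add
      · exact (le_self_pow₀ h two_ne_zero).trans le_add_self
    exact (hx _).trans (add_le_add le_rfl (hCb n i))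
  have hlim : Filter.Tendsto (fun n => eLpNorm (moll (κ n) V₀ - V₀) 2 volume) Filter.atTop
      (nhds 0) := by
    have h1 : ∀ n, eLpNorm (moll (κ n) V₀ - V₀) 2 volume ≤ ((n : ℝ≥0∞) + 1)⁻¹ := by
      intro n
      refine (ENNReal.pow_le_pow_left_iff two_ne_zero).1 (le_trans (le_of_eq ?_) (hclose n))
      rw [← lintegral_enorm_sq_eq]
      rfl
    refine tendsto_of_tendsto_of_tendsto_of_le_of_le tendsto_const_nhds ?_ (fun _ => zero_le) h1
    have h2 := (Filter.tendsto_add_atTop_iff_nat 1).2 ENNReal.tendsto_inv_nat_nhds_zero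
    simpa using h2
  -- L² convergence gives convergence in measure, hence almost everywhere along a subsequence.
  have hmeas := tendstoInMeasure_of_tendsto_eLpNorm two_ne_zero
    (fun n => (hVn n).continuous.aestronglyMeasurable) hV.measurable.aestronglyMeasurable hlim
  obtain ⟨ns, -, hns⟩ := hmeas.exists_seq_tendsto_ae
  refine ⟨fun n => moll (κ (ns n)) V₀, S.toNNReal, fun n => hVn _, fun n => h01 _, fun n => hinit _,
    fun n => ?_, ?_⟩
  · rw [ENNReal.coe_toNNReal hStop]; exact hD _
  · have h3 : ∀ᵐ p ∂(spaceTime T), Filter.Tendsto (fun n => moll (κ (ns n)) V₀ p) Filter.atTop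
        (nhds (V₀ p)) := by
      rw [spaceTime_eq]; exact ae_restrict_of_ae hns
    filter_upwards [h3, hV.ae_eq] with p hp hp'
    rwa [hp'] at hp

end


/-! ### Passage to the limit -/

/-- For a bounded sequence, weak convergence tested on `S` extends to its closure, and pairing with
a strongly convergent sequence then passes to the limit. -/
theorem tendsto_inner_of_mem_closure {H : Type*} [NormedAddCommGroup H] [InnerProductSpace ℝ H]
    {D : ℕ → H} {L : H} {B : ℝ} (hB : ∀ n, ‖D n‖ ≤ B) {S : Set H}
    (hS : ∀ φ ∈ S, Filter.Tendsto (fun n => inner ℝ φ (D n)) Filter.atTop (nhds (inner ℝ φ L)))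
    {g : H} (hg : g ∈ closure S) {g' : ℕ → H} (hg' : Filter.Tendsto g' Filter.atTop (nhds g)) :
    Filter.Tendsto (fun n => inner ℝ (g' n) (D n)) Filter.atTop (nhds (inner ℝ g L)) := by
  have hB0 : 0 ≤ B := (norm_nonneg _).trans (hB 0)
  rw [Metric.tendsto_atTop]
  intro ε hε
  set η := ε / (4 * (B + ‖L‖ + 1)) with hη
  have hden : 0 < B + ‖L‖ + 1 := by positivity
  have hη0 : 0 < η := by positivity
  have hηε : η * (B + ‖L‖ + 1) = ε / 4 := by rw [hη]; field_simp
  obtain ⟨φ, hφS, hφ⟩ := Metric.mem_closure_iff.1 hg η hη0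
  obtain ⟨N₁, h1⟩ := Metric.tendsto_atTop.1 (hS φ hφS) (ε / 4) (by positivity)
  obtain ⟨N₂, h2⟩ := Metric.tendsto_atTop.1 hg' η hη0
  refine ⟨max N₁ N₂, fun n hn => ?_⟩
  have h1 := h1 n ((le_max_left _ _).trans hn)
  have h2 := h2 n ((le_max_right _ _).trans hn)
  rw [dist_eq_norm] at h1 h2 hφ ⊢
  have e : inner ℝ (g' n) (D n) - inner ℝ g L = inner ℝ (g' n - g) (D n) +
      inner ℝ (g - φ) (D n) + (inner ℝ φ (D n) - inner ℝ φ L) - inner ℝ (g - φ) L := by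
    simp only [inner_sub_left]; ring
  have k1 : ‖inner ℝ (g' n - g) (D n)‖ ≤ η * B :=
    (norm_inner_le_norm _ _).trans (mul_le_mul h2.le (hB n) (norm_nonneg _) hη0.le)
  have k2 : ‖inner ℝ (g - φ) (D n)‖ ≤ η * B :=
    (norm_inner_le_norm _ _).trans (mul_le_mul hφ.le (hB n) (norm_nonneg _) hη0.le)
  have k3 : ‖inner ℝ (g - φ) L‖ ≤ η * ‖L‖ :=
    (norm_inner_le_norm _ _).trans (mul_le_mul_of_nonneg_right hφ.le (norm_nonneg _))
  rw [e]
  have n1 := norm_sub_le (inner ℝ (g' n - g) (D n) + inner ℝ (g - φ) (D n) +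
    (inner ℝ φ (D n) - inner ℝ φ L)) (inner ℝ (g - φ) L)
  have n2 := norm_add_le (inner ℝ (g' n - g) (D n) + inner ℝ (g - φ) (D n))
    (inner ℝ φ (D n) - inner ℝ φ L)
  have n3 := norm_add_le (inner ℝ (g' n - g) (D n)) (inner ℝ (g - φ) (D n))
  nlinarith [norm_nonneg L]

theorem inner_toLp {α : Type*} [MeasurableSpace α] {μ : Measure α} {f g : α → ℝ}
    (hf : MemLp f 2 μ) (hg : MemLp g 2 μ) : inner ℝ (hf.toLp f) (hg.toLp g) = ∫ a, f a * g a ∂μ := by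
  rw [L2.inner_def]
  refine integral_congr_ae ?_
  filter_upwards [hf.coeFn_toLp, hg.coeFn_toLp] with a h1 h2
  rw [h1, h2]
  simp [mul_comm]

theorem memLp_mul_of_abs_le {α : Type*} [MeasurableSpace α] {μ : Measure α} {f a : α → ℝ} {c : ℝ}
    (hf : MemLp f 2 μ) (ha : AEStronglyMeasurable a μ) (hc : ∀ x, |a x| ≤ c) :
    MemLp (fun x => f x * a x) 2 μ :=
  (memLp_top_of_bound ha c (Filter.Eventually.of_forall hc)).mul' hf

/-- Dominated convergence for the squares, with majorant `|2 c f|²`: bounded multipliers converging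
almost everywhere act strongly on a fixed L² function. -/
theorem tendsto_toLp_mul {α : Type*} [MeasurableSpace α] {μ : Measure α} {f : α → ℝ}
    {a : ℕ → α → ℝ} {b : α → ℝ} {c : ℝ} (hf : MemLp f 2 μ) (ha : ∀ n, AEStronglyMeasurable (a n) μ)
    (hb : AEStronglyMeasurable b μ) (hac : ∀ n x, |a n x| ≤ c) (hbc : ∀ x, |b x| ≤ c)
    (hlim : ∀ᵐ x ∂μ, Filter.Tendsto (fun n => a n x) Filter.atTop (nhds (b x))) :
    Filter.Tendsto (fun n => (memLp_mul_of_abs_le hf (ha n) (hac n)).toLp _) Filter.atTop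
      (nhds ((memLp_mul_of_abs_le hf hb hbc).toLp _)) := by
  rw [Lp.tendsto_Lp_iff_tendsto_eLpNorm'']
  have h1 : Filter.Tendsto (fun n => ∫⁻ x, ‖f x * a n x - f x * b x‖ₑ ^ 2 ∂μ) Filter.atTop
      (nhds (∫⁻ _, 0 ∂μ)) := by
    refine tendsto_lintegral_of_dominated_convergence'
      (fun x => ‖f x * (2 * c)‖ₑ ^ 2) (fun n => ?_) (fun n => ?_) ?_ ?_
    · exact ((hf.1.mul (ha n)).sub (hf.1.mul hb)).enorm.pow_const 2
    · refine Filter.Eventually.of_forall fun x => pow_le_pow_left' ?_ 2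
      rw [← mul_sub, enorm_mul, enorm_mul]
      gcongr
      rw [Real.enorm_eq_ofReal_abs, Real.enorm_eq_ofReal_abs]
      refine ENNReal.ofReal_le_ofReal ((abs_sub _ _).trans ?_)
      refine le_trans ?_ (le_abs_self _)
      linarith [hac n x, hbc x]
    · have := (hf.mul_const (2 * c)).2.ne
      rw [lintegral_enorm_sq_eq]
      exact ENNReal.pow_ne_top this
    · filter_upwards [hlim] with x hx
      have h2 : Filter.Tendsto (fun n => f x * a n x - f x * b x) Filter.atTop (nhds 0) := by
        have := (hx.const_mul (f x)).sub_const (f x * b x)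
        rwa [sub_self] at this
      have h3 := ((ENNReal.continuous_pow 2).tendsto _).comp h2.enorm
      simpa [Function.comp_def] using h3
  rw [lintegral_zero] at h1
  have h4 := ((ENNReal.continuous_rpow_const (y := 1 / 2)).tendsto 0).comp h1
  rw [ENNReal.zero_rpow_of_pos (by norm_num)] at h4
  refine h4.congr fun n => ?_
  simp only [Function.comp]
  rw [lintegral_enorm_sq_eq, ← ENNReal.rpow_natCast, ← ENNReal.rpow_mul]
  norm_num
  rfl

section

variable {T : ℝ} {u : ℝ × T3 → E3} {Du : ℝ × T3 → Mat3} {Λ w : ℝ × T3 → ℝ}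

/-- Mollification pushes supports forward in time by less than `τ`. A function vanishing after `T' <
T` therefore has mollifications that are test functions. -/
theorem mem_closure_testFun {T' : ℝ} (hT' : T' < T) {g : ℝ × T3 → ℝ}
    (hg : MemLp g 2 (spaceTime T)) (h0 : ∀ p : ℝ × T3, T' ≤ p.1 → g p = 0) :
    hg.toLp g ∈ closure {f : Lp ℝ 2 (spaceTime T) | ∃ φ, IsTestFun T φ ∧ f =ᵐ[spaceTime T] φ} := by
  rw [Metric.mem_closure_iff]
  intro ε hε
  obtain ⟨G₀, hG₀⟩ := exists_isZeroExt hg.aestronglyMeasurable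
  -- The extra cutoff makes the representative vanish everywhere after `T'`, not merely almost
  -- everywhere.
  set G : ℝ × T3 → ℝ := {p : ℝ × T3 | p.1 < T'}.indicator G₀ with hGdef
  have hms : MeasurableSet {p : ℝ × T3 | p.1 < T'} := measurableSet_lt measurable_fst measurable_const
  have hG : IsZeroExt T g G := by
    refine ⟨hG₀.measurable.indicator hms, fun p hp => ?_, ?_⟩
    · simp [hGdef, indicator_apply, hG₀.eq_zero p hp]
    · filter_upwards [hG₀.ae_eq] with p hp
      by_cases h : p.1 < T'
      · rw [hGdef, indicator_of_mem (by exact h), hp]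
      · rw [hGdef, indicator_of_notMem (by exact h), h0 p (not_lt.1 h)]
  have hGi : Integrable G := hG.integrable (hg.integrable (by norm_num))
  have hε' : (0 : ℝ≥0∞) < ENNReal.ofReal (ε / 2) ^ 2 := by positivity
  obtain ⟨η, hη, hnear⟩ := exists_mollifier_near hGi (hG.memLp hg) hG.measurable hε'
  have hτ : 0 < min η ((T - T') / 2) := lt_min hη (by linarith)
  obtain ⟨κ, hκ⟩ := exists_isMollifier hτ (lt_min hη one_pos) (min_le_right η 1)
  have hC : IsC1 (moll κ G) := isC1_moll hGi hκ.isC1 hκ.support_Icc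
  have htest : IsTestFun T (moll κ G) := by
    refine ⟨hC, T' + (T - T') / 2, by linarith, fun t x ht => ?_⟩
    have : ∀ q : ℝ × T3, G q * κ ((t, x) - q) = 0 := by
      intro q
      by_cases hq : q.1 < T'
      · have : κ ((t, x) - q) = 0 := by
          by_contra hne
          have h1 := (hκ.support_time _ hne).2.trans_le (min_le_right _ _)
          simp only [Prod.fst_sub] at h1
          linarith
        rw [this, mul_zero]
      · rw [hGdef, indicator_of_notMem (by exact hq), zero_mul]
    simp [moll, this]
  have hφ : MemLp (moll κ G) 2 (spaceTime T) := hC.memLp_top.mono_exponent le_top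
  refine ⟨hφ.toLp _, ⟨_, htest, hφ.coeFn_toLp⟩, ?_⟩
  have h1 : eLpNorm (fun p => moll κ G p - G p) 2 volume ≤ ENNReal.ofReal (ε / 2) := by
    have := hnear _ _ _ _ (min_le_left _ _) (min_le_left _ _) hκ
    rw [lintegral_enorm_sq_eq] at this
    exact (ENNReal.pow_le_pow_left_iff two_ne_zero).1 this
  have h2 : edist (hg.toLp g) (hφ.toLp _) ≤ ENNReal.ofReal (ε / 2) := by
    rw [edist_comm, Lp.edist_toLp_toLp]
    refine le_trans (le_of_eq ?_) ((eLpNorm_spaceTime_le T _ 2).trans h1)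
    refine eLpNorm_congr_ae ?_
    filter_upwards [hG.ae_eq] with p hp
    simp [hp]
  rw [edist_le_ofReal (by positivity)] at h2
  linarith

/-- Integrate the product rule for `φV`. The boundary terms vanish: at `T` because of `φ`, at `0`
because of `V`. -/
theorem integral_mul_materialDeriv (hT : 0 < T) (hu : IsL2W12 T u Du) {φ V : ℝ × T3 → ℝ}
    (hφ : IsTestFun T φ) (hV : IsC1 V) (hV0 : ∀ x, V (0, x) = 0) :
    ∫ p, φ p * materialDeriv u V p ∂(spaceTime T) =
      -∫ p, V p * (timeDeriv φ p + dirDeriv u φ p + divergence Du p * φ p) ∂(spaceTime T) := by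
  have hC := hφ.isC1
  have hP := hC.mul hV
  have h1 := hP.integral_timeDeriv hT fun x => by rw [hφ.eq_zero_end, zero_mul]
  have h2 := hu.integral_dirDeriv hP
  simp only [hV0, mul_zero, integral_zero, neg_zero] at h1
  have g1 : Integrable (timeDeriv fun p => φ p * V p) (spaceTime T) :=
    hP.memLp_top_timeDeriv.integrable (by simp)
  have g2 : Integrable (dirDeriv u fun p => φ p * V p) (spaceTime T) :=
    (hu.memLp_dirDeriv hP).integrable (by norm_num)
  have g3 : Integrable (fun p => divergence Du p * (φ p * V p)) (spaceTime T) :=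
    MemLp.integrable (q := 2) (by norm_num) (hP.memLp_top.mul' hu.memLp_divergence)
  have g4 : Integrable (fun p => V p * (timeDeriv φ p + dirDeriv u φ p + divergence Du p * φ p))
      (spaceTime T) := by
    have hF : MemLp (fun p => timeDeriv φ p + dirDeriv u φ p + divergence Du p * φ p) 2
        (spaceTime T) :=
      ((hC.memLp_top_timeDeriv.mono_exponent le_top).add (hu.memLp_dirDeriv hC)).add
        (hC.memLp_top.mul' hu.memLp_divergence)
    exact (hF.integrable (by norm_num)).mul_of_top_right hV.memLp_top
  have e : ∀ p, φ p * materialDeriv u V p = timeDeriv (fun p => φ p * V p) p +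
      dirDeriv u (fun p => φ p * V p) p + divergence Du p * (φ p * V p) -
        V p * (timeDeriv φ p + dirDeriv u φ p + divergence Du p * φ p) := by
    intro p
    simp only [materialDeriv, dirDeriv_eq, hC.timeDeriv_mul hV, hC.spacePartial_mul hV,
      Fin.sum_univ_three]
    ring
  have g12 : Integrable (fun p => timeDeriv (fun p => φ p * V p) p +
      dirDeriv u (fun p => φ p * V p) p) (spaceTime T) := g1.add g2
  have g123 : Integrable (fun p => timeDeriv (fun p => φ p * V p) p +
      dirDeriv u (fun p => φ p * V p) p + divergence Du p * (φ p * V p)) (spaceTime T) := g12.add g3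
  simp_rw [e]
  rw [integral_sub g123 g4, integral_add g12 g3, integral_add g1 g2, h1, h2]
  ring

/-- Identifies the weak limit of the material derivatives. With the derivatives moved onto `φ`,
dominated convergence applies, and the equation of `1 - w` turns the limit into `Λw`. -/
theorem tendsto_integral_mul_materialDeriv (hT : 0 < T) (hu : IsL2W12 T u Du)
    (hw : IsWeakTransportSol T u Du Λ (fun _ => 1) w) {V : ℕ → ℝ × T3 → ℝ} (hV : ∀ n, IsC1 (V n))
    (hV01 : ∀ n p, 0 ≤ V n p ∧ V n p ≤ 1) (hV0 : ∀ n x, V n (0, x) = 0)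
    (hlim : ∀ᵐ p ∂(spaceTime T),
      Filter.Tendsto (fun n => V n p) Filter.atTop (nhds (1 - w p)))
    {φ : ℝ × T3 → ℝ} (hφ : IsTestFun T φ) :
    Filter.Tendsto (fun n => ∫ p, φ p * materialDeriv u (V n) p ∂(spaceTime T)) Filter.atTop
      (nhds (∫ p, φ p * (Λ p * w p) ∂(spaceTime T))) := by
  have hC := hφ.isC1
  have hF : Integrable (fun p => timeDeriv φ p + dirDeriv u φ p + divergence Du p * φ p)
      (spaceTime T) := by
    refine MemLp.integrable (q := 2) (by norm_num) ?_
    exact ((hC.memLp_top_timeDeriv.mono_exponent le_top).add (hu.memLp_dirDeriv hC)).add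
      (hC.memLp_top.mul' hu.memLp_divergence)
  have hv : MemLp (fun p => 1 - w p) ∞ (spaceTime T) := (memLp_top_const 1).sub hw.memLp
  have h1 := hw.weak_eq_compl hT hu hφ
  have g1 : Integrable (fun p => (1 - w p) * (timeDeriv φ p + dirDeriv u φ p +
      divergence Du p * φ p)) (spaceTime T) := hF.mul_of_top_right hv
  have g2 : Integrable (fun p => Λ p * w p * φ p) (spaceTime T) :=
    hw.integrable_damping.mul_of_top_left hC.memLp_top
  rw [integral_add g1 g2] at h1
  have h2 : ∫ p, φ p * (Λ p * w p) ∂(spaceTime T) = -∫ p, (1 - w p) * (timeDeriv φ p +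
      dirDeriv u φ p + divergence Du p * φ p) ∂(spaceTime T) := by
    rw [← add_eq_zero_iff_eq_neg, add_comm, ← h1]
    congr 2
    funext p; ring
  simp_rw [fun n => integral_mul_materialDeriv hT hu hφ (hV n) (hV0 n)]
  rw [h2]
  refine Filter.Tendsto.neg ?_
  refine tendsto_integral_of_dominated_convergence (fun p => |timeDeriv φ p + dirDeriv u φ p +
    divergence Du p * φ p|) (fun n => ?_) hF.abs (fun n => ?_) ?_
  · exact (hV n).continuous.aestronglyMeasurable.mul hF.aestronglyMeasurable
  · refine Filter.Eventually.of_forall fun p => ?_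
    rw [norm_mul, Real.norm_eq_abs, Real.norm_eq_abs, abs_of_nonneg (hV01 n p).1]
    exact mul_le_of_le_one_left (abs_nonneg _) (hV01 n p).2
  · filter_upwards [hlim] with p hp
    exact hp.mul_const _

end


/-! ### The renormalized logarithmic estimate -/

/-- `log (1 + σ) - log (1 - y + σ)`, an approximation of `|log (1 - y)|` for `y ∈ [0, 1]`. -/
noncomputable def logGain (σ y : ℝ) : ℝ := Real.log (1 + σ) - Real.log (1 - y + σ)

section logGain

variable {σ y : ℝ}

theorem logGain_zero (σ : ℝ) : logGain σ 0 = 0 := by simp [logGain]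

theorem hasDerivAt_logGain (h : 1 - y + σ ≠ 0) : HasDerivAt (logGain σ) (1 / (1 - y + σ)) y := by
  have h1 : HasDerivAt (fun y : ℝ => 1 - y + σ) (-1) y := ((hasDerivAt_id y).const_sub 1).add_const σ
  have h2 := (h1.log h).const_sub (Real.log (1 + σ))
  rwa [neg_div, neg_neg] at h2

theorem logGain_nonneg (hσ : 0 < σ) (h0 : 0 ≤ y) (h1 : y ≤ 1) : 0 ≤ logGain σ y :=
  sub_nonneg.2 (Real.log_le_log (by linarith) (by linarith))

theorem logGain_le (hσ : 0 < σ) (h1 : y ≤ 1) : logGain σ y ≤ Real.log (1 + σ) - Real.log σ :=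
  sub_le_sub_left (Real.log_le_log hσ (by linarith)) _

theorem abs_logGain_le (hσ : 0 < σ) (h0 : 0 ≤ y) (h1 : y ≤ 1) :
    |logGain σ y| ≤ Real.log (1 + σ) - Real.log σ := by
  rw [abs_of_nonneg (logGain_nonneg hσ h0 h1)]
  exact logGain_le hσ h1

theorem measurable_logGain (σ : ℝ) : Measurable (logGain σ) := by
  unfold logGain
  fun_prop

theorem IsC1.logGain_comp {V : ℝ × T3 → ℝ} (hσ : 0 < σ) (hV : IsC1 V) (h1 : ∀ p, V p ≤ 1) :
    IsC1 fun p => logGain σ (V p) := by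
  have h2 : ContDiff ℝ 1 fun q => 1 - V (cover q) + σ := (contDiff_const.sub hV).add contDiff_const
  exact contDiff_const.sub (h2.log fun q => by linarith [h1 (cover q)])

end logGain

section

variable {T σ : ℝ} {u : ℝ × T3 → E3} {Du : ℝ × T3 → Mat3} {Λ w h ρ : ℝ × T3 → ℝ} {ρ₀ : T3 → ℝ}

/-- Test the continuity equation with `χ logGain σ (V)`. Since `logGain σ 0 = 0` the initial density
disappears, and the sink term is dropped by its sign. -/
theorem IsDensity.logGain_ineq (hu : IsL2W12 T u Du) (hρ : IsDensity T u h ρ₀ ρ)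
    (hσ : 0 < σ) {χ : ℝ → ℝ} (hχ : ContDiff ℝ 1 χ) (hχ0 : ∀ t, 0 ≤ χ t) {T' : ℝ} (hT' : T' < T)
    (hχT : ∀ t, T' ≤ t → χ t = 0) {V : ℝ × T3 → ℝ} (hV : IsC1 V) (hV01 : ∀ p, 0 ≤ V p ∧ V p ≤ 1)
    (hV0 : ∀ x, V (0, x) = 0) :
    0 ≤ ∫ p, ρ p * (deriv χ p.1 * logGain σ (V p)) ∂(spaceTime T) +
      ∫ p, ρ p * (χ p.1 / (1 - V p + σ)) * materialDeriv u V p ∂(spaceTime T) := by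
  have hpos : ∀ p, 0 < 1 - V p + σ := fun p => by linarith [(hV01 p).2]
  have hL : IsC1 fun p => logGain σ (V p) := hV.logGain_comp hσ fun p => (hV01 p).2
  have hX : IsC1 fun p : ℝ × T3 => χ p.1 := IsC1.of_time hχ
  have hψ : IsC1 fun p : ℝ × T3 => χ p.1 * logGain σ (V p) := hX.mul hL
  have htest : IsTestFun T fun p : ℝ × T3 => χ p.1 * logGain σ (V p) :=
    ⟨hψ, T', hT', fun t x ht => by simp [hχT t ht]⟩
  have key := hρ.weak_eq _ htest
  simp only [hV0, logGain_zero, mul_zero, integral_zero, neg_zero] at key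
  have e : ∀ p, timeDeriv (fun p : ℝ × T3 => χ p.1 * logGain σ (V p)) p +
      dirDeriv u (fun p : ℝ × T3 => χ p.1 * logGain σ (V p)) p =
      deriv χ p.1 * logGain σ (V p) + χ p.1 / (1 - V p + σ) * materialDeriv u V p := by
    intro p
    have hd := hasDerivAt_logGain (hpos p).ne'
    have e1 : timeDeriv (fun p : ℝ × T3 => χ p.1) p = deriv χ p.1 := rfl
    simp only [dirDeriv_eq, hX.timeDeriv_mul hL, hX.spacePartial_mul hL, IsC1.spacePartial_time,
      hV.timeDeriv_comp p hd, hV.spacePartial_comp _ p hd, materialDeriv, e1,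
      Fin.sum_univ_three]
    ring
  simp_rw [e] at key
  have i1 : MemLp (fun p : ℝ × T3 => deriv χ p.1 * logGain σ (V p)) 2 (spaceTime T) :=
    (hL.memLp_top.mul' hX.memLp_top_timeDeriv (r := ∞)).mono_exponent le_top
  have hmd : MemLp (materialDeriv u V) 2 (spaceTime T) :=
    (hV.memLp_top_timeDeriv.mono_exponent le_top).add (hu.memLp_dirDeriv hV)
  have hq : IsC1 fun p : ℝ × T3 => χ p.1 / (1 - V p + σ) :=
    ContDiff.div hX ((contDiff_const.sub hV).add contDiff_const) fun q => (hpos (cover q)).ne'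
  have i2 : MemLp (fun p => χ p.1 / (1 - V p + σ) * materialDeriv u V p) 2 (spaceTime T) :=
    hmd.mul' hq.memLp_top
  have j1 : Integrable (fun p => ρ p * (deriv χ p.1 * logGain σ (V p))) (spaceTime T) :=
    hρ.memLp.integrable_mul i1
  have j2 : Integrable (fun p => ρ p * (χ p.1 / (1 - V p + σ) * materialDeriv u V p))
      (spaceTime T) := hρ.memLp.integrable_mul i2
  have j3 : Integrable (fun p => h p * (χ p.1 * logGain σ (V p))) (spaceTime T) :=
    hρ.sink_integrable.mul_of_top_left hψ.memLp_top
  have j12 : Integrable (fun p => ρ p * (deriv χ p.1 * logGain σ (V p)) +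
      ρ p * (χ p.1 / (1 - V p + σ) * materialDeriv u V p)) (spaceTime T) := j1.add j2
  simp_rw [mul_add] at key
  rw [integral_sub j12 j3, integral_add j1 j2] at key
  have hh : 0 ≤ ∫ p, h p * (χ p.1 * logGain σ (V p)) ∂(spaceTime T) := by
    refine integral_nonneg_of_ae ?_
    filter_upwards [hρ.sink_nonneg] with p hp
    exact mul_nonneg hp (mul_nonneg (hχ0 _) (logGain_nonneg hσ (hV01 p).1 (hV01 p).2))
  simp_rw [mul_assoc]
  linarith

/-- The inequality for `V_n` passes to the limit: the `χ'` term by dominated convergence, the other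
as strong times weak convergence in L². The bound obtained does not involve `σ`. -/
theorem IsDensity.logGain_limit_ineq (hT : 0 < T) (hu : IsL2W12 T u Du)
    (hΛ : MemLp Λ 2 (spaceTime T)) (hΛ0 : ∀ᵐ p ∂(spaceTime T), 0 ≤ Λ p)
    (hρ : IsDensity T u h ρ₀ ρ) (hwm : Measurable w) (hw01 : ∀ p, 0 ≤ w p ∧ w p ≤ 1)
    (hw : IsWeakTransportSol T u Du Λ (fun _ => 1) w) (hσ : 0 < σ)
    {χ : ℝ → ℝ} (hχ : ContDiff ℝ 1 χ) (hχ0 : ∀ t, 0 ≤ χ t) (hχ1 : ∀ t, χ t ≤ 1) {T' : ℝ}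
    (hT' : T' < T) (hχT : ∀ t, T' ≤ t → χ t = 0) :
    -∫ p, ρ p * (deriv χ p.1 * logGain σ (1 - w p)) ∂(spaceTime T) ≤
      ∫ p, ρ p * Λ p ∂(spaceTime T) := by
  obtain ⟨V, B, hV, hV01, hV0, hVB, hlim⟩ := exists_approximation hT hu hΛ hwm hw01 hw
  have hX : IsC1 fun p : ℝ × T3 => χ p.1 := IsC1.of_time hχ
  have hΛw : MemLp (fun p => Λ p * w p) 2 (spaceTime T) :=
    memLp_mul_of_abs_le hΛ hwm.aestronglyMeasurable (c := 1) fun p => by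
      rw [abs_of_nonneg (hw01 p).1]; exact (hw01 p).2
  have hmd : ∀ n, MemLp (materialDeriv u (V n)) 2 (spaceTime T) := fun n =>
    ((hV n).memLp_top_timeDeriv.mono_exponent le_top).add (hu.memLp_dirDeriv (hV n))
  have hbd : ∀ (y : ℝ) (t : ℝ), 0 ≤ y → |χ t / (y + σ)| ≤ 1 / σ := by
    intro y t hy
    rw [abs_of_nonneg (div_nonneg (hχ0 t) (by linarith))]
    exact div_le_div₀ zero_le_one (hχ1 t) hσ (by linarith)
  have hmχ : Measurable fun p : ℝ × T3 => χ p.1 := hX.continuous.measurable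
  have ham : ∀ n, AEStronglyMeasurable (fun p : ℝ × T3 => χ p.1 / (1 - V n p + σ))
      (spaceTime T) := fun n =>
    (hmχ.div ((measurable_const.sub (hV n).continuous.measurable).add_const σ)).aestronglyMeasurable
  have hbm : AEStronglyMeasurable (fun p : ℝ × T3 => χ p.1 / (w p + σ)) (spaceTime T) :=
    (hmχ.div (hwm.add_const σ)).aestronglyMeasurable
  have hac : ∀ n p, |χ p.1 / (1 - V n p + σ)| ≤ 1 / σ := fun n p =>
    hbd _ _ (by linarith [(hV01 n p).2])
  have hbc : ∀ p : ℝ × T3, |χ p.1 / (w p + σ)| ≤ 1 / σ := fun p => hbd _ _ (hw01 p).1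
  have hal : ∀ᵐ p ∂(spaceTime T), Filter.Tendsto (fun n => χ p.1 / (1 - V n p + σ)) Filter.atTop
      (nhds (χ p.1 / (w p + σ))) := by
    filter_upwards [hlim] with p hp
    have h1 : Filter.Tendsto (fun n => 1 - V n p + σ) Filter.atTop (nhds (w p + σ)) := by
      have := (hp.const_sub 1).add_const σ
      rwa [sub_sub_cancel] at this
    exact tendsto_const_nhds.div h1 (by linarith [(hw01 p).1])
  have hconv := tendsto_toLp_mul hρ.memLp ham hbm hac hbc hal
  have hmem := mem_closure_testFun hT' (memLp_mul_of_abs_le hρ.memLp hbm hbc)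
    fun p hp => by simp [hχT _ hp]
  have h2 := tendsto_inner_of_mem_closure (D := fun n => (hmd n).toLp _) (L := hΛw.toLp _)
    (B := B) (fun n => by
      rw [Lp.norm_toLp]
      exact ENNReal.toReal_le_of_le_ofReal B.2 (by simpa using hVB n)) (S := {f |
        ∃ φ, IsTestFun T φ ∧ f =ᵐ[spaceTime T] φ}) (by
      rintro f ⟨φ, hφ, hf⟩
      have hφL : MemLp φ 2 (spaceTime T) := hφ.isC1.memLp_top.mono_exponent le_top
      have : f = hφL.toLp φ := Lp.ext (hf.trans hφL.coeFn_toLp.symm)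
      rw [this]
      simp_rw [inner_toLp]
      exact tendsto_integral_mul_materialDeriv hT hu hw hV hV01 hV0 hlim hφ) hmem hconv
  simp_rw [inner_toLp] at h2
  have h1 : Filter.Tendsto (fun n => ∫ p, ρ p * (deriv χ p.1 * logGain σ (V n p)) ∂(spaceTime T))
      Filter.atTop (nhds (∫ p, ρ p * (deriv χ p.1 * logGain σ (1 - w p)) ∂(spaceTime T))) := by
    have hd : MemLp (fun p : ℝ × T3 => deriv χ p.1) ∞ (spaceTime T) := hX.memLp_top_timeDeriv
    have hρd : Integrable (fun p => ρ p * deriv χ p.1) (spaceTime T) :=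
      (hρ.memLp.integrable (by norm_num)).mul_of_top_left hd
    refine tendsto_integral_of_dominated_convergence (fun p => |ρ p * deriv χ p.1| *
      (Real.log (1 + σ) - Real.log σ)) (fun n => ?_) (hρd.abs.mul_const _) (fun n => ?_) ?_
    · exact hρ.memLp.1.mul (hd.1.mul
        ((measurable_logGain σ).comp (hV n).continuous.measurable).aestronglyMeasurable)
    · refine Filter.Eventually.of_forall fun p => ?_
      rw [← mul_assoc, norm_mul, Real.norm_eq_abs, Real.norm_eq_abs]
      exact mul_le_mul_of_nonneg_left (abs_logGain_le hσ (hV01 n p).1 (hV01 n p).2) (abs_nonneg _)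
    · filter_upwards [hlim] with p hp
      refine Filter.Tendsto.const_mul _ (Filter.Tendsto.const_mul _ ?_)
      have : 1 - (1 - w p) + σ ≠ 0 := by linarith [(hw01 p).1]
      exact ((hasDerivAt_logGain this).continuousAt.tendsto).comp hp
  have h3 := ge_of_tendsto (h1.add h2) (Filter.Eventually.of_forall fun n =>
    hρ.logGain_ineq hu hσ hχ hχ0 hT' hχT (hV n) (hV01 n) (hV0 n))
  have h4 : ∫ p, ρ p * (χ p.1 / (w p + σ)) * (Λ p * w p) ∂(spaceTime T) ≤
      ∫ p, ρ p * Λ p ∂(spaceTime T) := by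
    refine integral_mono_ae ((memLp_mul_of_abs_le hρ.memLp hbm hbc).integrable_mul hΛw)
      (hρ.memLp.integrable_mul hΛ) ?_
    filter_upwards [hρ.nonneg, hΛ0] with p hp1 hp2
    -- The factor `w` in the damping cancels the singularity of the logarithm's derivative,
    -- uniformly in `σ`.
    have h5 : χ p.1 / (w p + σ) * w p ≤ 1 := by
      have hw0 := (hw01 p).1
      rw [div_mul_eq_mul_div, div_le_one (by linarith)]
      nlinarith [hχ1 p.1]
    calc ρ p * (χ p.1 / (w p + σ)) * (Λ p * w p) = ρ p * Λ p * (χ p.1 / (w p + σ) * w p) := by ring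
      _ ≤ ρ p * Λ p := mul_le_of_le_one_right (mul_nonneg hp1 hp2) h5
  linarith

end


/-! ### The estimate at almost every time -/

/-- A smooth decreasing cutoff in time, centred at `t₀`. -/
noncomputable def tailCutoff (η : ContDiffBump (0 : ℝ)) (t₀ t : ℝ) : ℝ :=
  ∫ s in Iic (t₀ - t), η.normed volume s

section tailCutoff

variable (η : ContDiffBump (0 : ℝ)) (t₀ t : ℝ)

theorem hasDerivAt_tailCutoff : HasDerivAt (tailCutoff η t₀) (-η.normed volume (t₀ - t)) t := by
  have hc : Continuous (η.normed volume) := η.continuous_normed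
  have h1 : HasDerivAt (fun r => ∫ s in (0 : ℝ)..r, η.normed volume s) (η.normed volume (t₀ - t))
      (t₀ - t) :=
    intervalIntegral.integral_hasDerivAt_right (hc.intervalIntegrable _ _)
      hc.stronglyMeasurable.stronglyMeasurableAtFilter hc.continuousAt
  have h2 := (HasDerivAt.comp t h1 ((hasDerivAt_id t).const_sub t₀)).add_const
    (∫ s in Iic (0 : ℝ), η.normed volume s)
  rw [mul_neg_one] at h2
  refine h2.congr_of_eventuallyEq (Filter.Eventually.of_forall fun r => ?_)
  have hi : Integrable (η.normed volume) := η.integrable_normed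
  have := intervalIntegral.integral_Iic_sub_Iic hi.integrableOn (hi.integrableOn (s := Iic (t₀ - r)))
    (a := 0)
  simp only [tailCutoff, Function.comp]
  linarith

theorem deriv_tailCutoff : deriv (tailCutoff η t₀) t = -η.normed volume (t₀ - t) :=
  (hasDerivAt_tailCutoff η t₀ t).deriv

theorem contDiff_tailCutoff : ContDiff ℝ 1 (tailCutoff η t₀) := by
  rw [contDiff_one_iff_deriv]
  refine ⟨fun t => (hasDerivAt_tailCutoff η t₀ t).differentiableAt, ?_⟩
  rw [funext (deriv_tailCutoff η t₀)]
  exact (η.continuous_normed.comp (continuous_const.sub continuous_id)).neg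

theorem tailCutoff_nonneg : 0 ≤ tailCutoff η t₀ t :=
  integral_nonneg fun s => η.nonneg_normed s

theorem tailCutoff_le_one : tailCutoff η t₀ t ≤ 1 := by
  rw [← η.integral_normed (μ := volume)]
  exact setIntegral_le_integral η.integrable_normed
    (Filter.Eventually.of_forall fun s => η.nonneg_normed s)

theorem tailCutoff_eq_zero {t : ℝ} (ht : t₀ + η.rOut ≤ t) : tailCutoff η t₀ t = 0 := by
  refine setIntegral_eq_zero_of_forall_eq_zero fun s hs => ?_
  rw [← Function.notMem_support, η.support_normed_eq, mem_ball_zero_iff, Real.norm_eq_abs, not_lt]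
  have : s ≤ t₀ - t := hs
  exact le_trans (by linarith) (neg_le_abs s)

end tailCutoff

/-- Take for `χ` smooth steps down at `t₀`: then `-∫χ' m` is the convolution of `m` with a shrinking
bump, evaluated at `t₀`, and tends to `m t₀` at almost every `t₀`. -/
theorem ae_le_of_cutoff_ineq {T C₀ : ℝ} {m : ℝ → ℝ} (hm : Integrable m)
    (h : ∀ χ : ℝ → ℝ, ContDiff ℝ 1 χ → (∀ t, 0 ≤ χ t) → (∀ t, χ t ≤ 1) → ∀ T' < T,
      (∀ t, T' ≤ t → χ t = 0) → -∫ t, deriv χ t * m t ≤ C₀) :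
    ∀ᵐ t ∂((volume : Measure ℝ).restrict (Ioo 0 T)), m t ≤ C₀ := by
  have hr : ∀ i : ℕ, (0 : ℝ) < 1 / ((i : ℝ) + 1) := fun i => by positivity
  let η : ℕ → ContDiffBump (0 : ℝ) := fun i =>
    ⟨1 / ((i : ℝ) + 1) / 2, 1 / ((i : ℝ) + 1), half_pos (hr i), half_lt_self (hr i)⟩
  have h0 : Filter.Tendsto (fun i => (η i).rOut) Filter.atTop (nhds 0) :=
    tendsto_one_div_add_atTop_nhds_zero_nat
  -- `K = 2` is the ratio of outer to inner radius of the bumps.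
  have h1 := ContDiffBump.ae_convolution_tendsto_right_of_locallyIntegrable (φ := η) (K := 2) h0
    (Filter.Eventually.of_forall fun i => by simp only [η]; linarith) hm.locallyIntegrable
  filter_upwards [ae_restrict_of_ae h1, ae_restrict_mem measurableSet_Ioo] with t₀ ht₀ hmem
  refine le_of_tendsto ht₀ ?_
  -- Eventually the step ends before `T`, as the hypothesis on `χ` requires.
  have h2 : ∀ᶠ i in Filter.atTop, (η i).rOut < T - t₀ :=
    h0.eventually_lt_const (sub_pos.2 hmem.2)
  filter_upwards [h2] with i hi
  have h3 := h _ (contDiff_tailCutoff (η i) t₀) (tailCutoff_nonneg (η i) t₀)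
    (tailCutoff_le_one (η i) t₀) (t₀ + (η i).rOut) (by linarith)
    fun t ht => tailCutoff_eq_zero (η i) t₀ ht
  refine le_trans (le_of_eq ?_) h3
  rw [MeasureTheory.convolution_eq_swap, ← integral_neg]
  refine integral_congr_ae (Filter.Eventually.of_forall fun t => ?_)
  simp [deriv_tailCutoff]

theorem tendsto_logGain_absLog {s : ℝ} (h0 : 0 ≤ s) (h1 : s ≤ 1) :
    Filter.Tendsto (fun k : ℕ => ENNReal.ofReal (logGain (1 / ((k : ℝ) + 1)) (1 - s)))
      Filter.atTop (nhds (absLog s)) := by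
  have hσ : Filter.Tendsto (fun k : ℕ => 1 / ((k : ℝ) + 1)) Filter.atTop (nhds 0) :=
    tendsto_one_div_add_atTop_nhds_zero_nat
  have ha : Filter.Tendsto (fun k : ℕ => Real.log (1 + 1 / ((k : ℝ) + 1))) Filter.atTop (nhds 0) := by
    have := (hσ.const_add 1).log (by norm_num)
    rwa [add_zero, Real.log_one] at this
  simp only [logGain, sub_sub_cancel]
  rcases h0.eq_or_lt with rfl | hs
  · have : absLog 0 = ⊤ := by simp [absLog]
    rw [this]
    refine ENNReal.tendsto_ofReal_atTop.comp ?_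
    simp only [zero_add]
    have hσ' : Filter.Tendsto (fun k : ℕ => 1 / ((k : ℝ) + 1)) Filter.atTop (nhdsWithin 0 (Ioi 0)) :=
      tendsto_nhdsWithin_iff.2 ⟨hσ, Filter.Eventually.of_forall fun k => by
        simp only [mem_Ioi]; positivity⟩
    have hb := Filter.tendsto_neg_atBot_atTop.comp (Real.tendsto_log_nhdsGT_zero.comp hσ')
    exact ha.add_atTop hb
  · have e : absLog s = ENNReal.ofReal (0 - Real.log (s + 0)) := by
      rw [absLog, ENNReal.log_ofReal, if_neg (not_le.2 hs), EReal.abs_def,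
        abs_of_nonpos (Real.log_nonpos h0 h1)]
      simp
    rw [e]
    exact ENNReal.tendsto_ofReal (ha.sub ((hσ.const_add s).log (by rw [add_zero]; exact hs.ne')))

section

variable {T : ℝ} {u : ℝ × T3 → E3} {Du : ℝ × T3 → Mat3} {Λ w h ρ : ℝ × T3 → ℝ} {ρ₀ : T3 → ℝ}

/-- By Fubini, the time cutoff inequality concerns `m t = ∫ρ logGain`, extended by zero outside
`(0,T)`. The exceptional set of times may depend on `σ`. -/
theorem IsDensity.ae_lintegral_logGain_le (hT : 0 < T) (hu : IsL2W12 T u Du)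
    (hΛ : MemLp Λ 2 (spaceTime T)) (hΛ0 : ∀ᵐ p ∂(spaceTime T), 0 ≤ Λ p)
    (hρ : IsDensity T u h ρ₀ ρ) (hwm : Measurable w) (hw01 : ∀ p, 0 ≤ w p ∧ w p ≤ 1)
    (hw : IsWeakTransportSol T u Du Λ (fun _ => 1) w) {σ : ℝ} (hσ : 0 < σ) :
    ∀ᵐ t ∂((volume : Measure ℝ).restrict (Ioo 0 T)),
      ∫⁻ x : T3, ENNReal.ofReal (ρ (t, x)) * ENNReal.ofReal (logGain σ (1 - w (t, x))) ≤
        ENNReal.ofReal (∫ p, ρ p * Λ p ∂(spaceTime T)) := by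
  have hL0 : ∀ p, 0 ≤ logGain σ (1 - w p) := fun p =>
    logGain_nonneg hσ (by linarith [(hw01 p).2]) (by linarith [(hw01 p).1])
  have hLm : AEStronglyMeasurable (fun p => logGain σ (1 - w p)) (spaceTime T) :=
    ((measurable_logGain σ).comp (measurable_const.sub hwm)).aestronglyMeasurable
  have hL : MemLp (fun p => logGain σ (1 - w p)) ∞ (spaceTime T) :=
    memLp_top_of_bound hLm _ (Filter.Eventually.of_forall fun p =>
      abs_logGain_le hσ (by linarith [(hw01 p).2]) (by linarith [(hw01 p).1]))
  have hρL : Integrable (fun p => ρ p * logGain σ (1 - w p)) (spaceTime T) :=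
    (hρ.memLp.integrable (by norm_num)).mul_of_top_left hL
  set m : ℝ → ℝ := fun t => ∫ x : T3, ρ (t, x) * logGain σ (1 - w (t, x)) with hm
  have hmi : IntegrableOn m (Ioo 0 T) := hρL.integral_prod_left
  have h1 : ∀ᵐ t ∂((volume : Measure ℝ).restrict (Ioo 0 T)), (Ioo 0 T).indicator m t ≤
      ∫ p, ρ p * Λ p ∂(spaceTime T) := by
    refine ae_le_of_cutoff_ineq (hmi.integrable_indicator measurableSet_Ioo)
      fun χ hχ hχ0 hχ1 T' hT' hχT => ?_
    refine le_trans (le_of_eq ?_)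
      (hρ.logGain_limit_ineq hT hu hΛ hΛ0 hwm hw01 hw hσ hχ hχ0 hχ1 hT' hχT)
    have hd : MemLp (fun p : ℝ × T3 => deriv χ p.1) ∞ (spaceTime T) :=
      (IsC1.of_time hχ).memLp_top_timeDeriv
    have hi : Integrable (fun p => ρ p * (deriv χ p.1 * logGain σ (1 - w p))) (spaceTime T) :=
      (hρL.mul_of_top_right hd).congr (Filter.Eventually.of_forall fun p => by
        simp only [Pi.mul_apply]; ring)
    rw [spaceTime, integral_prod _ hi, ← integral_indicator measurableSet_Ioo]
    congr 2
    funext t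
    by_cases ht : t ∈ Ioo 0 T
    · rw [indicator_of_mem ht, indicator_of_mem ht, hm, ← integral_const_mul]
      refine integral_congr_ae (Filter.Eventually.of_forall fun x => ?_)
      ring
    · rw [indicator_of_notMem ht, indicator_of_notMem ht, mul_zero]
  have h2 := Measure.ae_ae_of_ae_prod hρ.nonneg
  have h3 : ∀ᵐ t ∂((volume : Measure ℝ).restrict (Ioo 0 T)),
      Integrable fun x : T3 => ρ (t, x) * logGain σ (1 - w (t, x)) := hρL.prod_right_ae
  filter_upwards [h1, h2, h3, ae_restrict_mem measurableSet_Ioo] with t ht1 ht2 ht3 hmem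
  rw [indicator_of_mem hmem] at ht1
  refine le_trans (le_of_eq ?_) (ENNReal.ofReal_le_ofReal ht1)
  rw [hm, ofReal_integral_eq_lintegral_ofReal ht3]
  · exact lintegral_congr_ae (Filter.Eventually.of_forall fun x =>
      (ENNReal.ofReal_mul' (hL0 _)).symm)
  · filter_upwards [ht2] with x hx
    exact mul_nonneg hx (hL0 _)

/-- The countably many values `σ = 1/(k+1)` share one null set of times; off it, Fatou's lemma
passes to `|log w|`, including points where `w = 0`. -/
theorem IsDensity.essSup_absLog_le (hT : 0 < T) (hu : IsL2W12 T u Du)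
    (hΛ : MemLp Λ 2 (spaceTime T)) (hΛ0 : ∀ᵐ p ∂(spaceTime T), 0 ≤ Λ p)
    (hρ : IsDensity T u h ρ₀ ρ) (hwm : Measurable w) (hw01 : ∀ p, 0 ≤ w p ∧ w p ≤ 1)
    (hw : IsWeakTransportSol T u Du Λ (fun _ => 1) w) :
    essSup (fun t => ∫⁻ x : T3, ENNReal.ofReal (ρ (t, x)) * absLog (w (t, x)))
      ((volume : Measure ℝ).restrict (Ioo 0 T)) ≤
        ENNReal.ofReal (∫ p, ρ p * Λ p ∂(spaceTime T)) := by
  refine essSup_le_of_ae_le _ ?_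
  have h1 := ae_all_iff.2 fun k : ℕ => hρ.ae_lintegral_logGain_le hT hu hΛ hΛ0 hwm hw01 hw
    (σ := 1 / ((k : ℝ) + 1)) (by positivity)
  have h2 : ∀ᵐ t ∂((volume : Measure ℝ).restrict (Ioo 0 T)),
      AEStronglyMeasurable fun x : T3 => ρ (t, x) := hρ.memLp.1.prodMk_left
  filter_upwards [h1, h2] with t ht1 ht2
  calc ∫⁻ x : T3, ENNReal.ofReal (ρ (t, x)) * absLog (w (t, x))
      = ∫⁻ x : T3, Filter.liminf (fun k : ℕ => ENNReal.ofReal (ρ (t, x)) *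
          ENNReal.ofReal (logGain (1 / ((k : ℝ) + 1)) (1 - w (t, x)))) Filter.atTop := by
        refine lintegral_congr fun x => (Filter.Tendsto.liminf_eq ?_).symm
        exact ENNReal.Tendsto.const_mul (tendsto_logGain_absLog (hw01 _).1 (hw01 _).2)
          (Or.inr ENNReal.ofReal_ne_top)
    _ ≤ Filter.liminf (fun k : ℕ => ∫⁻ x : T3, ENNReal.ofReal (ρ (t, x)) *
          ENNReal.ofReal (logGain (1 / ((k : ℝ) + 1)) (1 - w (t, x)))) Filter.atTop := by
        refine lintegral_liminf_le' fun k => ht2.aemeasurable.ennreal_ofReal.mul ?_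
        exact ((measurable_logGain _).comp (measurable_const.sub
          (hwm.comp measurable_prodMk_left))).ennreal_ofReal.aemeasurable
    _ ≤ _ := Filter.liminf_le_of_le (by isBoundedDefault) fun b hb => by
        obtain ⟨k, hk⟩ := hb.exists
        exact hk.trans (ht1 k)

end


/-! ### Integration over cubes of periodic functions -/

theorem measurable_toT3 : Measurable toT3 := continuous_toT3.measurable

/-- The cube `s³ ⊆ ℝ³`. -/
def cube (s : Set ℝ) : Set E3 := {z | ∀ i, z i ∈ s}

theorem map_toT3_restrict_cube {s : Set ℝ} (hs : MeasurableSet s) {c : ℝ≥0∞} (hc : c ≠ ∞)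
    (h : ((volume : Measure ℝ).restrict s).map (fun r : ℝ => (r : UnitAddCircle)) = c • volume) :
    ((volume : Measure E3).restrict (cube s)).map toT3 = c ^ 3 • volume := by
  have h1 : MeasurePreserving (WithLp.ofLp : E3 → Fin 3 → ℝ)
      ((volume : Measure E3).restrict (cube s)) (Measure.pi fun _ => volume.restrict s) := by
    have h0 := (PiLp.volume_preserving_ofLp (Fin 3)).restrict_preimage
      (s := univ.pi fun _ => s) (MeasurableSet.univ_pi fun _ => hs)
    have e1 : (WithLp.ofLp : E3 → Fin 3 → ℝ) ⁻¹' (univ.pi fun _ => s) = cube s := by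
      ext z; simp [cube]
    rwa [e1, volume_pi, Measure.restrict_pi_pi] at h0
  have hm : Measurable fun r : ℝ => (r : UnitAddCircle) := AddCircle.measurable_mk'
  have hfin : IsFiniteMeasure (c • (volume : Measure UnitAddCircle)) :=
    ⟨by simp [hc.lt_top]⟩
  have hsig : SigmaFinite (((volume : Measure ℝ).restrict s).map fun r : ℝ => (r : UnitAddCircle)) := by
    rw [h]; infer_instance
  have e2 : toT3 = (fun a : Fin 3 → ℝ => fun i => (a i : UnitAddCircle)) ∘ WithLp.ofLp := rfl
  have hm3 : Measurable fun a : Fin 3 → ℝ => fun i => (a i : UnitAddCircle) :=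
    measurable_pi_lambda _ fun i => hm.comp (measurable_pi_apply i)
  rw [e2, ← Measure.map_map hm3 h1.measurable, h1.map_eq, Measure.pi_map_pi fun _ => hm.aemeasurable,
    h]
  refine Measure.pi_eq fun t _ => ?_
  simp [volume_pi_pi, Finset.prod_mul_distrib]

/-- An interval of length `n` covers the circle exactly `n` times. -/
theorem map_mk_restrict_Ioc (a : ℝ) (n : ℕ) :
    ((volume : Measure ℝ).restrict (Ioc a (a + n))).map (fun r : ℝ => (r : UnitAddCircle)) =
      (n : ℝ≥0∞) • volume := by
  have hm : Measurable fun r : ℝ => (r : UnitAddCircle) := AddCircle.measurable_mk'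
  induction n with
  | zero => simp
  | succ n ih =>
    have e : Ioc a (a + (n + 1 : ℕ)) = Ioc a (a + n) ∪ Ioc (a + n) (a + n + 1) := by
      rw [Ioc_union_Ioc_eq_Ioc (by linarith [n.cast_nonneg (α := ℝ)]) (by linarith)]
      push_cast; rw [add_assoc]
    rw [e, Measure.restrict_union (Ioc_disjoint_Ioc_of_le le_rfl) measurableSet_Ioc,
      Measure.map_add _ _ hm, ih]
    have := (UnitAddCircle.measurePreserving_mk (a + n)).map_eq
    rw [show (fun r : ℝ => (r : UnitAddCircle)) = QuotientAddGroup.mk from rfl, this]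
    push_cast
    rw [add_smul, one_smul]

theorem setLIntegral_cube_comp_toT3 (a : ℝ) (n : ℕ) {f : T3 → ℝ≥0∞} (hf : Measurable f) :
    ∫⁻ z in cube (Ioc a (a + n)), f (toT3 z) = (n : ℝ≥0∞) ^ 3 * ∫⁻ y, f y := by
  rw [← lintegral_map hf measurable_toT3, map_toT3_restrict_cube measurableSet_Ioc
    (ENNReal.natCast_ne_top n) (map_mk_restrict_Ioc a n), lintegral_smul_measure, smul_eq_mul]

/-- Null sets of the torus lift to null sets of `ℝ³`, since countably many cubes exhaust the space.
This makes `maximalFunction` insensitive to changes on null sets. -/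
theorem quasiMeasurePreserving_add_toT3 (x : T3) :
    Measure.QuasiMeasurePreserving (fun z : E3 => x + toT3 z) := by
  have hm : Measurable fun z : E3 => x + toT3 z := measurable_toT3.const_add x
  refine ⟨hm, Measure.AbsolutelyContinuous.mk fun s hs h0 => ?_⟩
  rw [Measure.map_apply hm hs]
  have hU : (⋃ n : ℕ, cube (Ioc (-(n : ℝ)) (-n + (2 * n : ℕ)))) = univ := by
    refine eq_univ_of_forall fun z => mem_iUnion.2 ?_
    obtain ⟨n, hn⟩ := exists_nat_gt ‖z‖
    refine ⟨n, fun i => ?_⟩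
    have := abs_lt.1 (((Real.norm_eq_abs _).symm.le.trans (PiLp.norm_apply_le z i)).trans_lt hn)
    push_cast
    exact ⟨this.1, by linarith [this.2]⟩
  have hms := hm hs
  rw [← inter_univ ((fun z : E3 => x + toT3 z) ⁻¹' s), ← hU, inter_iUnion]
  refine measure_iUnion_null fun n => ?_
  rw [← Measure.restrict_apply hms]
  have hi : Measurable fun y : T3 => s.indicator (fun _ => (1 : ℝ≥0∞)) (x + y) :=
    (measurable_const.indicator hs).comp (measurable_const_add x)
  have h1 := setLIntegral_cube_comp_toT3 (-(n : ℝ)) (2 * n) hi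
  rw [lintegral_add_left_eq_self (fun y => s.indicator (fun _ => (1 : ℝ≥0∞)) y) x,
    lintegral_indicator_const hs, h0] at h1
  have h2 : (fun z : E3 => s.indicator (fun _ => (1 : ℝ≥0∞)) (x + toT3 z)) =
      ((fun z : E3 => x + toT3 z) ⁻¹' s).indicator fun _ => 1 := by
    rfl
  rw [h2, lintegral_indicator_const hms] at h1
  simpa using h1

/-! ### The dyadic centred maximal function on the torus -/

/-- The radii `2⁻⁽ⁿ⁺¹⁾`. -/
noncomputable def dyadicRadius (n : ℕ) : ℝ := (1 / 2) ^ (n + 1)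

theorem dyadicRadius_pos (n : ℕ) : 0 < dyadicRadius n := by unfold dyadicRadius; positivity

theorem two_mul_dyadicRadius (n : ℕ) : 2 * dyadicRadius n = (1 / 2) ^ n := by
  rw [dyadicRadius, pow_succ]; ring

theorem two_mul_dyadicRadius_le (n : ℕ) : 2 * dyadicRadius n ≤ 1 := by
  rw [two_mul_dyadicRadius]
  exact pow_le_one₀ (by norm_num) (by norm_num)

theorem volume_closedBall_T3 (x : T3) {r : ℝ} (hr : 0 ≤ r) :
    volume (Metric.closedBall x r) = ENNReal.ofReal (min 1 (2 * r)) ^ 3 := by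
  rw [closedBall_pi _ hr, volume_pi_pi]
  simp [AddCircle.volume_closedBall]

/-- The maximal function over dyadic balls of the sup metric of the torus. -/
noncomputable def dyadicMax (g : T3 → ℝ≥0∞) (x : T3) : ℝ≥0∞ :=
  ⨆ n : ℕ, (∫⁻ y in Metric.closedBall x (dyadicRadius n), g y) /
    volume (Metric.closedBall x (dyadicRadius n))

theorem setLIntegral_le_dyadicMax (g : T3 → ℝ≥0∞) (x : T3) (n : ℕ) :
    ∫⁻ y in Metric.closedBall x (dyadicRadius n), g y ≤
      ENNReal.ofReal (2 * dyadicRadius n) ^ 3 * dyadicMax g x := by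
  have h := le_iSup (fun n : ℕ => (∫⁻ y in Metric.closedBall x (dyadicRadius n), g y) /
    volume (Metric.closedBall x (dyadicRadius n))) n
  have hpos := dyadicRadius_pos n
  rw [volume_closedBall_T3 x hpos.le, min_eq_right (two_mul_dyadicRadius_le n)] at h
  rw [mul_comm]
  refine (ENNReal.div_le_iff_le_mul (Or.inl ?_) (Or.inl ?_)).1 h
  · exact pow_ne_zero _ (by rw [Ne, ENNReal.ofReal_eq_zero]; linarith)
  · exact ENNReal.pow_ne_top ENNReal.ofReal_ne_top

theorem closedBall_half (x : T3) : Metric.closedBall x (dyadicRadius 0) = univ := by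
  refine eq_univ_of_forall fun y => ?_
  rw [Metric.mem_closedBall, dist_pi_le_iff (dyadicRadius_pos 0).le]
  intro i
  rw [dist_eq_norm]
  have := AddCircle.norm_le_half_period (p := 1) (x := y i - x i) one_ne_zero
  simpa [dyadicRadius] using this

/-- The ball of radius `1/2` is the whole torus, of measure one. -/
theorem lintegral_le_dyadicMax (g : T3 → ℝ≥0∞) (x : T3) : ∫⁻ y, g y ≤ dyadicMax g x := by
  have h := setLIntegral_le_dyadicMax g x 0
  rw [closedBall_half, Measure.restrict_univ, two_mul_dyadicRadius] at h
  simpa using h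

/-- A ball with `r ≤ 1/2` fits into one fundamental cube and maps into a dyadic ball of comparable
radius. A larger one lies in a cube of side `2⌈r⌉ < 2r + 2 ≤ 6r`, over which periodicity gives
copies of the full integral. In both cases the constant is `6³ = 216`. -/
theorem setLIntegral_ball_le_dyadicMax {g : T3 → ℝ≥0∞} (hg : Measurable g) (x : T3) {r : ℝ}
    (hr : 0 < r) :
    ∫⁻ z in Metric.ball (0 : E3) r, g (x + toT3 z) ≤ 216 * ENNReal.ofReal r ^ 3 * dyadicMax g x := by
  have hcomp : ∀ {z : E3} {i : Fin 3}, z ∈ Metric.ball (0 : E3) r → |z i| < r := by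
    intro z i hz
    rw [mem_ball_zero_iff] at hz
    exact ((Real.norm_eq_abs _).symm.le.trans (PiLp.norm_apply_le z i)).trans_lt hz
  rcases le_or_gt r (1 / 2) with h | h
  -- This `n` satisfies `r ≤ dyadicRadius n < 2r`.
  · obtain ⟨n, hn1, hn2⟩ := exists_nat_pow_near_of_lt_one (x := 2 * r) (y := (1 / 2 : ℝ))
      (by positivity) (by linarith) (by norm_num) (by norm_num)
    rw [← two_mul_dyadicRadius n] at hn2
    have hs : Metric.ball (0 : E3) r ⊆ cube (Ioc (-(1 / 2)) (-(1 / 2) + (1 : ℕ))) := by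
      intro z hz i
      have := abs_lt.1 (hcomp (i := i) hz)
      push_cast
      exact ⟨by linarith [this.1], by linarith [this.2]⟩
    have hF : Measurable fun y : T3 => (Metric.closedBall x (dyadicRadius n)).indicator g (x + y) :=
      (hg.indicator Metric.isClosed_closedBall.measurableSet).comp (measurable_const_add x)
    calc ∫⁻ z in Metric.ball (0 : E3) r, g (x + toT3 z)
        ≤ ∫⁻ z in Metric.ball (0 : E3) r,
            (Metric.closedBall x (dyadicRadius n)).indicator g (x + toT3 z) := by
          refine setLIntegral_mono' measurableSet_ball fun z hz => ?_
          rw [indicator_of_mem]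
          rw [Metric.mem_closedBall, dist_eq_norm, add_sub_cancel_left,
            pi_norm_le_iff_of_nonneg (dyadicRadius_pos n).le]
          intro i
          have h3 : ‖toT3 z i‖ ≤ |z i| := QuotientAddGroup.norm_mk_le_norm
          linarith [hcomp (i := i) hz]
      _ ≤ ∫⁻ z in cube (Ioc (-(1 / 2)) (-(1 / 2) + (1 : ℕ))),
            (Metric.closedBall x (dyadicRadius n)).indicator g (x + toT3 z) :=
          lintegral_mono_set hs
      _ = ∫⁻ y in Metric.closedBall x (dyadicRadius n), g y := by
          rw [setLIntegral_cube_comp_toT3 _ _ hF, lintegral_add_left_eq_self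
            (fun y => (Metric.closedBall x (dyadicRadius n)).indicator g y) x,
            lintegral_indicator Metric.isClosed_closedBall.measurableSet]
          simp
      _ ≤ ENNReal.ofReal (2 * dyadicRadius n) ^ 3 * dyadicMax g x := setLIntegral_le_dyadicMax g x n
      _ ≤ ENNReal.ofReal (6 * r) ^ 3 * dyadicMax g x := by
          rw [pow_succ, ← two_mul_dyadicRadius] at hn1
          have h4 : 2 * dyadicRadius n ≤ 6 * r := by linarith
          gcongr
      _ = 216 * ENNReal.ofReal r ^ 3 * dyadicMax g x := by
          rw [ENNReal.ofReal_mul (by norm_num), mul_pow]; norm_num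
  · set k := ⌈r⌉₊ with hk
    have hk1 : r ≤ k := Nat.le_ceil r
    have hk2 : (k : ℝ) < r + 1 := Nat.ceil_lt_add_one hr.le
    have hs : Metric.ball (0 : E3) r ⊆ cube (Ioc (-(k : ℝ)) (-k + (2 * k : ℕ))) := by
      intro z hz i
      have := abs_lt.1 (hcomp (i := i) hz)
      push_cast
      exact ⟨by linarith [this.1], by linarith [this.2]⟩
    have hF : Measurable fun y : T3 => g (x + y) := hg.comp (measurable_const_add x)
    calc ∫⁻ z in Metric.ball (0 : E3) r, g (x + toT3 z)
        ≤ ∫⁻ z in cube (Ioc (-(k : ℝ)) (-k + (2 * k : ℕ))), g (x + toT3 z) := lintegral_mono_set hs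
      _ = ((2 * k : ℕ) : ℝ≥0∞) ^ 3 * ∫⁻ y, g y := by
          rw [setLIntegral_cube_comp_toT3 _ _ hF, lintegral_add_left_eq_self g x]
      _ ≤ ENNReal.ofReal (6 * r) ^ 3 * dyadicMax g x := by
          gcongr
          · rw [← ENNReal.ofReal_natCast]
            refine ENNReal.ofReal_le_ofReal ?_
            push_cast
            linarith
          · exact lintegral_le_dyadicMax g x
      _ = 216 * ENNReal.ofReal r ^ 3 * dyadicMax g x := by
          rw [ENNReal.ofReal_mul (by norm_num), mul_pow]; norm_num

theorem maximalFunction_le_dyadicMax {f : T3 → ℝ} (hf : Measurable f) (x : T3) :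
    maximalFunction f x ≤ 216 * dyadicMax (fun y => ‖f y‖ₑ) x := by
  refine iSup₂_le fun r hr => ?_
  rw [setLAverage_eq]
  refine ENNReal.div_le_of_le_mul ((setLIntegral_ball_le_dyadicMax hf.enorm x hr).trans ?_)
  have : ENNReal.ofReal r ^ 3 ≤ volume (Metric.ball (0 : E3) r) := by
    rw [EuclideanSpace.volume_ball_fin_three]
    refine le_mul_of_one_le_right' (ENNReal.one_le_ofReal.2 ?_)
    linarith [Real.pi_gt_three]
  calc 216 * ENNReal.ofReal r ^ 3 * dyadicMax (fun y => ‖f y‖ₑ) x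
      ≤ 216 * volume (Metric.ball (0 : E3) r) * dyadicMax (fun y => ‖f y‖ₑ) x := by gcongr
    _ = _ := by ring


/-! ### The maximal inequality -/

theorem measurable_dyadicMax {g : T3 → ℝ≥0∞} (hg : Measurable g) : Measurable (dyadicMax g) := by
  refine Measurable.iSup fun n => ?_
  have h1 : Measurable fun x : T3 => ∫⁻ y in Metric.closedBall x (dyadicRadius n), g y := by
    have hs : MeasurableSet {q : T3 × T3 | q.2 ∈ Metric.closedBall q.1 (dyadicRadius n)} :=
      measurableSet_le (measurable_snd.dist measurable_fst) measurable_const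
    have h2 : Measurable fun q : T3 × T3 =>
        (Metric.closedBall q.1 (dyadicRadius n)).indicator g q.2 :=
      (hg.comp measurable_snd).indicator hs
    have h3 := h2.lintegral_prod_right' (ν := (volume : Measure T3))
    simpa only [lintegral_indicator Metric.isClosed_closedBall.measurableSet] using h3
  simp only [volume_closedBall_T3 _ (dyadicRadius_pos n).le]
  exact h1.div_const _

/-- Weak type (1,1) by Vitali covering: enlarging disjoint balls five times costs `5³ = 125` in
volume. -/
theorem mul_volume_lt_dyadicMax_le {g : T3 → ℝ≥0∞} {c : ℝ≥0∞} :
    c * volume {x | c < dyadicMax g x} ≤ 125 * ∫⁻ y, g y := by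
  have hex : ∀ x, ∃ n, c < dyadicMax g x → c * volume (Metric.closedBall x (dyadicRadius n)) ≤
      ∫⁻ y in Metric.closedBall x (dyadicRadius n), g y := by
    intro x
    by_cases hx : c < dyadicMax g x
    · obtain ⟨n, hn⟩ := lt_iSup_iff.1 hx
      exact ⟨n, fun _ => ENNReal.mul_le_of_le_div hn.le⟩
    · exact ⟨0, fun h => absurd h hx⟩
  choose n hn using hex
  obtain ⟨U, hUt, hdisj, hcov⟩ := Vitali.exists_disjoint_subfamily_covering_enlargement_closedBall
    {x | c < dyadicMax g x} id (fun x => dyadicRadius (n x)) (1 / 2)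
    (fun x _ => by linarith [two_mul_dyadicRadius_le (n x)]) 5 (by norm_num)
  simp only [id] at hdisj hcov
  have hU : U.Countable := hdisj.countable_of_nonempty_interior fun x _ =>
    ⟨x, interior_mono Metric.ball_subset_closedBall (by
      rw [Metric.isOpen_ball.interior_eq]; exact Metric.mem_ball_self (dyadicRadius_pos _))⟩
  have hsub : {x | c < dyadicMax g x} ⊆ ⋃ b ∈ U, Metric.closedBall b (5 * dyadicRadius (n b)) := by
    intro x hx
    obtain ⟨b, hb, hxb⟩ := hcov x hx
    exact mem_iUnion₂.2 ⟨b, hb, hxb (Metric.mem_closedBall_self (dyadicRadius_pos _).le)⟩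
  have hvol : ∀ b : T3, volume (Metric.closedBall b (5 * dyadicRadius (n b))) ≤
      125 * volume (Metric.closedBall b (dyadicRadius (n b))) := by
    intro b
    have hp := dyadicRadius_pos (n b)
    rw [volume_closedBall_T3 _ hp.le, volume_closedBall_T3 _ (by positivity),
      min_eq_right (two_mul_dyadicRadius_le (n b))]
    calc ENNReal.ofReal (min 1 (2 * (5 * dyadicRadius (n b)))) ^ 3
        ≤ ENNReal.ofReal (5 * (2 * dyadicRadius (n b))) ^ 3 := by
          gcongr
          exact (min_le_right _ _).trans (by linarith)
      _ = _ := by rw [ENNReal.ofReal_mul (by norm_num), mul_pow]; norm_num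
  calc c * volume {x | c < dyadicMax g x}
      ≤ c * ∑' b : U, 125 * volume (Metric.closedBall (b : T3) (dyadicRadius (n b))) := by
        gcongr
        exact (measure_mono hsub).trans ((measure_biUnion_le _ hU _).trans
          (ENNReal.tsum_le_tsum fun b => hvol b))
    _ = 125 * ∑' b : U, c * volume (Metric.closedBall (b : T3) (dyadicRadius (n b))) := by
        rw [ENNReal.tsum_mul_left, ENNReal.tsum_mul_left]; ring
    _ ≤ 125 * ∑' b : U, ∫⁻ y in Metric.closedBall (b : T3) (dyadicRadius (n b)), g y := by
        gcongr with b
        exact hn b (hUt b.2)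
    _ = 125 * ∫⁻ y in ⋃ b ∈ U, Metric.closedBall b (dyadicRadius (n b)), g y := by
        rw [lintegral_biUnion hU (fun b _ => Metric.isClosed_closedBall.measurableSet) hdisj]
    _ ≤ 125 * ∫⁻ y, g y := by
        gcongr
        exact Measure.restrict_le_self

theorem dyadicMax_le_add_const {g g' : T3 → ℝ≥0∞} (hg' : Measurable g') {c : ℝ≥0∞}
    (h : ∀ y, g y ≤ g' y + c) (x : T3) : dyadicMax g x ≤ dyadicMax g' x + c := by
  refine iSup_le fun n => ?_
  set B := Metric.closedBall x (dyadicRadius n)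
  calc (∫⁻ y in B, g y) / volume B ≤ (∫⁻ y in B, (g' y + c)) / volume B := by
        gcongr with y
        exact h y
    _ = (∫⁻ y in B, g' y) / volume B + c * volume B / volume B := by
        rw [lintegral_add_left hg', setLIntegral_const, ENNReal.add_div]
    _ ≤ dyadicMax g' x + c := by
        refine add_le_add (le_iSup (fun n : ℕ => (∫⁻ y in Metric.closedBall x (dyadicRadius n),
          g' y) / volume (Metric.closedBall x (dyadicRadius n))) n) ?_
        rw [mul_div_assoc]
        exact mul_le_of_le_one_right' ENNReal.div_self_le_one

/-- Values of `g` below `c/2` add at most `c/2` to any average, so only the part above `c/2`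
matters. The weak bound at level `c/2` then gives `2 · 125`. -/
theorem mul_volume_lt_dyadicMax_le_setLIntegral {g : T3 → ℝ≥0∞} (hg : Measurable g) (c : ℝ≥0∞) :
    c * volume {x | c < dyadicMax g x} ≤ 250 * ∫⁻ y in {y | c < 2 * g y}, g y := by
  rcases eq_or_ne c ∞ with rfl | hc
  · simp
  have hs : MeasurableSet {y | c < 2 * g y} := measurableSet_lt measurable_const (hg.const_mul 2)
  set g' := {y | c < 2 * g y}.indicator g with hg'
  have hle : ∀ y, g y ≤ g' y + c / 2 := by
    intro y
    by_cases hy : c < 2 * g y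
    · rw [hg', indicator_of_mem (by exact hy)]
      exact le_self_add
    · rw [hg', indicator_of_notMem (by exact hy), zero_add, ENNReal.le_div_iff_mul_le (by simp)
        (by simp), mul_comm]
      exact not_lt.1 hy
  have hsub : {x | c < dyadicMax g x} ⊆ {x | c / 2 < dyadicMax g' x} := by
    intro x hx
    have h1 : c < dyadicMax g' x + c / 2 :=
      lt_of_lt_of_le hx (dyadicMax_le_add_const (hg.indicator hs) hle x)
    change c / 2 < dyadicMax g' x
    by_contra h2
    have h3 := add_le_add_left (not_lt.1 h2) (c / 2)
    rw [ENNReal.add_halves] at h3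
    exact absurd h1 (not_lt.2 h3)
  calc c * volume {x | c < dyadicMax g x} ≤ c * volume {x | c / 2 < dyadicMax g' x} := by gcongr
    _ = 2 * (c / 2 * volume {x | c / 2 < dyadicMax g' x}) := by
        rw [← mul_assoc, ENNReal.mul_div_cancel (by simp) (by simp)]
    _ ≤ 2 * (125 * ∫⁻ y, g' y) := by
        gcongr 2 * ?_
        exact mul_volume_lt_dyadicMax_le
    _ = 250 * ∫⁻ y in {y | c < 2 * g y}, g y := by
        rw [hg', lintegral_indicator hs, ← mul_assoc]; norm_num

theorem sq_le_lintegral_layer (a : ℝ≥0∞) :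
    a ^ 2 ≤ ∫⁻ s in Ioi (0 : ℝ), 2 * (ENNReal.ofReal s * (if ENNReal.ofReal s < a then 1 else 0)) := by
  have key : ∀ b : ℝ≥0, (b : ℝ≥0∞) ≤ a → (b : ℝ≥0∞) ^ 2 ≤
      ∫⁻ s in Ioi (0 : ℝ), 2 * (ENNReal.ofReal s * (if ENNReal.ofReal s < a then 1 else 0)) := by
    intro b hb
    have h1 : ∫⁻ s in Ioo (0 : ℝ) b, ENNReal.ofReal (2 * s) = (b : ℝ≥0∞) ^ 2 := by
      rw [restrict_Ioo_eq_restrict_Ioc, ← ofReal_integral_eq_lintegral_ofReal,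
        ← intervalIntegral.integral_of_le b.coe_nonneg]
      · have : ∫ s in (0 : ℝ)..b, 2 * s = (b : ℝ) ^ 2 := by
          rw [intervalIntegral.integral_const_mul, integral_id]; ring
        rw [this, ENNReal.ofReal_pow b.coe_nonneg]
        simp
      · exact ((continuous_const.mul continuous_id).integrableOn_Icc).mono_set Ioc_subset_Icc_self
      · filter_upwards [ae_restrict_mem measurableSet_Ioc] with s hs
        have := hs.1
        simp only [Pi.zero_apply]
        positivity
    rw [← h1]
    refine le_trans (setLIntegral_mono' measurableSet_Ioo fun s hs => ?_)
      (lintegral_mono_set Ioo_subset_Ioi_self)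
    have h2 : ENNReal.ofReal s < a := by
      refine lt_of_lt_of_le ?_ hb
      rw [ENNReal.ofReal_lt_coe_iff hs.1.le]
      exact hs.2
    rw [if_pos h2, mul_one, ENNReal.ofReal_mul (by norm_num)]
    simp
  rcases eq_or_ne a ∞ with rfl | ha
  · refine le_of_le_of_eq le_top (ENNReal.eq_top_of_forall_nnreal_le fun r => ?_).symm
    rcases le_total 1 r with h | h
    · refine le_trans ?_ (key r le_top)
      exact_mod_cast le_self_pow₀ h two_ne_zero
    · refine le_trans ?_ (key 1 le_top)
      simpa using h
  · lift a to ℝ≥0 using ha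
    exact key a le_rfl

theorem lintegral_layer_le (a : ℝ≥0∞) :
    ∫⁻ s in Ioi (0 : ℝ), (if ENNReal.ofReal s < a then (1 : ℝ≥0∞) else 0) ≤ a := by
  rcases eq_or_ne a ∞ with rfl | ha
  · exact le_top
  lift a to ℝ≥0 using ha
  calc ∫⁻ s in Ioi (0 : ℝ), (if ENNReal.ofReal s < a then (1 : ℝ≥0∞) else 0)
      ≤ ∫⁻ s in Ioi (0 : ℝ), (Ioo (0 : ℝ) a).indicator 1 s := by
        refine setLIntegral_mono' measurableSet_Ioi fun s hs => ?_
        have hs : 0 < s := hs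
        by_cases h : ENNReal.ofReal s < a
        · rw [if_pos h, indicator_of_mem (mem_Ioo.2 ⟨hs, (ENNReal.ofReal_lt_coe_iff hs.le).1 h⟩)]
          simp
        · rw [if_neg h]
          exact zero_le
    _ ≤ ∫⁻ s, (Ioo (0 : ℝ) a).indicator 1 s := setLIntegral_le_lintegral _ _
    _ = a := by
        rw [lintegral_indicator_one measurableSet_Ioo, Real.volume_Ioo]
        simp

/-- Marcinkiewicz interpolation by hand: the truncated weak estimate is inserted in the layer-cake
formula and the integrals are exchanged. The level integral over `s < 2g` is at most `2g`, whence `2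
· 250 · 2 = 1000`. -/
theorem lintegral_sq_dyadicMax_le {g : T3 → ℝ≥0∞} (hg : Measurable g) :
    ∫⁻ x, dyadicMax g x ^ 2 ≤ 1000 * ∫⁻ x, g x ^ 2 := by
  have hM := measurable_dyadicMax hg
  have hm1 : Measurable fun q : T3 × ℝ =>
      2 * (ENNReal.ofReal q.2 * (if ENNReal.ofReal q.2 < dyadicMax g q.1 then 1 else 0)) := by
    refine Measurable.const_mul (Measurable.mul (by fun_prop) ?_) 2
    exact Measurable.ite (measurableSet_lt (by fun_prop) (hM.comp measurable_fst))
      measurable_const measurable_const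
  have hm2 : Measurable fun q : ℝ × T3 =>
      (if ENNReal.ofReal q.1 < 2 * g q.2 then (1 : ℝ≥0∞) else 0) :=
    Measurable.ite (measurableSet_lt (by fun_prop) ((hg.comp measurable_snd).const_mul 2))
      measurable_const measurable_const
  have hm3 : Measurable fun q : ℝ × T3 =>
      g q.2 * (if ENNReal.ofReal q.1 < 2 * g q.2 then (1 : ℝ≥0∞) else 0) :=
    (hg.comp measurable_snd).mul hm2
  calc ∫⁻ x, dyadicMax g x ^ 2
      ≤ ∫⁻ x, ∫⁻ s in Ioi (0 : ℝ), 2 * (ENNReal.ofReal s *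
          (if ENNReal.ofReal s < dyadicMax g x then 1 else 0)) :=
        lintegral_mono fun x => sq_le_lintegral_layer _
    _ = ∫⁻ s in Ioi (0 : ℝ), ∫⁻ x, 2 * (ENNReal.ofReal s *
          (if ENNReal.ofReal s < dyadicMax g x then 1 else 0)) :=
        lintegral_lintegral_swap hm1.aemeasurable
    _ = ∫⁻ s in Ioi (0 : ℝ), 2 * (ENNReal.ofReal s *
          volume {x | ENNReal.ofReal s < dyadicMax g x}) := by
        refine lintegral_congr fun s => ?_
        have hs : MeasurableSet {x | ENNReal.ofReal s < dyadicMax g x} :=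
          measurableSet_lt measurable_const hM
        rw [lintegral_const_mul' _ _ (by simp), lintegral_const_mul' _ _ ENNReal.ofReal_ne_top,
          ← lintegral_indicator_one hs]
        congr 3
        funext x
        simp [indicator_apply]
    _ ≤ ∫⁻ s in Ioi (0 : ℝ), 2 * (250 * ∫⁻ y in {y | ENNReal.ofReal s < 2 * g y}, g y) := by
        refine lintegral_mono fun s => ?_
        gcongr 2 * ?_
        exact mul_volume_lt_dyadicMax_le_setLIntegral hg _
    _ = 500 * ∫⁻ s in Ioi (0 : ℝ), ∫⁻ y, g y *
          (if ENNReal.ofReal s < 2 * g y then (1 : ℝ≥0∞) else 0) := by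
        rw [← lintegral_const_mul' _ _ (by simp)]
        refine lintegral_congr fun s => ?_
        rw [← mul_assoc, ← lintegral_indicator
          (measurableSet_lt measurable_const (hg.const_mul 2))]
        norm_num
        congr 1
        refine lintegral_congr fun y => ?_
        simp [indicator_apply]
    _ = 500 * ∫⁻ y, ∫⁻ s in Ioi (0 : ℝ), g y *
          (if ENNReal.ofReal s < 2 * g y then (1 : ℝ≥0∞) else 0) := by
        rw [lintegral_lintegral_swap hm3.aemeasurable]
    _ ≤ 500 * ∫⁻ y, 2 * g y ^ 2 := by
        gcongr with y
        have hy : Measurable fun s : ℝ => if ENNReal.ofReal s < 2 * g y then (1 : ℝ≥0∞) else 0 :=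
          hm2.comp measurable_prodMk_right
        rw [lintegral_const_mul _ hy]
        calc _ ≤ g y * (2 * g y) := by gcongr; exact lintegral_layer_le _
          _ = _ := by ring
    _ = 1000 * ∫⁻ x, g x ^ 2 := by
        rw [lintegral_const_mul' _ _ (by simp), ← mul_assoc]; norm_num


/-! ### The damping rate -/

/-- Reduces to countably many radii, for measurability. A ball is the increasing union of its
rational sub-balls; the integrals converge and the sub-balls have no larger volume. -/
theorem maximalFunction_eq_iSup_rat (f : T3 → ℝ) (x : T3) :
    maximalFunction f x = ⨆ (q : ℚ) (_ : 0 < q),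
      ⨍⁻ z in Metric.ball (0 : E3) q, ‖f (x + toT3 z)‖ₑ ∂volume := by
  refine le_antisymm (iSup₂_le fun r hr => ?_)
    (iSup₂_le fun q hq => le_iSup₂_of_le (q : ℝ) (by exact_mod_cast hq) le_rfl)
  set S := ⨆ (q : ℚ) (_ : 0 < q), ⨍⁻ z in Metric.ball (0 : E3) q, ‖f (x + toT3 z)‖ₑ ∂volume with hS
  rw [setLAverage_eq]
  refine ENNReal.div_le_of_le_mul ?_
  obtain ⟨v, hv, hvr, hvlim⟩ := Real.exists_seq_rat_strictMono_tendsto r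
  have hmono : Monotone fun n => Metric.ball (0 : E3) (v n) := fun m n hmn =>
    Metric.ball_subset_ball (by exact_mod_cast hv.monotone hmn)
  have hU : Metric.ball (0 : E3) r = ⋃ n, Metric.ball (0 : E3) (v n) := by
    ext z
    simp only [mem_iUnion, mem_ball_zero_iff]
    exact ⟨fun hz => (hvlim.eventually_const_lt hz).exists, fun ⟨n, hn⟩ => hn.trans (hvr n)⟩
  have h1 : ∫⁻ z in Metric.ball (0 : E3) r, ‖f (x + toT3 z)‖ₑ =
      ⨆ n, ∫⁻ z in Metric.ball (0 : E3) (v n), ‖f (x + toT3 z)‖ₑ := by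
    rw [hU]
    exact setLIntegral_iUnion_of_directed _ hmono.directed_le
  rw [h1]
  refine iSup_le fun n => ?_
  rcases le_or_gt (v n) 0 with h | h
  · rw [Metric.ball_eq_empty.2 (by exact_mod_cast h)]
    simp
  · have h2 : (∫⁻ z in Metric.ball (0 : E3) (v n), ‖f (x + toT3 z)‖ₑ) /
        volume (Metric.ball (0 : E3) (v n)) ≤ S := by
      rw [← setLAverage_eq]
      exact le_iSup₂_of_le (v n) h le_rfl
    have hpos : (0 : ℝ) < v n := by exact_mod_cast h
    have h3 := (ENNReal.div_le_iff_le_mul (Or.inl (Metric.measure_ball_pos volume _ hpos).ne')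
      (Or.inl measure_ball_lt_top.ne)).1 h2
    refine h3.trans ?_
    gcongr
    exact (hvr n).le

theorem measurable_maximalFunction {α : Type*} [MeasurableSpace α] {f : α × T3 → ℝ}
    (hf : Measurable f) : Measurable fun p : α × T3 => maximalFunction (fun y => f (p.1, y)) p.2 := by
  simp_rw [maximalFunction_eq_iSup_rat, setLAverage_eq]
  refine Measurable.iSup fun q => Measurable.iSup fun _ => Measurable.div_const ?_ _
  have h : Measurable fun s : (α × T3) × E3 => ‖f (s.1.1, s.1.2 + toT3 s.2)‖ₑ := by
    refine (hf.comp ?_).enorm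
    exact (measurable_fst.comp measurable_fst).prodMk
      ((measurable_snd.comp measurable_fst).add (measurable_toT3.comp measurable_snd))
  exact h.lintegral_prod_right'

theorem maximalFunction_congr_ae {f g : T3 → ℝ} (h : f =ᵐ[volume] g) :
    maximalFunction f = maximalFunction g := by
  funext x
  have h1 : ∀ᵐ z : E3, f (x + toT3 z) = g (x + toT3 z) :=
    (quasiMeasurePreserving_add_toT3 x).ae h
  refine iSup_congr fun r => iSup_congr fun _ => ?_
  rw [setLAverage_eq, setLAverage_eq]
  congr 1
  refine lintegral_congr_ae (ae_restrict_of_ae ?_)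
  filter_upwards [h1] with z hz
  rw [hz]

/-- The constant is a square above `216² · 1000`: `6912 = 216 · 32` and `32² ≥ 1000`. -/
theorem lintegral_sq_maximalFunction_le {f : T3 → ℝ} (hf : AEStronglyMeasurable f) :
    ∫⁻ x, maximalFunction f x ^ 2 ≤ 6912 ^ 2 * ∫⁻ x, ‖f x‖ₑ ^ 2 := by
  have hg : Measurable (hf.mk f) := hf.stronglyMeasurable_mk.measurable
  have e : ∫⁻ x, ‖f x‖ₑ ^ 2 = ∫⁻ x, ‖hf.mk f x‖ₑ ^ 2 := by
    refine lintegral_congr_ae ?_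
    filter_upwards [hf.ae_eq_mk] with x hx
    rw [← hx]
  rw [maximalFunction_congr_ae hf.ae_eq_mk, e]
  calc ∫⁻ x, maximalFunction (hf.mk f) x ^ 2
      ≤ ∫⁻ x, 216 ^ 2 * dyadicMax (fun y => ‖hf.mk f y‖ₑ) x ^ 2 := by
        refine lintegral_mono fun x => ?_
        rw [← mul_pow]
        exact pow_le_pow_left' (maximalFunction_le_dyadicMax hg x) 2
    _ ≤ 216 ^ 2 * (1000 * ∫⁻ x, ‖hf.mk f x‖ₑ ^ 2) := by
        rw [lintegral_const_mul' _ _ (by simp)]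
        gcongr 216 ^ 2 * ?_
        exact lintegral_sq_dyadicMax_le hg.enorm
    _ ≤ 6912 ^ 2 * ∫⁻ x, ‖hf.mk f x‖ₑ ^ 2 := by
        rw [← mul_assoc]
        gcongr
        norm_num

section

variable {T : ℝ} {Du : ℝ × T3 → Mat3} {G : ℝ × T3 → ℝ}

/-- Pass to a measurable version of `Du`. For almost every time the two slices agree almost
everywhere, and then their maximal functions agree at every point. -/
theorem aemeasurable_maximalFunction (hDu : AEStronglyMeasurable Du (spaceTime T)) :
    AEMeasurable (fun p => maximalFunction (fun y => ‖Du (p.1, y)‖) p.2) (spaceTime T) := by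
  refine ⟨_, measurable_maximalFunction hDu.stronglyMeasurable_mk.norm.measurable, ?_⟩
  have h1 := Measure.ae_ae_of_ae_prod hDu.ae_eq_mk
  filter_upwards [Measure.quasiMeasurePreserving_fst.ae h1] with p hp
  refine congrFun (maximalFunction_congr_ae ?_) p.2
  filter_upwards [hp] with y hy
  rw [hy]

theorem eLpNorm_maximalFunction_le (hDu : AEStronglyMeasurable Du (spaceTime T)) :
    eLpNorm (fun p => (maximalFunction (fun y => ‖Du (p.1, y)‖) p.2).toReal) 2 (spaceTime T) ≤
      6912 * eLpNorm Du 2 (spaceTime T) := by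
  rw [← ENNReal.pow_le_pow_left_iff two_ne_zero, ← lintegral_enorm_sq_eq, mul_pow, ← eLpNorm_norm Du,
    ← lintegral_enorm_sq_eq]
  have h1 : ∀ᵐ t ∂((volume : Measure ℝ).restrict (Ioo 0 T)),
      AEStronglyMeasurable fun x : T3 => ‖Du (t, x)‖ := hDu.norm.prodMk_left
  calc ∫⁻ p, ‖(maximalFunction (fun y => ‖Du (p.1, y)‖) p.2).toReal‖ₑ ^ 2 ∂(spaceTime T)
      ≤ ∫⁻ p, maximalFunction (fun y => ‖Du (p.1, y)‖) p.2 ^ 2 ∂(spaceTime T) := by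
        refine lintegral_mono fun p => pow_le_pow_left' ?_ 2
        rw [Real.enorm_eq_ofReal ENNReal.toReal_nonneg]
        exact ENNReal.ofReal_toReal_le
    _ = ∫⁻ t in Ioo 0 T, ∫⁻ x, maximalFunction (fun y => ‖Du (t, y)‖) x ^ 2 :=
        lintegral_prod _ ((aemeasurable_maximalFunction hDu).pow_const 2)
    _ ≤ ∫⁻ t in Ioo 0 T, 6912 ^ 2 * ∫⁻ x, ‖‖Du (t, x)‖‖ₑ ^ 2 := by
        refine lintegral_mono_ae ?_
        filter_upwards [h1] with t ht
        exact lintegral_sq_maximalFunction_le ht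
    _ = 6912 ^ 2 * ∫⁻ p, ‖‖Du p‖‖ₑ ^ 2 ∂(spaceTime T) := by
        rw [lintegral_const_mul' _ _ (by simp), spaceTime,
          lintegral_prod _ (hDu.norm.enorm.pow_const 2)]

variable {a₁ a₂ a₃ : ℝ}

theorem weightRate_nonneg (ha₁ : 0 ≤ a₁) (ha₂ : 0 ≤ a₂) (ha₃ : 0 ≤ a₃) (p : ℝ × T3) :
    0 ≤ weightRate a₁ a₂ a₃ Du G p := by
  have := ENNReal.toReal_nonneg (a := maximalFunction (fun y => ‖Du (p.1, y)‖) p.2)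
  unfold weightRate
  positivity

theorem aestronglyMeasurable_weightRate (hDu : AEStronglyMeasurable Du (spaceTime T))
    (hG : AEStronglyMeasurable G (spaceTime T)) :
    AEStronglyMeasurable (weightRate a₁ a₂ a₃ Du G) (spaceTime T) :=
  (aestronglyMeasurable_const.add
    ((aemeasurable_maximalFunction hDu).ennreal_toReal.aestronglyMeasurable.const_mul a₂)).add
      (hG.norm.const_mul a₃)

theorem eLpNorm_weightRate_le (hDu : AEStronglyMeasurable Du (spaceTime T))
    (hG : AEStronglyMeasurable G (spaceTime T)) :
    eLpNorm (weightRate a₁ a₂ a₃ Du G) 2 (spaceTime T) ≤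
      eLpNorm (fun _ : ℝ × T3 => a₁) 2 (spaceTime T) +
        ‖a₂‖ₑ * (6912 * eLpNorm Du 2 (spaceTime T)) + ‖a₃‖ₑ * eLpNorm G 2 (spaceTime T) := by
  have m2 := (aemeasurable_maximalFunction hDu).ennreal_toReal.aestronglyMeasurable.const_mul a₂
  have m3 : AEStronglyMeasurable (fun p => a₃ * |G p|) (spaceTime T) := hG.norm.const_mul a₃
  have m12 := (aestronglyMeasurable_const (b := a₁)).add m2
  refine (eLpNorm_add_le m12 m3 one_le_two).trans (add_le_add
    ((eLpNorm_add_le aestronglyMeasurable_const m2 one_le_two).trans (add_le_add le_rfl ?_)) ?_)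
  · refine (eLpNorm_const_smul_le (c := a₂)).trans ?_
    gcongr
    exact eLpNorm_maximalFunction_le hDu
  · refine (eLpNorm_const_smul_le (c := a₃) (f := fun p => |G p|)).trans ?_
    gcongr
    exact (eLpNorm_norm G).le

end

/-! ### Conclusion. -/

theorem ofReal_integral_mul_le {α : Type*} [MeasurableSpace α] {μ : Measure α} {f g : α → ℝ}
    (hf : MemLp f 2 μ) (hg : MemLp g 2 μ) :
    ENNReal.ofReal (∫ a, f a * g a ∂μ) ≤ eLpNorm f 2 μ * eLpNorm g 2 μ := by
  rw [← inner_toLp hf hg]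
  refine (ENNReal.ofReal_le_ofReal (real_inner_le_norm _ _)).trans (le_of_eq ?_)
  rw [ENNReal.ofReal_mul (norm_nonneg _), Lp.norm_toLp, Lp.norm_toLp, ENNReal.ofReal_toReal hf.2.ne,
    ENNReal.ofReal_toReal hg.2.ne]

theorem mainTheorem4 (T : ℝ) (hT : 0 < T) (a₁ a₂ a₃ : ℝ)
    (ha₁ : 0 ≤ a₁) (ha₂ : 0 ≤ a₂) (ha₃ : 0 ≤ a₃) (M : ℝ≥0) :
    ∃ C : ℝ≥0, ∀ (u : ℝ × T3 → E3) (Du : ℝ × T3 → Mat3) (G h ρ : ℝ × T3 → ℝ) (ρ₀ : T3 → ℝ),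
      IsL2W12 T u Du → MemLp G 2 (spaceTime T) → IsDensity T u h ρ₀ ρ →
      eLpNorm Du 2 (spaceTime T) ≤ M → eLpNorm G 2 (spaceTime T) ≤ M →
      eLpNorm ρ 2 (spaceTime T) ≤ M →
      ∃ w : ℝ × T3 → ℝ,
        IsWeakTransportSol T u Du (weightRate a₁ a₂ a₃ Du G) (fun _ => 1) w ∧
        (∀ t ∈ Ioo 0 T, ∀ x : T3, 0 ≤ w (t, x) ∧ w (t, x) ≤ 1) ∧
        essSup (fun t => ∫⁻ x : T3, ENNReal.ofReal (ρ (t, x)) * absLog (w (t, x)))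
          ((volume : Measure ℝ).restrict (Ioo 0 T)) ≤ C := by

  set N : ℝ≥0∞ := eLpNorm (fun _ : ℝ × T3 => a₁) 2 (spaceTime T) + ‖a₂‖ₑ * (6912 * M) + ‖a₃‖ₑ * M
    with hN
  have hNtop : N ≠ ∞ := by
    have h1 : eLpNorm (fun _ : ℝ × T3 => a₁) 2 (spaceTime T) ≠ ∞ := (memLp_const a₁).2.ne
    have h2 : ‖a₂‖ₑ * (6912 * (M : ℝ≥0∞)) ≠ ∞ :=
      ENNReal.mul_ne_top enorm_ne_top (ENNReal.mul_ne_top (by simp) ENNReal.coe_ne_top)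
    have h3 : ‖a₃‖ₑ * (M : ℝ≥0∞) ≠ ∞ := ENNReal.mul_ne_top enorm_ne_top ENNReal.coe_ne_top
    exact ENNReal.add_ne_top.2 ⟨ENNReal.add_ne_top.2 ⟨h1, h2⟩, h3⟩
  -- Cauchy–Schwarz for `∫∫ρΛ`: `M` bounds `‖ρ‖₂` and `N` bounds `‖Λ‖₂`.
  refine ⟨M * N.toNNReal, fun u Du G h ρ ρ₀ hu hG hρ hDuM hGM hρM => ?_⟩
  have hDum := hu.memLp_grad.1
  have hΛN : eLpNorm (weightRate a₁ a₂ a₃ Du G) 2 (spaceTime T) ≤ N :=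
    (eLpNorm_weightRate_le hDum hG.1).trans (by rw [hN]; gcongr)
  have hΛ : MemLp (weightRate a₁ a₂ a₃ Du G) 2 (spaceTime T) :=
    ⟨aestronglyMeasurable_weightRate hDum hG.1, hΛN.trans_lt hNtop.lt_top⟩
  have hΛ0 : ∀ᵐ p ∂(spaceTime T), 0 ≤ weightRate a₁ a₂ a₃ Du G p :=
    Filter.Eventually.of_forall (weightRate_nonneg ha₁ ha₂ ha₃)
  obtain ⟨w, hwm, hw01, hw⟩ := exists_weak_solution hT hu hΛ hΛ0
  refine ⟨w, hw, fun t _ x => hw01 (t, x), ?_⟩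
  refine (hρ.essSup_absLog_le hT hu hΛ hΛ0 hwm hw01 hw).trans
    ((ofReal_integral_mul_le hρ.memLp hΛ).trans ?_)
  rw [ENNReal.coe_mul, ENNReal.coe_toNNReal hNtop]
  gcongr
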